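/- **Theorem 2.1.** Let $g>0$ and $H_0>0$, and put $a=(\tfrac23 g^2H_0)^{1/3}$ and $\tau=ar$. (i) The two-point boundary value problem $$KU=-\frac{1-K^2}{\tau^2}\frac{dK}{d\tau},\qquad \frac{dU}{d\tau}=\frac{(1-K^2)^2}{\tau^4}\qquad(0<\tau<\infty),$$ $$K(0)=1,\quad U(0)=0,\quad K(\infty)=0,\quad U(\infty)=1,$$ has exactly one solution $(K,U)$ among pairs of real functions of $r\in[0,\infty)$ that are differentiable on $(0,\infty)$ and continuous at $0$. In this solution, $K$ is strictly decreasing and $U$ is strictly increasing. (ii) For some constant $C>0$, $$K=O(e^{-Cr^3}),\quad U=1+O(r^{-3})\quad(r\to\infty),\qquad K=1+O(r^2),\quad U=O(r)\quad(r\to0).$$ These rates are sharp: $e^{-C'r^3}=O(K)$ as $r\to\infty$ for some $C'>0$; the quantity $1-U$ is also bounded below by a positive multiple of $r^{-3}$ as $r\to\infty$; and $1-K$ and $U$ are bounded below by positive multiples of $r^2$ and of $r$, respectively, as $r\to0$. (iii) Let $\gamma_1,\dots,\gamma_5$ be Hermitian $4\times4$ matrices with $\gamma_a\gamma_b+\gamma_b\gamma_a=2\delta_{ab}$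 and $\gamma_1\gamma_2\gamma_3\gamma_4\gamma_5=1$. On $\mathbb R^5$, with $r=|x|$ and $e=x^a\gamma_a/r$, let $$\phi=H_0U(r)\,e,\qquad A=\frac{1-K(r)}{2g}\,e\,de,$$ both set to $0$ at the origin, and let $F=dA+gA\wedge A$ and $D_A\phi=d\phi+g[A,\phi]$. Then $(A,\phi)$ is a static, spherically symmetric, finite-energy $SO(5)$ monopole of unit topological charge in six-dimensional Minkowski space-time (with $A_0=0$). That is: * $A$ takes values in $so(5)=\mathrm{span}\{\gamma_a\gamma_b: a\ne b\}$ and $\phi$ in the vector representation $\mathrm{span}\{\gamma_a\}$, and both are $C^1$ on $\mathbb R^5$. * The Bogomolny equation $*_5(F\wedge F)=D_A\phi$ holds on $\mathbb R^5$. * For every rotation $R\in SO(5)$, the pull-back of $(A,\phi)$ by $R$ agrees with $(A,\phi)$ up to a global gauge transformation (conjugation by a unitary matrix that induces an element of $SO(5)$ on $\mathrm{span}\{\gamma_a\}$). * For every $\lambda\ge0$, the energy density $\tfrac1{8\cdot4!}\mathrm{Tr}\,(F^2)_{ijkl}(F^2)_{ijkl}+\tfrac18\mathrm{Tr}\,D_m\phi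 D_m\phi+\lambda(\phi^a\phi_a-H_0^2)^2$ is integrable over $\mathbb R^5$. Here $\phi=\phi^a\gamma_a$, and $(F^2)_{ijkl}$ are the components of the four-form $F\wedge F=\tfrac1{4!}(F^2)_{ijkl}\,dx^i\wedge dx^j\wedge dx^k\wedge dx^l$. * The topological charge $\Psi=\dfrac{g^2}{16\pi^2H_0}\displaystyle\int_{\mathbb R^5}\mathrm{Tr}\,(D_A\phi\wedge F\wedge F)$ equals $1$. The configuration is unique in the following sense. Let $\tilde K,\tilde U$ be any functions that are differentiable on $(0,\infty)$, continuous at $0$, and have the boundary values in (i). If the configuration of the above form built from $(\tilde K,\tilde U)$ satisfies the Bogomolny equation on $\mathbb R^5\setminus\{0\}$, then $\tilde K=K$ and $\tilde U=U$ on $[0,\infty)$. -/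

import Mathlib

open Set Filter Topology Asymptotics MeasureTheory

namespace Monopole

noncomputable section

/-! ### The two-point boundary value problem -/

/-- `(k, u)`, as functions of the rescaled radius `τ ∈ [0, ∞)`, are differentiable on `(0, ∞)`,
satisfy there
`k u = -(1 - k²) k' / τ²` and `u' = (1 - k²)² / τ⁴`,
and take (continuously) the boundary values
`k(0) = 1`, `u(0) = 0`, `k(∞) = 0`, `u(∞) = 1`.
Values at negative arguments are irrelevant. -/
structure IsProfile (k u : ℝ → ℝ) : Prop where
  differentiableAt_k : ∀ τ > 0, DifferentiableAt ℝ k τ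
  differentiableAt_u : ∀ τ > 0, DifferentiableAt ℝ u τ
  eq_k : ∀ τ > 0, k τ * u τ = -((1 - k τ ^ 2) * deriv k τ / τ ^ 2)
  eq_u : ∀ τ > 0, deriv u τ = (1 - k τ ^ 2) ^ 2 / τ ^ 4
  k_zero : k 0 = 1
  u_zero : u 0 = 0
  continuousWithinAt_k : ContinuousWithinAt k (Ici 0) 0
  continuousWithinAt_u : ContinuousWithinAt u (Ici 0) 0
  tendsto_k : Tendsto k atTop (𝓝 0)
  tendsto_u : Tendsto u atTop (𝓝 1)

/-- The constant `a = (2 g² H₀ / 3)^(1/3)` of the change of variable `τ = a r`. -/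
def scale (g H₀ : ℝ) : ℝ := (2 * g ^ 2 / 3 * H₀) ^ (1 / 3 : ℝ)

/-- `K` and `U`, as functions of `r`, solve the boundary value problem: written in the variable
`τ = a r` they form a profile. -/
def SolvesBVP (g H₀ : ℝ) (K U : ℝ → ℝ) : Prop :=
  IsProfile (fun τ => K (τ / scale g H₀)) (fun τ => U (τ / scale g H₀))

/-! ### Static `SO(5)` gauge theory on `ℝ⁵`, in the Clifford (spinor) representation -/

/-- Five-dimensional space. -/
abbrev Space : Type := EuclideanSpace ℝ (Fin 5)

/-- The `4 × 4` complex matrices, in which the Clifford algebra is represented. -/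
abbrev Mat : Type := Matrix (Fin 4) (Fin 4) ℂ

/-- Euclidean gamma matrices in five dimensions: Hermitian `4 × 4` matrices with
`γ_a γ_b + γ_b γ_a = 2 δ_{ab}`, of the chirality `γ₁ γ₂ γ₃ γ₄ γ₅ = 1`. -/
structure IsGamma (γ : Fin 5 → Mat) : Prop where
  hermitian : ∀ a, (γ a).IsHermitian
  clifford : ∀ a b, γ a * γ b + γ b * γ a = if a = b then 2 else 0
  chirality : γ 0 * γ 1 * γ 2 * γ 3 * γ 4 = 1

/-- Gamma matrices exist. -/
theorem exists_isGamma : ∃ γ : Fin 5 → Mat, IsGamma γ := by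
  obtain ⟨G, h1, h2, h3⟩ : ∃ G : Fin 5 → Matrix (Fin 4) (Fin 4) GaussianInt,
      (∀ a, (G a).conjTranspose = G a) ∧
      (∀ a b, G a * G b + G b * G a = if a = b then 1 + 1 else 0) ∧
      G 0 * G 1 * G 2 * G 3 * G 4 = 1 := by
    let I : GaussianInt := ⟨0, 1⟩
    refine ⟨![!![0, 0, 0, 1; 0, 0, 1, 0; 0, 1, 0, 0; 1, 0, 0, 0],
      !![0, 0, 0, -I; 0, 0, I, 0; 0, -I, 0, 0; I, 0, 0, 0],
      !![0, 0, 1, 0; 0, 0, 0, -1; 1, 0, 0, 0; 0, -1, 0, 0],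
      !![0, 0, -I, 0; 0, 0, 0, -I; I, 0, 0, 0; 0, I, 0, 0],
      !![-1, 0, 0, 0; 0, -1, 0, 0; 0, 0, 1, 0; 0, 0, 0, 1]], ?_, ?_, ?_⟩
    all_goals decide
  let f : Matrix (Fin 4) (Fin 4) GaussianInt →+* Mat := GaussianInt.toComplex.mapMatrix
  refine ⟨fun a => f (G a), fun a => ?_, fun a b => ?_, ?_⟩
  · change (f (G a)).conjTranspose = f (G a)
    conv_rhs => rw [← h1 a]
    refine Matrix.ext fun i j => ?_
    exact (GaussianInt.toComplex_star (G a j i)).symm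
  · rw [← map_mul, ← map_mul, ← map_add, h2]
    split_ifs
    · rw [map_add, map_one, one_add_one_eq_two]
    · rw [map_zero]
  · simp only [← map_mul, h3, map_one]

/-- The partial derivative `∂_i M` of a matrix-valued function, taken entry by entry. -/
def pderiv (i : Fin 5) (M : Space → Mat) (x : Space) : Mat :=
  Matrix.of fun p q => fderiv ℝ (fun y => M y p q) x (EuclideanSpace.single i 1)

/-- The Levi-Civita symbol `ε_{ijklm}`. -/
def leviCivita (i j k l m : Fin 5) : ℝ :=
  (Matrix.of fun p q : Fin 5 => if ![i, j, k, l, m] p = q then (1 : ℝ) else 0).det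

/-- A gauge potential `A = ∑ A_i dx^i`: `A x i` is the component `A_i` at `x`. -/
abbrev Potential : Type := Space → Fin 5 → Mat

/-- A Higgs field. -/
abbrev Higgs : Type := Space → Mat

/-- `A` takes values in the Lie algebra `so(5)`, spanned by the `γ_a γ_b` with `a ≠ b`, and the
Higgs field in the vector representation, spanned by the `γ_a`. -/
def IsSO5Valued (γ : Fin 5 → Mat) (A : Potential) (φ : Higgs) : Prop :=
  (∀ x i, A x i ∈ Submodule.span ℝ {M : Mat | ∃ a b, a ≠ b ∧ M = γ a * γ b}) ∧
    ∀ x, φ x ∈ Submodule.span ℝ (range γ)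

/-- Both fields are continuously differentiable on all of `ℝ⁵`. -/
def IsC1 (A : Potential) (φ : Higgs) : Prop :=
  (∀ i p q, ContDiff ℝ 1 fun x => A x i p q) ∧ ∀ p q, ContDiff ℝ 1 fun x => φ x p q

/-- The components `F_{ij} = ∂_i A_j - ∂_j A_i + g [A_i, A_j]` of the field strength
`F = dA + g A ∧ A`. -/
def fieldStrength (g : ℝ) (A : Potential) (x : Space) (i j : Fin 5) : Mat :=
  pderiv i (fun y => A y j) x - pderiv j (fun y => A y i) x + g • (A x i * A x j - A x j * A x i)

/-- The components `D_m φ = ∂_m φ + g [A_m, φ]` of the covariant derivative. -/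
def covDeriv (g : ℝ) (A : Potential) (φ : Higgs) (x : Space) (m : Fin 5) : Mat :=
  pderiv m φ x + g • (A x m * φ x - φ x * A x m)

/-- The components of the one-form `*₅ (F ∧ F)`. As `F ∧ F = (1/4) F_{ij} F_{kl} dx^{ijkl}` and
`*₅ dx^{ijkl} = ε_{ijklm} dx^m`, they are `(1/4) ε_{ijklm} F_{ij} F_{kl}`. -/
def starFF (g : ℝ) (A : Potential) (x : Space) (m : Fin 5) : Mat :=
  (1 / 4 : ℝ) • ∑ i, ∑ j, ∑ k, ∑ l,
    leviCivita i j k l m • (fieldStrength g A x i j * fieldStrength g A x k l)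

/-- The Bogomolny equation `*₅ (F ∧ F) = D_A φ` at the point `x`. -/
def BogomolnyAt (g : ℝ) (A : Potential) (φ : Higgs) (x : Space) : Prop :=
  ∀ m, starFF g A x m = covDeriv g A φ x m

/-- The energy density of a static configuration (with `A₀ = 0`),
`(1/(8·4!)) Tr (F²)_{ijkl} (F²)_{ijkl} + (1/8) Tr (D_m φ)(D_m φ) + lam (φ^a φ^a - H₀²)²`,
where `lam` is the coupling of the Higgs potential. Here `φ^a φ^a = (1/4) Tr φ²`, and the first
term is `(1/8) Tr B_m B_m` with `B = *₅ (F ∧ F)`. -/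
def energyDensity (g H₀ lam : ℝ) (A : Potential) (φ : Higgs) (x : Space) : ℝ :=
  1 / 8 * (∑ m, (starFF g A x m * starFF g A x m).trace).re +
    1 / 8 * (∑ m, (covDeriv g A φ x m * covDeriv g A φ x m).trace).re +
    lam * (1 / 4 * (φ x * φ x).trace.re - H₀ ^ 2) ^ 2

/-- The topological charge `Ψ`, given by `(16 π² / g²) H₀ Ψ = ∫ Tr (D_A φ ∧ F ∧ F)`. -/
def charge (g H₀ : ℝ) (A : Potential) (φ : Higgs) : ℝ :=
  g ^ 2 / (16 * Real.pi ^ 2 * H₀) *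
    ∫ x : Space, (∑ m, (covDeriv g A φ x m * starFF g A x m).trace).re

/-- The action of a `5 × 5` matrix on space. -/
def rotate (R : Matrix (Fin 5) (Fin 5) ℝ) (x : Space) : Space :=
  WithLp.toLp 2 (R.mulVec x.ofLp)

/-- Spherical symmetry: for every rotation `R ∈ SO(5)` of space, the fields pulled back by `R`
agree with the original ones up to a global gauge transformation. The latter is the conjugation
by a unitary `S` that acts on the span of the `γ_a` by some `O ∈ SO(5)`. -/
def IsSphericallySymmetric (γ : Fin 5 → Mat) (A : Potential) (φ : Higgs) : Prop :=
  ∀ R ∈ Matrix.specialOrthogonalGroup (Fin 5) ℝ,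
    ∃ S ∈ Matrix.unitaryGroup (Fin 4) ℂ,
      (∃ O ∈ Matrix.specialOrthogonalGroup (Fin 5) ℝ,
        ∀ a, S * γ a * star S = ∑ b, O b a • γ b) ∧
      (∀ x, φ (rotate R x) = S * φ x * star S) ∧
      ∀ x i, ∑ j, R j i • A (rotate R x) j = S * A x i * star S

/-! ### The hedgehog ansatz -/

/-- The matrix `e = x^a γ_a / r` (zero at the origin). -/
def radial (γ : Fin 5 → Mat) (x : Space) : Mat := ‖x‖⁻¹ • ∑ a, x a • γ a

/-- `φ = H₀ U(r) e` (zero at the origin). -/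
def hedgehogHiggs (γ : Fin 5 → Mat) (H₀ : ℝ) (U : ℝ → ℝ) : Higgs :=
  fun x => (H₀ * U ‖x‖) • radial γ x

/-- `A = ((1 - K(r)) / (2g)) e de` (zero at the origin). -/
def hedgehogPotential (γ : Fin 5 → Mat) (g : ℝ) (K : ℝ → ℝ) : Potential :=
  fun x i => ((1 - K ‖x‖) / (2 * g)) • (radial γ x * pderiv i (radial γ) x)

end

end Monopole

namespace Monopole

noncomputable section

/-! The two radial equations reduce to one scalar equation. Put t = -log K, w = 1 - K² and V = τ³ U.
Then dt/dτ = τ² U / w and d(log τ)/dt = w / V. The radius drops out, leaving V' = w (3 + w² / V)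
with V(0) = 0. The right hand side is singular at V = 0 but decreasing in V, so solutions cannot
separate. Solutions started at 1/(n+1) therefore decrease to a solution started at 0
(`exists_reduced`). The comparison principle traps it between explicit barriers: w² ≤ V ≤ w² exp(2t)
and 3t - 3/2 ≤ V ≤ 4t.

The radius is recovered from log τ = ∫ w/V dt + const. The barriers make this integral diverge at
both ends, so τ runs over all of (0, ∞). They also make log V - 3 log τ converge as t → ∞ and log w
- 2 log τ converge as t → 0. The first limit fixes the constant by U(∞) = 1; the second gives 1 - K
~ b τ² and U ~ 4 b² τ at the origin. The decay of K comes from U → 1 together with the linear bounds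
on V, and the rate of 1 - U from L'Hôpital's rule (`exists_profile`, `IsProfile.u_sub_one_isTheta`).

For uniqueness, an arbitrary profile is shown to satisfy 0 < K < 1 beyond the last zero of U. There
V(-log K) - τ³ U solves a linear homogeneous equation that cannot leave 0, and log τ differs from
the integral by the constant dictated by U(∞) = 1. A last zero at positive radius would make log τ
tend to -∞ at a finite radius, so there is none (`IsProfile.eq_reduced`).

On the gauge side both fields have the form ρ(r) times a linear function of x. The Clifford
relations and chirality evaluate F ∧ F and D_A φ in terms of γ_m and x_m x^a γ_a
(`IsGamma.contract_eq`, `starFF_hedgehog`, `covDeriv_hedgehog`). Comparing coefficients identifies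
the Bogomolny equation off the origin with the radial system. The asymptotics at 0 give C¹
regularity, and continuity extends the equation to the origin. Symmetry holds because every rotation
is implemented by a product of Clifford unit vectors (`IsGamma.exists_spin`). On solutions r⁴ times
the energy density of the Higgs field is the derivative of a multiple of U w², which gives
finiteness of the energy and the value of the charge. -/

/-! ### A comparison principle -/

/-- A function that starts nonpositive and does not increase where it is positive stays
nonpositive. -/
theorem nonpos_of_deriv_nonpos_of_pos {D D' : ℝ → ℝ} {a b : ℝ} (hc : ContinuousOn D (Icc a b))
    (ha : D a ≤ 0) (hd : ∀ t ∈ Ioo a b, HasDerivAt D (D' t) t)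
    (hn : ∀ t ∈ Ioo a b, 0 < D t → D' t ≤ 0) : ∀ t ∈ Icc a b, D t ≤ 0 := by
  intro t₁ ht₁
  by_contra! hpos
  have hsub : Icc a t₁ ⊆ Icc a b := Icc_subset_Icc_right ht₁.2
  have hcl : IsClosed (Icc a t₁ ∩ D ⁻¹' Iic 0) :=
    (hc.mono hsub).preimage_isClosed_of_isClosed isClosed_Icc isClosed_Iic
  have hK : IsCompact (Icc a t₁ ∩ D ⁻¹' Iic 0) :=
    isCompact_Icc.of_isClosed_subset hcl inter_subset_left
  have hne : (Icc a t₁ ∩ D ⁻¹' Iic 0).Nonempty := ⟨a, ⟨le_rfl, ht₁.1⟩, ha⟩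
  -- The last point `t₀ ≤ t₁` with `D ≤ 0`: beyond it `D` is positive, hence nonincreasing, and
  -- cannot have climbed to `D t₁ > 0`.
  obtain ⟨h0, h0'⟩ := hK.sSup_mem hne
  set t₀ := sSup (Icc a t₁ ∩ D ⁻¹' Iic 0)
  have hlt : t₀ < t₁ := lt_of_le_of_ne h0.2 fun h => by
    rw [h] at h0'; exact absurd h0' (not_le.2 hpos)
  have hp : ∀ t ∈ Ioo t₀ t₁, 0 < D t := fun t ht => by
    by_contra! h
    exact absurd (le_csSup hK.bddAbove ⟨⟨h0.1.trans ht.1.le, ht.2.le⟩, h⟩) (not_le.2 ht.1)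
  have hmem : ∀ t ∈ Ioo t₀ t₁, t ∈ Ioo a b := fun t ht =>
    ⟨h0.1.trans_lt ht.1, ht.2.trans_le ht₁.2⟩
  have hanti : AntitoneOn D (Icc t₀ t₁) := by
    refine antitoneOn_of_deriv_nonpos (convex_Icc _ _)
      (hc.mono (Icc_subset_Icc h0.1 ht₁.2)) ?_ ?_
    · rw [interior_Icc]
      exact fun t ht => (hd t (hmem t ht)).differentiableAt.differentiableWithinAt
    · rw [interior_Icc]
      intro t ht
      rw [(hd t (hmem t ht)).deriv]
      exact hn t (hmem t ht) (hp t ht)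
  have := hanti ⟨le_rfl, hlt.le⟩ ⟨hlt.le, le_rfl⟩ hlt.le
  exact absurd (this.trans h0') (not_le.2 hpos)

/-! ### The reduced equation `V' = w (3 + w² / V)` with `w = 1 - exp (-2 t)` -/

/-- The function `w = 1 - K²` in terms of `t = - log K`. -/
def gap (t : ℝ) : ℝ := 1 - Real.exp (-2 * t)

theorem gap_zero : gap 0 = 0 := by simp [gap]

theorem hasDerivAt_gap (t : ℝ) : HasDerivAt gap (2 * (1 - gap t)) t := by
  have h : HasDerivAt (fun s : ℝ => -2 * s) (-2) t := by simpa using (hasDerivAt_id t).const_mul (-2)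
  exact (h.exp.const_sub 1).congr_deriv (by unfold gap; ring)

theorem continuous_gap : Continuous gap := by unfold gap; fun_prop

theorem gap_lt_one (t : ℝ) : gap t < 1 := by have := Real.exp_pos (-2 * t); unfold gap; linarith

theorem gap_pos {t : ℝ} (ht : 0 < t) : 0 < gap t := by
  have : Real.exp (-2 * t) < 1 := by
    rw [← Real.exp_zero]; exact Real.exp_lt_exp.2 (by linarith)
  unfold gap; linarith

theorem gap_nonneg {t : ℝ} (ht : 0 ≤ t) : 0 ≤ gap t := by
  have : Real.exp (-2 * t) ≤ 1 := Real.exp_le_one_iff.2 (by linarith)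
  unfold gap; linarith

theorem gap_mono : Monotone gap := fun s t h => by
  have : Real.exp (-2 * t) ≤ Real.exp (-2 * s) := Real.exp_le_exp.2 (by linarith)
  unfold gap; linarith

theorem gap_le (t : ℝ) : gap t ≤ 2 * t := by
  have := Real.add_one_le_exp (-2 * t)
  unfold gap; linarith

theorem one_sub_gap (t : ℝ) : 1 - gap t = Real.exp (-2 * t) := by unfold gap; ring

/-- The right hand side of the reduced equation. -/
def slope (t v : ℝ) : ℝ := gap t * (3 + gap t ^ 2 / v)

/-- Solutions of the reduced equation from a positive initial value, on bounded intervals. -/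
theorem exists_reduced_of_pos {ε T : ℝ} (hε : 0 < ε) (hT : 0 ≤ T) :
    ∃ v : ℝ → ℝ, v 0 = ε ∧ ContinuousOn v (Icc 0 T) ∧
      (∀ t ∈ Ioo 0 T, HasDerivAt v (slope t (v t)) t) ∧ ∀ t ∈ Icc 0 T, ε ≤ v t := by
  have hmax : ∀ x, 0 < max x ε := fun x => hε.trans_le (le_max_right _ _)
  -- Truncating at `ε` makes the field globally bounded by 3 + 1/ε and Lipschitz with constant 1/ε².
  -- The ball of radius (3 + 1/ε) T is then never left before time `T`.
  have hpl : IsPicardLindelof (fun t x => slope t (max x ε)) (tmin := 0) (tmax := T)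
      ⟨0, le_rfl, hT⟩ ε ⟨(3 + 1 / ε) * T, by positivity⟩ 0 ⟨3 + 1 / ε, by positivity⟩
      ⟨1 / ε ^ 2, by positivity⟩ := by
    refine ⟨fun t ht => ?_, fun x _ => ?_, fun t ht x _ => ?_, ?_⟩
    · refine LipschitzOnWith.of_dist_le_mul fun x _ y _ => ?_
      have h0 := gap_nonneg ht.1
      have h1 := (gap_lt_one t).le
      have e : slope t (max x ε) - slope t (max y ε) =
          gap t ^ 3 * ((max y ε - max x ε) / (max x ε * max y ε)) := by
        have := (hmax x).ne'; have := (hmax y).ne'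
        unfold slope; field_simp; ring
      rw [Real.dist_eq, Real.dist_eq, e, abs_mul, abs_div, abs_of_nonneg (by positivity)]
      have h2 : |max y ε - max x ε| ≤ |x - y| := by
        rw [abs_sub_comm x y]; exact abs_max_sub_max_le_abs _ _ _
      have h3 : ε ^ 2 ≤ |max x ε * max y ε| := by
        rw [abs_of_pos (mul_pos (hmax x) (hmax y)), sq]
        exact mul_le_mul (le_max_right _ _) (le_max_right _ _) hε.le (hmax x).le
      calc gap t ^ 3 * (|max y ε - max x ε| / |max x ε * max y ε|)
          ≤ 1 * (|x - y| / ε ^ 2) := by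
            gcongr
            exact pow_le_one₀ h0 h1
        _ = 1 / ε ^ 2 * |x - y| := by ring
    · have := continuous_gap
      unfold slope
      fun_prop
    · have h0 := gap_nonneg ht.1
      have h1 := (gap_lt_one t).le
      have := hmax x
      rw [Real.norm_eq_abs, slope, abs_of_nonneg (by positivity)]
      calc gap t * (3 + gap t ^ 2 / max x ε) ≤ 1 * (3 + 1 / ε) := by
            gcongr
            · exact pow_le_one₀ h0 h1
            · exact le_max_right _ _
        _ = 3 + 1 / ε := by ring
    · change (3 + 1 / ε) * max (T - 0) (0 - 0) ≤ (3 + 1 / ε) * T - 0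
      simp [hT]
  obtain ⟨v, hv0, hv⟩ := hpl.exists_eq_forall_mem_Icc_hasDerivWithinAt₀
  have hc : ContinuousOn v (Icc 0 T) := fun t ht => (hv t ht).continuousWithinAt
  have hd : ∀ t ∈ Ioo 0 T, HasDerivAt v (slope t (max (v t) ε)) t := fun t ht =>
    (hv t (Ioo_subset_Icc_self ht)).hasDerivAt (Icc_mem_nhds ht.1 ht.2)
  -- The truncated slope is nonnegative, so the solution stays above `ε` and the truncation is never
  -- active.
  have hge : ∀ t ∈ Icc 0 T, ε ≤ v t := by
    have := nonpos_of_deriv_nonpos_of_pos (D := fun t => ε - v t)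
      (D' := fun t => -slope t (max (v t) ε)) (continuousOn_const.sub hc) (by simp_all)
      (fun t ht => (hd t ht).const_sub ε) (fun t ht _ => ?_)
    · exact fun t ht => by linarith [this t ht]
    · have := gap_nonneg ht.1.le
      have := hmax (v t)
      unfold slope
      simp only [Left.neg_nonpos_iff]
      positivity
  refine ⟨v, hv0, hc, fun t ht => ?_, hge⟩
  have := hd t ht
  rwa [max_eq_left (hge t (Ioo_subset_Icc_self ht))] at this

/-- A one-sided substitute for a Lipschitz bound, valid up to the singularity at zero: the larger of
two solutions grows no faster. -/
theorem slope_anti {t x y : ℝ} (ht : 0 ≤ t) (hx : 0 < x) (hxy : x ≤ y) : slope t y ≤ slope t x := by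
  have := gap_nonneg ht
  unfold slope
  gcongr

/-- Solutions of the reduced equation lie above `w²`. -/
theorem gap_sq_le_of_reduced {v : ℝ → ℝ} {T : ℝ} (h0 : 0 ≤ v 0) (hc : ContinuousOn v (Icc 0 T))
    (hd : ∀ t ∈ Ioo 0 T, HasDerivAt v (slope t (v t)) t) (hp : ∀ t ∈ Ioo 0 T, 0 < v t) :
    ∀ t ∈ Icc 0 T, gap t ^ 2 ≤ v t := by
  have := nonpos_of_deriv_nonpos_of_pos (D := fun t => gap t ^ 2 - v t)
      (D' := fun t => 2 * gap t * (2 * (1 - gap t)) - slope t (v t))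
      ((continuous_gap.pow 2).continuousOn.sub hc) (by simpa [gap_zero] using h0)
      (fun t ht => by simpa using ((hasDerivAt_gap t).fun_pow 2).fun_sub (hd t ht)) (fun t ht h => ?_)
  · exact fun t ht => by linarith [this t ht]
  · have hv := hp t ht
    have hw := gap_pos ht.1
    -- Below the barrier w² the slope is at least 4w, while the barrier itself grows at the rate
    -- 4w(1 - w).
    have h1 : 1 ≤ gap t ^ 2 / v t := by rw [le_div_iff₀ hv]; linarith
    simp only [slope]
    nlinarith

/-- Solutions of the reduced equation lie above `3 t - 3 w / 2`. -/
theorem three_mul_sub_le_of_reduced {v : ℝ → ℝ} {T : ℝ} (h0 : 0 ≤ v 0)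
    (hc : ContinuousOn v (Icc 0 T))
    (hd : ∀ t ∈ Ioo 0 T, HasDerivAt v (slope t (v t)) t) (hp : ∀ t ∈ Ioo 0 T, 0 < v t) :
    ∀ t ∈ Icc 0 T, 3 * t - 3 / 2 * gap t ≤ v t := by
  have := nonpos_of_deriv_nonpos_of_pos (D := fun t => 3 * t - 3 / 2 * gap t - v t)
      (D' := fun t => 3 * 1 - 3 / 2 * (2 * (1 - gap t)) - slope t (v t))
      (((continuous_const.mul continuous_id).sub
        (continuous_const.mul continuous_gap)).continuousOn.sub hc) (by simpa [gap_zero] using h0)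
      (fun t ht => ((((hasDerivAt_id t).const_mul 3).sub
        ((hasDerivAt_gap t).const_mul (3 / 2))).sub (hd t ht))) (fun t ht h => ?_)
  · exact fun t ht => by linarith [this t ht]
  · have hv := hp t ht
    have hw := gap_pos ht.1
    -- The barrier has derivative exactly 3w, the slope with its last term dropped.
    have h1 : 0 ≤ gap t ^ 2 / v t := by positivity
    simp only [slope]
    nlinarith

/-- Solutions of the reduced equation lie below `v 0 + 4 t`. -/
theorem le_add_four_mul_of_reduced {v : ℝ → ℝ} {T : ℝ} (h0 : 0 ≤ v 0)
    (hc : ContinuousOn v (Icc 0 T))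
    (hd : ∀ t ∈ Ioo 0 T, HasDerivAt v (slope t (v t)) t) (hp : ∀ t ∈ Ioo 0 T, 0 < v t) :
    ∀ t ∈ Icc 0 T, v t ≤ v 0 + 4 * t := by
  have := nonpos_of_deriv_nonpos_of_pos (D := fun t => v t - (v 0 + 4 * t))
      (D' := fun t => slope t (v t) - 4 * 1)
      (hc.sub (by fun_prop)) (by simp)
      (fun t ht => (hd t ht).sub (((hasDerivAt_id t).const_mul 4).const_add _)) (fun t ht h => ?_)
  · exact fun t ht => by linarith [this t ht]
  · have hv := hp t ht
    have hw := gap_pos ht.1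
    have hw1 := gap_lt_one t
    -- The lower barrier w² ≤ v bounds the slope by 4w ≤ 4.
    have h1 : gap t ^ 2 / v t ≤ 1 := by
      rw [div_le_one hv]; exact gap_sq_le_of_reduced h0 hc hd hp t (Ioo_subset_Icc_self ht)
    simp only [slope]
    nlinarith

/-- Solutions of the reduced equation with `v 0 = 0` lie below `w² exp (2 t)`. -/
theorem le_gap_sq_mul_exp_of_reduced {v : ℝ → ℝ} {T : ℝ} (h0 : v 0 = 0)
    (hc : ContinuousOn v (Icc 0 T))
    (hd : ∀ t ∈ Ioo 0 T, HasDerivAt v (slope t (v t)) t) (hp : ∀ t ∈ Ioo 0 T, 0 < v t) :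
    ∀ t ∈ Icc 0 T, v t ≤ gap t ^ 2 * Real.exp (2 * t) := by
  have hexp : ∀ t, HasDerivAt (fun t : ℝ => Real.exp (2 * t)) (Real.exp (2 * t) * 2) t := fun t => by
    simpa using ((hasDerivAt_id t).const_mul 2).exp
  have key : ∀ t, Real.exp (2 * t) * (1 - gap t) = 1 := fun t => by
    rw [one_sub_gap, ← Real.exp_add]; simp
  have hcg := continuous_gap
  have := nonpos_of_deriv_nonpos_of_pos (D := fun t => v t - gap t ^ 2 * Real.exp (2 * t))
      (D' := fun t => slope t (v t) - (2 * gap t * (2 * (1 - gap t)) * Real.exp (2 * t)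
        + gap t ^ 2 * (Real.exp (2 * t) * 2)))
      (hc.sub (by fun_prop)) (by simp [gap_zero, h0])
      (fun t ht => by
        simpa using (hd t ht).fun_sub (((hasDerivAt_gap t).fun_pow 2).fun_mul (hexp t))) (fun t ht h => ?_)
  · exact fun t ht => by linarith [this t ht]
  · have hv := hp t ht
    have hw := gap_pos ht.1
    have hw1 := gap_lt_one t
    have hk := key t
    have hE := Real.exp_pos (2 * t)
    -- Since exp(2t)(1 - w) = 1, being above the barrier means w²/v ≤ 1 - w, so the slope is at most
    -- 4w. The barrier has derivative 4w + 2w² exp(2t), which is no smaller.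
    have h1 : gap t ^ 2 / v t ≤ 1 - gap t := by
      rw [div_le_iff₀ hv]
      have : (1 - gap t) * (gap t ^ 2 * Real.exp (2 * t)) = gap t ^ 2 := by
        linear_combination gap t ^ 2 * hk
      nlinarith
    have h2 : slope t (v t) ≤ gap t * (3 + (1 - gap t)) := by
      unfold slope; gcongr
    have h3 : 2 * gap t * (2 * (1 - gap t)) * Real.exp (2 * t) = 4 * gap t := by
      linear_combination 4 * gap t * hk
    have h4 : 0 ≤ gap t ^ 2 * (Real.exp (2 * t) * 2) := by positivity
    rw [h3]
    nlinarith

/-- Two solutions of the reduced equation do not move apart. -/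
theorem sub_le_of_reduced {v₁ v₂ : ℝ → ℝ} {T c : ℝ} (hc₀ : 0 ≤ c) (h0 : v₁ 0 ≤ v₂ 0 + c)
    (hc₁ : ContinuousOn v₁ (Icc 0 T)) (hc₂ : ContinuousOn v₂ (Icc 0 T))
    (hd₁ : ∀ t ∈ Ioo 0 T, HasDerivAt v₁ (slope t (v₁ t)) t)
    (hd₂ : ∀ t ∈ Ioo 0 T, HasDerivAt v₂ (slope t (v₂ t)) t)
    (hp₂ : ∀ t ∈ Ioo 0 T, 0 < v₂ t) :
    ∀ t ∈ Icc 0 T, v₁ t ≤ v₂ t + c := by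
  have := nonpos_of_deriv_nonpos_of_pos (D := fun t => v₁ t - v₂ t - c)
      (D' := fun t => slope t (v₁ t) - slope t (v₂ t))
      ((hc₁.sub hc₂).sub continuousOn_const) (by linarith)
      (fun t ht => ((hd₁ t ht).sub (hd₂ t ht)).sub_const c) (fun t ht h => ?_)
  · exact fun t ht => by linarith [this t ht]
  · have := slope_anti ht.1.le (hp₂ t ht) (y := v₁ t) (by linarith)
    linarith

/-- The reduced equation has a solution with `V 0 = 0` that is positive on `(0, ∞)`. -/
theorem exists_reduced : ∃ V : ℝ → ℝ, V 0 = 0 ∧ ContinuousOn V (Ici 0) ∧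
    (∀ t > 0, HasDerivAt V (slope t (V t)) t) ∧ ∀ t > 0, 0 < V t := by
  have hε : ∀ n : ℕ, (0 : ℝ) < 1 / (n + 1) := fun n => by positivity
  choose v hv0 hvc hvd hvge using fun n : ℕ => exists_reduced_of_pos (hε n) (Nat.cast_nonneg n)
  have hvp : ∀ n : ℕ, ∀ t ∈ Ioo (0 : ℝ) n, 0 < v n t := fun n t ht =>
    (hε n).trans_le (hvge n t (Ioo_subset_Icc_self ht))
  have hsq : ∀ n : ℕ, ∀ t ∈ Icc (0 : ℝ) n, gap t ^ 2 ≤ v n t := fun n =>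
    gap_sq_le_of_reduced (by rw [hv0]; exact (hε n).le) (hvc n) (hvd n) (hvp n)
  have hup : ∀ n : ℕ, ∀ t ∈ Icc (0 : ℝ) n, v n t ≤ 1 / (n + 1) + 4 * t := fun n t ht => by
    rw [← hv0 n]
    exact le_add_four_mul_of_reduced (by rw [hv0]; exact (hε n).le) (hvc n) (hvd n) (hvp n) t ht
  -- The approximations decrease in `n`, and the gap between two of them never exceeds the initial
  -- one. This gives a limit together with a uniform rate.
  have hle : ∀ m n : ℕ, m ≤ n → ∀ t ∈ Icc (0 : ℝ) m,
      v n t ≤ v m t ∧ v m t ≤ v n t + 1 / (m + 1) := by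
    intro m n hmn t ht
    have hcast : (m : ℝ) ≤ n := Nat.cast_le.2 hmn
    have hs : Icc (0 : ℝ) m ⊆ Icc 0 n := Icc_subset_Icc_right hcast
    have hs' : Ioo (0 : ℝ) m ⊆ Ioo 0 n := Ioo_subset_Ioo_right hcast
    have hεε : (1 : ℝ) / (n + 1) ≤ 1 / (m + 1) := by gcongr
    constructor
    · simpa using sub_le_of_reduced (c := 0) le_rfl (by rw [hv0, hv0]; linarith)
        ((hvc n).mono hs) (hvc m) (fun t ht => hvd n t (hs' ht)) (hvd m) (hvp m) t ht
    · exact sub_le_of_reduced (hε m).le (by rw [hv0, hv0]; linarith [hε n])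
        (hvc m) ((hvc n).mono hs) (hvd m) (fun t ht => hvd n t (hs' ht))
        (fun t ht => hvp n t (hs' ht)) t ht
  have hlim : ∀ t : ℝ, ∃ l, 0 ≤ t → Tendsto (fun n => v n t) atTop (𝓝 l) := by
    intro t
    by_cases ht : 0 ≤ t
    · obtain ⟨N, hN⟩ := exists_nat_ge t
      have hanti : Antitone fun n => v (n + N) t := fun m n hmn =>
        (hle (m + N) (n + N) (by omega) t ⟨ht, hN.trans (by simp)⟩).1
      have hbdd : BddBelow (range fun n => v (n + N) t) :=
        ⟨gap t ^ 2, by rintro _ ⟨n, rfl⟩; exact hsq (n + N) t ⟨ht, hN.trans (by simp)⟩⟩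
      exact ⟨_, fun _ => (tendsto_add_atTop_iff_nat N).1 (tendsto_atTop_ciInf hanti hbdd)⟩
    · exact ⟨0, fun h => absurd h ht⟩
  choose V hV using hlim
  have hge : ∀ t : ℝ, 0 ≤ t → ∀ᶠ n : ℕ in atTop, t ≤ n := fun t _ =>
    (tendsto_natCast_atTop_atTop (R := ℝ)).eventually_ge_atTop t
  have hVsq : ∀ t, 0 ≤ t → gap t ^ 2 ≤ V t := fun t ht => by
    refine ge_of_tendsto (hV t ht) ?_
    filter_upwards [hge t ht] with n hn using hsq n t ⟨ht, hn⟩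
  have hVpos : ∀ t > 0, 0 < V t := fun t ht =>
    (pow_pos (gap_pos ht) 2).trans_le (hVsq t ht.le)
  have hVup : ∀ t, 0 ≤ t → V t ≤ 4 * t := fun t ht => by
    have h1 : Tendsto (fun n : ℕ => 1 / ((n : ℝ) + 1) + 4 * t) atTop (𝓝 (0 + 4 * t)) :=
      tendsto_one_div_add_atTop_nhds_zero_nat.add_const _
    rw [zero_add] at h1
    refine le_of_tendsto_of_tendsto (hV t ht) h1 ?_
    filter_upwards [hge t ht] with n hn using hup n t ⟨ht, hn⟩
  have hclose : ∀ m : ℕ, ∀ t ∈ Icc (0 : ℝ) m, V t ≤ v m t ∧ v m t ≤ V t + 1 / (m + 1) := by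
    intro m t ht
    constructor
    · refine le_of_tendsto (hV t ht.1) ?_
      filter_upwards [eventually_ge_atTop m] with n hn using (hle m n hn t ht).1
    · refine ge_of_tendsto ((hV t ht.1).add_const _) ?_
      filter_upwards [eventually_ge_atTop m] with n hn using (hle m n hn t ht).2
  have hV0 : V 0 = 0 := le_antisymm (by simpa using hVup 0 le_rfl)
    (by simpa [gap_zero] using hVsq 0 le_rfl)
  have hderiv : ∀ t > 0, HasDerivAt V (slope t (V t)) t := by
    intro t ht
    obtain ⟨N, hN⟩ := exists_nat_gt t
    refine hasDerivAt_of_tendstoUniformlyOn (l := atTop) (f := v) (s := Ioo (t / 2) N)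
      (f' := fun n s => slope s (v n s)) (g' := fun s => slope s (V s)) isOpen_Ioo ?_ ?_
      (fun s hs => hV s (by linarith [hs.1])) ⟨by linarith, hN⟩
    · have hw := gap_pos (half_pos ht)
      rw [Metric.tendstoUniformlyOn_iff]
      intro e he
      have h1 : Tendsto (fun n : ℕ => 1 / ((n : ℝ) + 1)) atTop (𝓝 0) :=
        tendsto_one_div_add_atTop_nhds_zero_nat
      filter_upwards [h1.eventually_lt_const (show 0 < e * gap (t / 2) by positivity),
        eventually_ge_atTop N] with n hn hnN s hs
      have hs0 : 0 < s := by linarith [hs.1]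
      have hsn : s ∈ Icc (0 : ℝ) n := ⟨hs0.le, hs.2.le.trans (Nat.cast_le.2 hnN)⟩
      have hws := gap_pos hs0
      have hws' : gap (t / 2) ≤ gap s := gap_mono hs.1.le
      have hA := hVpos s hs0
      have hA' := hVsq s hs0.le
      obtain ⟨hB, hB'⟩ := hclose n s hsn
      have hBp := hA.trans_le hB
      -- With both denominators at least w², the difference of slopes is at most 1/((n+1) w), which
      -- is uniformly small away from s = 0. So the derivatives converge locally uniformly.
      have e1 : slope s (V s) - slope s (v n s) = gap s ^ 3 * (v n s - V s) / (V s * v n s) := by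
        unfold slope; field_simp; ring
      rw [Real.dist_eq, e1, abs_of_nonneg (by have := sub_nonneg.2 hB; positivity),
        div_lt_iff₀ (by positivity)]
      calc gap s ^ 3 * (v n s - V s) ≤ gap s ^ 3 * (1 / ((n : ℝ) + 1)) := by
            gcongr; linarith
        _ < gap s ^ 3 * (e * gap (t / 2)) := by gcongr
        _ ≤ gap s ^ 3 * (e * gap s) := by gcongr
        _ = e * (gap s ^ 2 * gap s ^ 2) := by ring
        _ ≤ e * (V s * v n s) := by
            gcongr
            exact hA'.trans hB
    · filter_upwards [eventually_ge_atTop N] with n hn s hs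
      exact hvd n s ⟨by linarith [hs.1], hs.2.trans_le (Nat.cast_le.2 hn)⟩
  refine ⟨V, hV0, fun t ht => ?_, hderiv, hVpos⟩
  rcases (mem_Ici.1 ht).eq_or_lt with rfl | ht
  · rw [ContinuousWithinAt, hV0]
    refine tendsto_of_tendsto_of_tendsto_of_le_of_le' tendsto_const_nhds
      (h := fun t => 4 * t) ?_ ?_ ?_
    · have : Tendsto (fun t : ℝ => 4 * t) (𝓝 0) (𝓝 (4 * 0)) := by
        apply Continuous.tendsto; fun_prop
      rw [mul_zero] at this
      exact this.mono_left nhdsWithin_le_nhds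
    · filter_upwards [self_mem_nhdsWithin] with s hs using (sq_nonneg _).trans (hVsq s hs)
    · filter_upwards [self_mem_nhdsWithin] with s hs using hVup s hs
  · exact (hderiv t ht).continuousAt.continuousWithinAt

/-! ### Solutions of the reduced equation on the half line -/

/-- `V` solves the reduced equation on `(0, ∞)`, is positive there, and starts at `0`. -/
structure IsReduced (V : ℝ → ℝ) : Prop where
  zero : V 0 = 0
  continuousOn : ContinuousOn V (Ici 0)
  hasDerivAt : ∀ t > 0, HasDerivAt V (slope t (V t)) t
  pos : ∀ t > 0, 0 < V t

namespace IsReduced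

variable {V : ℝ → ℝ}

theorem gap_sq_le (h : IsReduced V) {t : ℝ} (ht : 0 ≤ t) : gap t ^ 2 ≤ V t :=
  gap_sq_le_of_reduced h.zero.ge (h.continuousOn.mono Icc_subset_Ici_self)
    (fun s hs => h.hasDerivAt s hs.1) (fun s hs => h.pos s hs.1) t ⟨ht, le_rfl⟩

theorem le_gap_sq_mul_exp (h : IsReduced V) {t : ℝ} (ht : 0 ≤ t) :
    V t ≤ gap t ^ 2 * Real.exp (2 * t) :=
  le_gap_sq_mul_exp_of_reduced h.zero (h.continuousOn.mono Icc_subset_Ici_self)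
    (fun s hs => h.hasDerivAt s hs.1) (fun s hs => h.pos s hs.1) t ⟨ht, le_rfl⟩

theorem le_four_mul (h : IsReduced V) {t : ℝ} (ht : 0 ≤ t) : V t ≤ 4 * t := by
  have := le_add_four_mul_of_reduced h.zero.ge (h.continuousOn.mono Icc_subset_Ici_self)
    (fun s hs => h.hasDerivAt s hs.1) (fun s hs => h.pos s hs.1) t ⟨ht, le_rfl⟩
  rwa [h.zero, zero_add] at this

theorem three_mul_sub_le (h : IsReduced V) {t : ℝ} (ht : 0 ≤ t) : 3 * t - 3 / 2 ≤ V t := by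
  have := three_mul_sub_le_of_reduced h.zero.ge (h.continuousOn.mono Icc_subset_Ici_self)
    (fun s hs => h.hasDerivAt s hs.1) (fun s hs => h.pos s hs.1) t ⟨ht, le_rfl⟩
  linarith [gap_lt_one t]

end IsReduced

/-! ### Recovering the radius from the reduced solution. -/

/-- The logarithm of the radius, up to a constant, as a function of `t = - log K`. -/
def logRadius (V : ℝ → ℝ) (t : ℝ) : ℝ := ∫ s in (1 : ℝ)..t, gap s / V s

namespace IsReduced

variable {V : ℝ → ℝ}

theorem hasDerivAt_logRadius (h : IsReduced V) {t : ℝ} (ht : 0 < t) :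
    HasDerivAt (logRadius V) (gap t / V t) t := by
  have hc : ∀ s > 0, ContinuousAt (fun s => gap s / V s) s := fun s hs =>
    continuous_gap.continuousAt.div (h.hasDerivAt s hs).continuousAt (h.pos s hs).ne'
  have hc' : ContinuousOn (fun s => gap s / V s) (Ioi 0) := fun s hs =>
    (hc s hs).continuousWithinAt
  refine intervalIntegral.integral_hasDerivAt_right ?_ ?_ (hc t ht)
  · refine (hc'.mono fun s hs => ?_).intervalIntegrable
    exact (lt_min one_pos ht).trans_le hs.1
  · exact hc'.stronglyMeasurableAtFilter isOpen_Ioi t ht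

theorem logRadius_one : logRadius V 1 = 0 := by simp [logRadius]

/-- From V ≤ w² exp(2t) and w ≤ 2t, the integrand w/V is at least 1/(2e² t) on (0, 1]. Hence the
integral diverges at 0, and the origin of the radius corresponds to t = 0. -/
theorem logRadius_le_mul_log (h : IsReduced V) {t : ℝ} (ht : 0 < t) (ht1 : t ≤ 1) :
    logRadius V t ≤ 1 / (2 * Real.exp 2) * Real.log t := by
  have hd : ∀ s > 0, HasDerivAt (fun s => logRadius V s - 1 / (2 * Real.exp 2) * Real.log s)
      (gap s / V s - 1 / (2 * Real.exp 2) * s⁻¹) s := fun s hs =>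
    (h.hasDerivAt_logRadius hs).sub ((Real.hasDerivAt_log hs.ne').const_mul _)
  have hm : MonotoneOn (fun s => logRadius V s - 1 / (2 * Real.exp 2) * Real.log s) (Ioc 0 1) := by
    refine monotoneOn_of_deriv_nonneg (convex_Ioc _ _)
      (fun s hs => (hd s hs.1).continuousAt.continuousWithinAt) ?_ ?_
    · rw [interior_Ioc]
      exact fun s hs => (hd s hs.1).differentiableAt.differentiableWithinAt
    · rw [interior_Ioc]
      intro s hs
      rw [(hd s hs.1).deriv, sub_nonneg]
      have hw := gap_pos hs.1
      have hV := h.pos s hs.1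
      have hV' := h.le_gap_sq_mul_exp hs.1.le
      have hE : Real.exp (2 * s) ≤ Real.exp 2 := Real.exp_le_exp.2 (by linarith [hs.2])
      have := hs.1
      rw [← one_div, one_div_mul_one_div, div_le_div_iff₀ (by positivity) hV, one_mul]
      calc V s ≤ gap s ^ 2 * Real.exp (2 * s) := hV'
        _ ≤ gap s * (2 * s) * Real.exp 2 := by
          rw [sq]; gcongr; exact gap_le s
        _ = gap s * (2 * Real.exp 2 * s) := by ring
  have := hm ⟨ht, ht1⟩ ⟨one_pos, le_rfl⟩ ht1
  simp only [logRadius_one, Real.log_one] at this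
  linarith

/-- For t ≥ 1 the bounds V ≤ 4t and w ≥ w(1) make the integrand at least w(1)/(4t), so the radius
reaches infinity. -/
theorem mul_log_le_logRadius (h : IsReduced V) {t : ℝ} (ht : 1 ≤ t) :
    gap 1 / 4 * Real.log t ≤ logRadius V t := by
  have hd : ∀ s > 0, HasDerivAt (fun s => logRadius V s - gap 1 / 4 * Real.log s)
      (gap s / V s - gap 1 / 4 * s⁻¹) s := fun s hs =>
    (h.hasDerivAt_logRadius hs).sub ((Real.hasDerivAt_log hs.ne').const_mul _)
  have hm : MonotoneOn (fun s => logRadius V s - gap 1 / 4 * Real.log s) (Ici 1) := by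
    refine monotoneOn_of_deriv_nonneg (convex_Ici _)
      (fun s hs => (hd s (one_pos.trans_le hs)).continuousAt.continuousWithinAt) ?_ ?_
    · rw [interior_Ici]
      exact fun s hs => (hd s (one_pos.trans hs)).differentiableAt.differentiableWithinAt
    · rw [interior_Ici]
      intro s hs
      have hs0 : 0 < s := one_pos.trans hs
      rw [(hd s hs0).deriv, sub_nonneg]
      have hw := gap_pos hs0
      have hw1 : gap 1 ≤ gap s := gap_mono (le_of_lt hs)
      have hV := h.pos s hs0
      have hV' := h.le_four_mul hs0.le
      rw [← div_eq_mul_inv, div_div]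
      gcongr
  have := hm (mem_Ici.2 le_rfl) ht ht
  simp only [logRadius_one, Real.log_one] at this
  linarith

theorem tendsto_logRadius_atTop (h : IsReduced V) : Tendsto (logRadius V) atTop atTop := by
  have h1 : 0 < gap 1 / 4 := by have := gap_pos one_pos; positivity
  refine tendsto_atTop_mono' atTop ?_ (Real.tendsto_log_atTop.const_mul_atTop h1)
  filter_upwards [eventually_ge_atTop 1] with t ht using h.mul_log_le_logRadius ht

theorem tendsto_logRadius_zero (h : IsReduced V) : Tendsto (logRadius V) (𝓝[>] 0) atBot := by
  have h1 : 0 < 1 / (2 * Real.exp 2) := by positivity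
  refine tendsto_atBot_mono' _ ?_ (Real.tendsto_log_nhdsGT_zero.const_mul_atBot h1)
  filter_upwards [Ioc_mem_nhdsGT one_pos] with t ht using h.logRadius_le_mul_log ht.1 ht.2

theorem strictMonoOn_logRadius (h : IsReduced V) : StrictMonoOn (logRadius V) (Ioi 0) := by
  refine strictMonoOn_of_deriv_pos (convex_Ioi _)
    (fun s hs => (h.hasDerivAt_logRadius hs).continuousAt.continuousWithinAt) ?_
  rw [interior_Ioi]
  intro s hs
  rw [(h.hasDerivAt_logRadius hs).deriv]
  exact div_pos (gap_pos hs) (h.pos s hs)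

/-- The quantity `log (V / τ³)` converges at infinity. -/
theorem exists_tendsto_log_sub_logRadius (h : IsReduced V) :
    ∃ l, Tendsto (fun t => Real.log (V t) - 3 * logRadius V t) atTop (𝓝 l) := by
  set f : ℝ → ℝ := fun t => Real.log (V t) - 3 * logRadius V t
  -- The terms 3w/V cancel, leaving only the integrable remainder w³/V².
  have hd : ∀ t > 0, HasDerivAt f (gap t ^ 3 / V t ^ 2) t := fun t ht => by
    refine (((h.hasDerivAt t ht).log (h.pos t ht).ne').sub
      ((h.hasDerivAt_logRadius ht).const_mul 3)).congr_deriv ?_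
    have := (h.pos t ht).ne'
    unfold slope; field_simp; ring
  have hm : MonotoneOn f (Ici 1) := by
    refine monotoneOn_of_deriv_nonneg (convex_Ici _)
      (fun s hs => (hd s (one_pos.trans_le hs)).continuousAt.continuousWithinAt) ?_ ?_
    · rw [interior_Ici]
      exact fun s hs => (hd s (one_pos.trans hs)).differentiableAt.differentiableWithinAt
    · rw [interior_Ici]
      intro s hs
      have hs0 : 0 < s := one_pos.trans hs
      rw [(hd s hs0).deriv]
      have := gap_pos hs0
      positivity
  -- Since V ≥ 3t - 3/2 ≥ t for t ≥ 1, the derivative of `f` is at most 1/t². Adding 1/t makes the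
  -- function decreasing, which bounds `f` from above.
  have hd' : ∀ t > 0, HasDerivAt (fun t => f t + t⁻¹) (gap t ^ 3 / V t ^ 2 + -(t ^ 2)⁻¹) t :=
    fun t ht => (hd t ht).add (hasDerivAt_inv ht.ne')
  have ha : AntitoneOn (fun t => f t + t⁻¹) (Ici 1) := by
    refine antitoneOn_of_deriv_nonpos (convex_Ici _)
      (fun s hs => (hd' s (one_pos.trans_le hs)).continuousAt.continuousWithinAt) ?_ ?_
    · rw [interior_Ici]
      exact fun s hs => (hd' s (one_pos.trans hs)).differentiableAt.differentiableWithinAt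
    · rw [interior_Ici]
      intro s hs
      have hs1 : 1 < s := hs
      have hs0 : 0 < s := one_pos.trans hs
      rw [(hd' s hs0).deriv, ← sub_eq_add_neg, sub_nonpos, inv_eq_one_div]
      have h1 := gap_pos hs0
      have h2 := h.three_mul_sub_le hs0.le
      gcongr
      · exact pow_le_one₀ h1.le (gap_lt_one s).le
      · linarith
  have hb : ∀ t ∈ Ici (1 : ℝ), f t ≤ f 1 + 1 := fun t ht => by
    have h1 := ha (mem_Ici.2 le_rfl) ht ht
    have h2 : 0 ≤ t⁻¹ := inv_nonneg.2 (zero_le_one.trans ht)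
    simp only [inv_one] at h1
    linarith
  have hmono : Monotone fun t => f (max 1 t) := fun s t hst =>
    hm (mem_Ici.2 (le_max_left 1 s)) (mem_Ici.2 (le_max_left 1 t)) (max_le_max_left 1 hst)
  refine ⟨_, (tendsto_atTop_ciSup hmono ⟨f 1 + 1, ?_⟩).congr' ?_⟩
  · rintro _ ⟨t, rfl⟩
    exact hb _ (mem_Ici.2 (le_max_left 1 t))
  · filter_upwards [eventually_ge_atTop 1] with t ht
    rw [max_eq_right ht]

/-- The quantity `log (w / τ²)` converges at the origin. -/
theorem exists_tendsto_log_gap_sub_logRadius (h : IsReduced V) :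
    ∃ l, Tendsto (fun t => Real.log (gap t) - 2 * logRadius V t) (𝓝[>] 0) (𝓝 l) := by
  set f : ℝ → ℝ := fun t => Real.log (gap t) - 2 * logRadius V t
  have hd : ∀ t > 0, HasDerivAt f (2 * (1 - gap t) / gap t - 2 * (gap t / V t)) t := fun t ht =>
    ((hasDerivAt_gap t).log (gap_pos ht).ne').sub ((h.hasDerivAt_logRadius ht).const_mul 2)
  -- The derivative is 2((1 - w)/w - w/V). It is nonpositive because (1 - w) V ≤ w², which is the
  -- upper barrier; below, the lower barrier w² ≤ V bounds it by -2, so `f t + 2 t` increases and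
  -- `f` is bounded near 0.
  have ha : AntitoneOn f (Ioo 0 1) := by
    refine antitoneOn_of_deriv_nonpos (convex_Ioo _ _)
      (fun s hs => (hd s hs.1).continuousAt.continuousWithinAt) ?_ ?_
    · rw [interior_Ioo]
      exact fun s hs => (hd s hs.1).differentiableAt.differentiableWithinAt
    · rw [interior_Ioo]
      intro s hs
      have hw := gap_pos hs.1
      have hV := h.pos s hs.1
      have hk : Real.exp (2 * s) * (1 - gap s) = 1 := by
        rw [one_sub_gap, ← Real.exp_add]; simp
      have h1 : (1 - gap s) * V s ≤ gap s * gap s := by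
        calc (1 - gap s) * V s ≤ (1 - gap s) * (gap s ^ 2 * Real.exp (2 * s)) :=
              mul_le_mul_of_nonneg_left (h.le_gap_sq_mul_exp hs.1.le)
                (sub_nonneg.2 (gap_lt_one s).le)
          _ = gap s * gap s := by linear_combination gap s ^ 2 * hk
      have h2 : (1 - gap s) / gap s ≤ gap s / V s := by rwa [div_le_div_iff₀ hw hV]
      rw [(hd s hs.1).deriv, mul_div_assoc]
      linarith
  have hd' : ∀ t > 0, HasDerivAt (fun t => f t + 2 * t)
      (2 * (1 - gap t) / gap t - 2 * (gap t / V t) + 2 * 1) t := fun t ht =>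
    (hd t ht).add ((hasDerivAt_id t).const_mul 2)
  have hm : MonotoneOn (fun t => f t + 2 * t) (Ioc 0 1) := by
    refine monotoneOn_of_deriv_nonneg (convex_Ioc _ _)
      (fun s hs => (hd' s hs.1).continuousAt.continuousWithinAt) ?_ ?_
    · rw [interior_Ioc]
      exact fun s hs => (hd' s hs.1).differentiableAt.differentiableWithinAt
    · rw [interior_Ioc]
      intro s hs
      have hw := gap_pos hs.1
      have hV := h.pos s hs.1
      have h2 : gap s / V s ≤ 1 / gap s := by
        rw [div_le_div_iff₀ hV hw]; linarith [h.gap_sq_le hs.1.le]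
      have h3 : (1 - gap s) / gap s = 1 / gap s - 1 := by field_simp
      rw [(hd' s hs.1).deriv, mul_div_assoc, h3]
      linarith
  refine ⟨_, ha.tendsto_nhdsWithin_Ioo_right ⟨1 / 2, by norm_num, by norm_num⟩ ⟨f 1 + 2, ?_⟩⟩
  rintro _ ⟨t, ht, rfl⟩
  have := hm ⟨ht.1, ht.2.le⟩ ⟨one_pos, le_rfl⟩ ht.2.le
  simp only at this
  linarith [ht.1]

/-- The inverse of the radius as a function of `t`. -/
theorem exists_inverse (h : IsReduced V) (c : ℝ) : ∃ T : ℝ → ℝ, (∀ τ > 0, 0 < T τ) ∧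
    (∀ τ > 0, logRadius V (T τ) + c = Real.log τ) ∧
    (∀ τ > 0, HasDerivAt T (V (T τ) / (gap (T τ) * τ)) τ) ∧
    Tendsto T (𝓝[>] 0) (𝓝[>] 0) ∧ Tendsto T atTop atTop := by
  -- In the variable y = log t the map to log τ is an increasing bijection of the whole line, so it
  -- can be inverted as an order isomorphism.
  set M : ℝ → ℝ := fun y => logRadius V (Real.exp y) + c with hM
  have hd : ∀ y, HasDerivAt M (gap (Real.exp y) / V (Real.exp y) * Real.exp y) y := fun y =>
    ((h.hasDerivAt_logRadius (Real.exp_pos y)).comp y (Real.hasDerivAt_exp y)).add_const c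
  have hpos : ∀ y, 0 < gap (Real.exp y) / V (Real.exp y) * Real.exp y := fun y => by
    have := gap_pos (Real.exp_pos y)
    have := h.pos _ (Real.exp_pos y)
    positivity
  have hmono : StrictMono M := strictMono_of_hasDerivAt_pos hd hpos
  have hcont : Continuous M := continuous_iff_continuousAt.2 fun y => (hd y).continuousAt
  have hsurj : Function.Surjective M := hcont.surjective
    (tendsto_atTop_add_const_right _ _ (h.tendsto_logRadius_atTop.comp Real.tendsto_exp_atTop))
    (tendsto_atBot_add_const_right _ _ (h.tendsto_logRadius_zero.comp Real.tendsto_exp_atBot_nhdsGT))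
  let e := hmono.orderIsoOfSurjective M hsurj
  have he : ∀ z, M (e.symm z) = z := fun z => e.apply_symm_apply z
  have hed : ∀ z, HasDerivAt e.symm
      (gap (Real.exp (e.symm z)) / V (Real.exp (e.symm z)) * Real.exp (e.symm z))⁻¹ z := fun z =>
    HasDerivAt.of_local_left_inverse e.symm.continuous.continuousAt (hd _) (hpos _).ne'
      (Eventually.of_forall he)
  refine ⟨fun τ => Real.exp (e.symm (Real.log τ)), fun τ _ => Real.exp_pos _,
    fun τ _ => he (Real.log τ), fun τ hτ => ?_, ?_, ?_⟩
  · refine (((hed (Real.log τ)).comp τ (Real.hasDerivAt_log hτ.ne')).exp).congr_deriv ?_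
    have h1 := (gap_pos (Real.exp_pos (e.symm (Real.log τ)))).ne'
    have h2 := (h.pos _ (Real.exp_pos (e.symm (Real.log τ)))).ne'
    simp only [Function.comp]
    field_simp
  · exact Real.tendsto_exp_atBot_nhdsGT.comp
      (e.symm.tendsto_atBot.comp Real.tendsto_log_nhdsGT_zero)
  · exact Real.tendsto_exp_atTop.comp (e.symm.tendsto_atTop.comp Real.tendsto_log_atTop)

end IsReduced

/-! ### Construction of the profile. -/

/-- Existence of a profile, with its behaviour at the origin and at infinity. -/
theorem exists_profile : ∃ k u : ℝ → ℝ, IsProfile k u ∧ (∀ τ > 0, 0 < k τ ∧ k τ < 1) ∧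
    (∀ τ > 0, 0 < u τ) ∧
    (∃ b > 0, Tendsto (fun τ => (1 - k τ) / τ ^ 2) (𝓝[>] 0) (𝓝 b) ∧
      Tendsto (fun τ => u τ / τ) (𝓝[>] 0) (𝓝 (4 * b ^ 2))) ∧
    k =O[atTop] (fun τ => Real.exp (-(1 / 8) * τ ^ 3)) ∧
    (fun τ => Real.exp (-(1 / 3) * τ ^ 3)) =O[atTop] k := by
  obtain ⟨V, hV0, hVc, hVd, hVp⟩ := exists_reduced
  have h : IsReduced V := ⟨hV0, hVc, hVd, hVp⟩
  obtain ⟨l, hl⟩ := h.exists_tendsto_log_sub_logRadius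
  obtain ⟨m, hm⟩ := h.exists_tendsto_log_gap_sub_logRadius
  -- With the shift l/3, log U = log V - 3 log τ tends to l - l = 0, which is the normalisation U(∞)
  -- = 1.
  obtain ⟨T, hTp, hTL, hTd, hT0, hTi⟩ := h.exists_inverse (l / 3)
  set k : ℝ → ℝ := fun τ => if τ ≤ 0 then 1 else Real.exp (-T τ) with hk
  set u : ℝ → ℝ := fun τ => if τ ≤ 0 then 0 else V (T τ) / τ ^ 3 with hu
  have hk' : ∀ τ > 0, k τ = Real.exp (-T τ) := fun τ hτ => if_neg (not_le.2 hτ)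
  have hu' : ∀ τ > 0, u τ = V (T τ) / τ ^ 3 := fun τ hτ => if_neg (not_le.2 hτ)
  have hk0 : k 0 = 1 := if_pos le_rfl
  have hu0 : u 0 = 0 := if_pos le_rfl
  have hgap : ∀ τ > 0, 1 - k τ ^ 2 = gap (T τ) := fun τ hτ => by
    rw [hk' τ hτ, ← Real.exp_nat_mul, gap]
    congr 2; push_cast; ring
  have hkd : ∀ τ > 0, HasDerivAt k (Real.exp (-T τ) * -(V (T τ) / (gap (T τ) * τ))) τ :=
    fun τ hτ => ((hTd τ hτ).neg.exp).congr_of_eventuallyEq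
      (by filter_upwards [lt_mem_nhds hτ] with s hs using hk' s hs)
  have hud : ∀ τ > 0, HasDerivAt u (gap (T τ) ^ 2 / τ ^ 4) τ := fun τ hτ => by
    have h1 := ((h.hasDerivAt _ (hTp τ hτ)).comp τ (hTd τ hτ)).div (hasDerivAt_pow 3 τ)
      (pow_pos hτ 3).ne'
    refine (h1.congr_of_eventuallyEq ?_).congr_deriv ?_
    · filter_upwards [lt_mem_nhds hτ] with s hs using hu' s hs
    · have h1 := (gap_pos (hTp τ hτ)).ne'
      have h2 := (h.pos _ (hTp τ hτ)).ne'
      have h3 := hτ.ne'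
      simp only [Function.comp, slope]
      field_simp
      push_cast
      ring
  have hpos : ∀ᶠ τ : ℝ in 𝓝[>] 0, 0 < τ := self_mem_nhdsWithin
  have hT0' : Tendsto T (𝓝[>] 0) (𝓝 0) := hT0.mono_right nhdsWithin_le_nhds
  have hklim : Tendsto k (𝓝[>] 0) (𝓝 1) := by
    have : Tendsto (fun τ => Real.exp (-T τ)) (𝓝[>] 0) (𝓝 (Real.exp (-0))) :=
      (Real.continuous_exp.tendsto _).comp hT0'.neg
    rw [neg_zero, Real.exp_zero] at this
    exact this.congr' (by filter_upwards [hpos] with τ hτ using (hk' τ hτ).symm)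
  -- The limit of w/τ² at the origin: log w - 2 log τ tends to m - 2l/3.
  set B := Real.exp (m - 2 * (l / 3)) with hB
  have hBpos : 0 < B := Real.exp_pos _
  have hgaplim : Tendsto (fun τ => gap (T τ) / τ ^ 2) (𝓝[>] 0) (𝓝 B) := by
    have h1 : Tendsto (fun τ => Real.exp (Real.log (gap (T τ)) - 2 * logRadius V (T τ) -
        2 * (l / 3))) (𝓝[>] 0) (𝓝 B) :=
      (Real.continuous_exp.tendsto _).comp ((hm.comp hT0).sub_const _)
    refine h1.congr' ?_
    filter_upwards [hpos] with τ hτ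
    have h2 := hTL τ hτ
    have h3 : Real.log (gap (T τ)) - 2 * logRadius V (T τ) - 2 * (l / 3) =
        Real.log (gap (T τ)) - (2 : ℕ) * Real.log τ := by push_cast; linarith
    rw [h3, ← Real.log_pow, Real.exp_sub, Real.exp_log (gap_pos (hTp τ hτ)),
      Real.exp_log (by positivity)]
  -- Here 1 - k = w/(1 + k) with k → 1, whence the factor one half.
  have hkquot : Tendsto (fun τ => (1 - k τ) / τ ^ 2) (𝓝[>] 0) (𝓝 (B / 2)) := by
    have h1 : Tendsto (fun τ => gap (T τ) / τ ^ 2 / (1 + k τ)) (𝓝[>] 0) (𝓝 (B / (1 + 1))) :=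
      hgaplim.div (hklim.const_add 1) (by norm_num)
    rw [one_add_one_eq_two] at h1
    refine h1.congr' ?_
    filter_upwards [hpos] with τ hτ
    have h2 : 0 < 1 + k τ := by rw [hk' τ hτ]; positivity
    rw [← hgap τ hτ]
    field_simp
    ring
  have hVlim : Tendsto (fun t => V t / gap t ^ 2) (𝓝[>] 0) (𝓝 1) := by
    have h1 : Tendsto (fun t => Real.exp (2 * t)) (𝓝[>] 0) (𝓝 1) := by
      have : Tendsto (fun t : ℝ => Real.exp (2 * t)) (𝓝 0) (𝓝 (Real.exp (2 * 0))) := by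
        apply Continuous.tendsto; fun_prop
      rw [mul_zero, Real.exp_zero] at this
      exact this.mono_left nhdsWithin_le_nhds
    refine tendsto_of_tendsto_of_tendsto_of_le_of_le' tendsto_const_nhds h1 ?_ ?_
    · filter_upwards [hpos] with t ht
      have := gap_pos ht
      rw [le_div_iff₀ (by positivity), one_mul]
      exact h.gap_sq_le ht.le
    · filter_upwards [hpos] with t ht
      have := gap_pos ht
      rw [div_le_iff₀ (by positivity), mul_comm]
      exact h.le_gap_sq_mul_exp ht.le
  -- Write u/τ = (V/w²)(w/τ²)²; the first factor tends to 1 because the two barriers for V agree to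
  -- leading order at 0.
  have huquot : Tendsto (fun τ => u τ / τ) (𝓝[>] 0) (𝓝 (4 * (B / 2) ^ 2)) := by
    have h1 := (hVlim.comp hT0).mul (hgaplim.pow 2)
    have h2 : 1 * B ^ 2 = 4 * (B / 2) ^ 2 := by ring
    rw [h2] at h1
    refine h1.congr' ?_
    filter_upwards [hpos] with τ hτ
    have := gap_pos (hTp τ hτ)
    rw [hu' τ hτ]
    simp only [Function.comp]
    field_simp
  have hulim : Tendsto u (𝓝[>] 0) (𝓝 0) := by
    have h1 : Tendsto (fun τ => u τ / τ * τ) (𝓝[>] 0) (𝓝 (4 * (B / 2) ^ 2 * 0)) :=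
      huquot.mul (tendsto_id.mono_right nhdsWithin_le_nhds)
    rw [mul_zero] at h1
    refine h1.congr' ?_
    filter_upwards [hpos] with τ hτ
    field_simp
  have hulim' : Tendsto u atTop (𝓝 1) := by
    have h1 : Tendsto (fun τ => Real.exp (Real.log (V (T τ)) - 3 * logRadius V (T τ) -
        l)) atTop (𝓝 (Real.exp (l - l))) :=
      (Real.continuous_exp.tendsto _).comp ((hl.comp hTi).sub_const _)
    rw [sub_self, Real.exp_zero] at h1
    refine h1.congr' ?_
    filter_upwards [eventually_gt_atTop 0] with τ hτ
    have h2 := hTL τ hτ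
    have h3 : Real.log (V (T τ)) - 3 * logRadius V (T τ) - l =
        Real.log (V (T τ)) - (3 : ℕ) * Real.log τ := by push_cast; linarith
    rw [h3, ← Real.log_pow, Real.exp_sub, Real.exp_log (h.pos _ (hTp τ hτ)),
      Real.exp_log (by positivity), hu' τ hτ]
  have huu : ∀ τ > 0, u τ ≤ 1 := by
    have hm : MonotoneOn u (Ioi 0) := by
      refine monotoneOn_of_deriv_nonneg (convex_Ioi _)
        (fun s hs => (hud s hs).continuousAt.continuousWithinAt) ?_ ?_
      · rw [interior_Ioi]
        exact fun s hs => (hud s hs).differentiableAt.differentiableWithinAt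
      · rw [interior_Ioi]
        intro s hs
        rw [(hud s hs).deriv]
        positivity
    intro τ hτ
    refine ge_of_tendsto hulim' ?_
    filter_upwards [eventually_ge_atTop τ] with s hs
    exact hm hτ (hτ.trans_le hs) hs
  refine ⟨k, u, ⟨fun τ hτ => (hkd τ hτ).differentiableAt, fun τ hτ => (hud τ hτ).differentiableAt,
    fun τ hτ => ?_, fun τ hτ => ?_, hk0, hu0, ?_, ?_, ?_, hulim'⟩, fun τ hτ => ?_, fun τ hτ => ?_,
    ⟨B / 2, by positivity, hkquot, huquot⟩, ?_, ?_⟩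
  · rw [(hkd τ hτ).deriv, hgap τ hτ, hu' τ hτ, hk' τ hτ]
    have := (gap_pos (hTp τ hτ)).ne'
    field_simp
  · rw [(hud τ hτ).deriv, hgap τ hτ]
  · rw [← Ioi_insert, continuousWithinAt_insert_self, ContinuousWithinAt, hk0]
    exact hklim
  · rw [← Ioi_insert, continuousWithinAt_insert_self, ContinuousWithinAt, hu0]
    exact hulim
  · refine (Real.tendsto_exp_neg_atTop_nhds_zero.comp hTi).congr' ?_
    filter_upwards [eventually_gt_atTop 0] with τ hτ using (hk' τ hτ).symm
  · rw [hk' τ hτ]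
    exact ⟨Real.exp_pos _, by
      rw [← Real.exp_zero]; exact Real.exp_lt_exp.2 (by linarith [hTp τ hτ])⟩
  · rw [hu' τ hτ]
    have := h.pos _ (hTp τ hτ)
    positivity
  -- Once u ≥ 1/2, the bound V ≤ 4T gives τ³/2 ≤ 4T, so T ≥ τ³/8.
  · refine IsBigO.of_bound 1 ?_
    filter_upwards [eventually_gt_atTop 0, hulim'.eventually_const_le (show 1 / 2 < (1 : ℝ) by
      norm_num)] with τ hτ hτ'
    rw [hk' τ hτ, Real.norm_of_nonneg (Real.exp_pos _).le, Real.norm_of_nonneg (Real.exp_pos _).le,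
      one_mul, Real.exp_le_exp]
    rw [hu' τ hτ, le_div_iff₀ (by positivity)] at hτ'
    linarith [h.le_four_mul (hTp τ hτ).le]
  -- From u ≤ 1 and V ≥ 3T - 3/2 one gets T ≤ τ³/3 + 1/2.
  · refine IsBigO.of_bound (Real.exp (1 / 2)) ?_
    filter_upwards [eventually_gt_atTop 0] with τ hτ
    rw [hk' τ hτ, Real.norm_of_nonneg (Real.exp_pos _).le, Real.norm_of_nonneg (Real.exp_pos _).le,
      ← Real.exp_add, Real.exp_le_exp]
    have h1 := huu τ hτ
    rw [hu' τ hτ, div_le_one (by positivity)] at h1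
    linarith [h.three_mul_sub_le (hTp τ hτ).le]

/-! ### Uniqueness of the profile -/

namespace IsProfile

variable {k u : ℝ → ℝ}

theorem continuousOn_k (h : IsProfile k u) : ContinuousOn k (Ici 0) := fun τ hτ => by
  rcases (mem_Ici.1 hτ).eq_or_lt with rfl | hτ
  · exact h.continuousWithinAt_k
  · exact (h.differentiableAt_k τ hτ).continuousAt.continuousWithinAt

theorem continuousOn_u (h : IsProfile k u) : ContinuousOn u (Ici 0) := fun τ hτ => by
  rcases (mem_Ici.1 hτ).eq_or_lt with rfl | hτ
  · exact h.continuousWithinAt_u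
  · exact (h.differentiableAt_u τ hτ).continuousAt.continuousWithinAt

theorem monotoneOn_u (h : IsProfile k u) : MonotoneOn u (Ici 0) := by
  refine monotoneOn_of_deriv_nonneg (convex_Ici _) h.continuousOn_u ?_ ?_
  · rw [interior_Ici]
    exact fun s hs => (h.differentiableAt_u s hs).differentiableWithinAt
  · rw [interior_Ici]
    intro s hs
    rw [h.eq_u s hs]
    positivity

theorem u_nonneg (h : IsProfile k u) {τ : ℝ} (hτ : 0 ≤ τ) : 0 ≤ u τ := by
  rw [← h.u_zero]; exact h.monotoneOn_u self_mem_Ici hτ hτ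

theorem u_le_one (h : IsProfile k u) {τ : ℝ} (hτ : 0 ≤ τ) : u τ ≤ 1 := by
  refine ge_of_tendsto h.tendsto_u ?_
  filter_upwards [eventually_ge_atTop τ] with s hs
  exact h.monotoneOn_u hτ (hτ.trans hs) hs

/-- The last point at which `u` vanishes; there `k = 1`. -/
theorem exists_last_zero (h : IsProfile k u) :
    ∃ T ≥ 0, u T = 0 ∧ k T = 1 ∧ ∀ τ > T, 0 < u τ := by
  set S := Ici (0 : ℝ) ∩ u ⁻¹' Iic 0
  have hcl : IsClosed S := h.continuousOn_u.preimage_isClosed_of_isClosed isClosed_Ici isClosed_Iic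
  have hne : S.Nonempty := ⟨0, self_mem_Ici, h.u_zero.le⟩
  have hbdd : BddAbove S := by
    obtain ⟨N, hN⟩ := eventually_atTop.1 (h.tendsto_u.eventually_const_lt one_pos)
    exact ⟨N, fun τ hτ => le_of_not_ge fun hN' => absurd hτ.2 (not_le.2 (hN τ hN'))⟩
  have hT := hcl.csSup_mem hne hbdd
  set T := sSup S
  have hT0 : 0 ≤ T := hT.1
  have huT : ∀ τ ∈ Icc 0 T, u τ = 0 := fun τ hτ =>
    le_antisymm ((h.monotoneOn_u hτ.1 hT0 hτ.2).trans hT.2) (h.u_nonneg hτ.1)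
  -- Where `u` vanishes identically the second equation forces 1 - k² = 0. The trivial branch k = 1,
  -- u = 0 on an initial interval cannot be excluded yet.
  have hsq : ∀ τ ∈ Ioo 0 T, k τ ^ 2 = 1 := fun τ hτ => by
    have h1 : deriv u τ = 0 := by
      have : u =ᶠ[𝓝 τ] fun _ => 0 := by
        filter_upwards [Icc_mem_nhds hτ.1 hτ.2] with s hs using huT s hs
      rw [this.deriv_eq, deriv_const]
    rw [h.eq_u τ hτ.1, div_eq_zero_iff, or_iff_left (pow_pos hτ.1 4).ne'] at h1
    linarith [pow_eq_zero_iff (two_ne_zero) |>.1 h1]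
  have hkc : ContinuousOn k (Icc 0 T) := h.continuousOn_k.mono Icc_subset_Ici_self
  refine ⟨T, hT0, huT T ⟨hT0, le_rfl⟩, ?_, fun τ hτ => ?_⟩
  · rcases hT0.eq_or_lt with h0 | h0
    · rw [← h0, h.k_zero]
    have hsq' : ∀ τ ∈ Icc 0 T, k τ ^ 2 = 1 := by
      have : EqOn (fun τ => k τ ^ 2) (fun _ => 1) (closure (Ioo 0 T)) :=
        EqOn.of_subset_closure (s := Ioo 0 T) (t := closure (Ioo 0 T)) (fun τ hτ => hsq τ hτ)
          (by rw [closure_Ioo h0.ne]; exact hkc.pow 2) continuousOn_const subset_closure le_rfl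
      rw [closure_Ioo h0.ne] at this
      exact this
    rcases mul_self_eq_one_iff.1 ((sq (k T)).symm.trans (hsq' T ⟨hT0, le_rfl⟩)) with h1 | h1
    · exact h1
    -- Reaching k = -1 from k = 1 would require a zero of `k`, where k² = 1 fails.
    · obtain ⟨s, hs, hs'⟩ := intermediate_value_Icc' hT0 hkc
        (show (0 : ℝ) ∈ Icc (k T) (k 0) by rw [h1, h.k_zero]; norm_num)
      have := hsq' s hs
      rw [hs'] at this
      norm_num at this
  · by_contra! h1
    exact absurd (le_csSup hbdd ⟨hT0.trans hτ.le, h1⟩) (not_le.2 hτ)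

/-- At k² = 1 the first equation degenerates to k u = 0, contradicting both u > 0 and k ≠ 0. This
makes the equation solvable for the derivative of `k`. -/
theorem k_sq_ne_one (h : IsProfile k u) {τ : ℝ} (hτ : 0 < τ) (hu : 0 < u τ) : k τ ^ 2 ≠ 1 := by
  intro h1
  have h2 := h.eq_k τ hτ
  rw [h1, sub_self, zero_mul, zero_div, neg_zero, mul_eq_zero, or_iff_left hu.ne'] at h2
  rw [h2] at h1
  norm_num at h1

theorem deriv_k (h : IsProfile k u) {τ : ℝ} (hτ : 0 < τ) (hk : k τ ^ 2 ≠ 1) :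
    deriv k τ = -(τ ^ 2 * k τ * u τ / (1 - k τ ^ 2)) := by
  have h1 := h.eq_k τ hτ
  have h2 : 1 - k τ ^ 2 ≠ 0 := sub_ne_zero.2 hk.symm
  rw [eq_neg_iff_add_eq_zero] at h1 ⊢
  field_simp at h1 ⊢
  linarith

/-- After the last zero of `u`, the function `k` takes values in `(0, 1)`. -/
theorem k_mem_Ioo_of_last_zero (h : IsProfile k u) {T : ℝ} (hT : 0 ≤ T) (hkT : k T = 1)
    (hu : ∀ τ > T, 0 < u τ) : ∀ τ > T, 0 < k τ ∧ k τ < 1 := by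
  have hpos : ∀ τ > T, 0 < τ := fun τ hτ => hT.trans_lt hτ
  have hne : ∀ τ > T, k τ ^ 2 ≠ 1 := fun τ hτ => h.k_sq_ne_one (hpos τ hτ) (hu τ hτ)
  have hd : ∀ τ > T, HasDerivAt k (-(τ ^ 2 * k τ * u τ / (1 - k τ ^ 2))) τ := fun τ hτ => by
    rw [← h.deriv_k (hpos τ hτ) (hne τ hτ)]
    exact (h.differentiableAt_k τ (hpos τ hτ)).hasDerivAt
  -- As k² → 0 at infinity, a value at least 1 would force k² = 1 at some later point.
  have hlt : ∀ τ > T, k τ ^ 2 < 1 := by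
    intro τ hτ
    by_contra! h1
    have h2 : Tendsto (fun σ => k σ ^ 2) atTop (𝓝 0) := by simpa using h.tendsto_k.pow 2
    obtain ⟨σ, hσ, hτσ⟩ := ((h2.eventually_lt_const one_pos).and (eventually_ge_atTop τ)).exists
    obtain ⟨s, hs, hs'⟩ := intermediate_value_Icc' hτσ
      ((h.continuousOn_k.mono fun s hs => (hpos τ hτ).le.trans hs.1).pow 2)
      (show (1 : ℝ) ∈ Icc (k σ ^ 2) (k τ ^ 2) from ⟨hσ.le, h1⟩)
    exact hne s (hτ.trans_le hs.1) hs'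
  have hsq : ∀ τ > T, HasDerivAt (fun τ => k τ ^ 2)
      (-(2 * (k τ ^ 2 * (τ ^ 2 * u τ / (1 - k τ ^ 2))))) τ := fun τ hτ =>
    ((hd τ hτ).pow 2).congr_deriv (by push_cast; ring)
  have hanti : AntitoneOn (fun τ => k τ ^ 2) (Ioi T) := by
    refine antitoneOn_of_deriv_nonpos (convex_Ioi _)
      (fun s hs => (hsq s hs).continuousAt.continuousWithinAt) ?_ ?_
    · rw [interior_Ioi]
      exact fun s hs => (hsq s hs).differentiableAt.differentiableWithinAt
    · rw [interior_Ioi]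
      intro s hs
      rw [(hsq s hs).deriv, Left.neg_nonpos_iff]
      have := hu s hs
      have := sub_pos.2 (hlt s hs)
      positivity
  -- A Gronwall argument: (k²)' = -2k² s² u/(1 - k²), and on [a, τ] the coefficient is at most `C`
  -- because u ≤ 1 and k² decreases. So k² exp(C s) is nondecreasing there, and a zero at τ
  -- propagates back to a.
  have hzero : ∀ τ > T, k τ = 0 → ∀ a ∈ Ioo T τ, k a = 0 := by
    intro τ hτ h0 a ha
    by_contra hka
    have ha1 := sub_pos.2 (hlt a ha.1)
    set C := 2 * τ ^ 2 / (1 - k a ^ 2)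
    have hE : ∀ s, HasDerivAt (fun s => Real.exp (C * s)) (Real.exp (C * s) * C) s := fun s => by
      simpa using ((hasDerivAt_id s).const_mul C).exp
    have hf : ∀ s > T, HasDerivAt (fun s => k s ^ 2 * Real.exp (C * s))
        (k s ^ 2 * Real.exp (C * s) * (C - 2 * (s ^ 2 * u s / (1 - k s ^ 2)))) s := fun s hs =>
      ((hsq s hs).mul (hE s)).congr_deriv (by ring)
    have hm : MonotoneOn (fun s => k s ^ 2 * Real.exp (C * s)) (Icc a τ) := by
      refine monotoneOn_of_deriv_nonneg (convex_Icc _ _)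
        (fun s hs => (hf s (ha.1.trans_le hs.1)).continuousAt.continuousWithinAt) ?_ ?_
      · rw [interior_Icc]
        exact fun s hs => (hf s (ha.1.trans hs.1)).differentiableAt.differentiableWithinAt
      · rw [interior_Icc]
        intro s hs
        have hs' := ha.1.trans hs.1
        have hs0 := hpos s hs'
        rw [(hf s hs').deriv]
        have h1 : s ^ 2 * u s / (1 - k s ^ 2) ≤ τ ^ 2 / (1 - k a ^ 2) := by
          have h2 := hanti ha.1 hs' hs.1.le
          have h3 := h.u_le_one hs0.le
          have h4 := hu s hs'
          simp only at h2
          gcongr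
          calc s ^ 2 * u s ≤ s ^ 2 * 1 := by gcongr
            _ ≤ τ ^ 2 := by rw [mul_one]; gcongr; exact hs.2.le
        have h5 : 0 ≤ C - 2 * (s ^ 2 * u s / (1 - k s ^ 2)) := by
          have h6 : C = 2 * (τ ^ 2 / (1 - k a ^ 2)) := mul_div_assoc _ _ _
          linarith
        positivity
    have h1 := hm ⟨le_rfl, ha.2.le⟩ ⟨ha.2.le, le_rfl⟩ ha.2.le
    simp only [h0] at h1
    have : 0 < k a ^ 2 * Real.exp (C * a) := by positivity
    norm_num at h1
    linarith
  -- Propagated down to `T`, a zero would contradict k → 1 there.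
  have hnz : ∀ τ > T, k τ ≠ 0 := by
    intro τ hτ h0
    have h1 : Tendsto k (𝓝[>] T) (𝓝 1) := by
      have := h.continuousOn_k T hT
      rw [ContinuousWithinAt, hkT] at this
      exact this.mono_left (nhdsWithin_mono _ fun s hs => hT.trans (le_of_lt hs))
    have h2 : Tendsto k (𝓝[>] T) (𝓝 0) := by
      refine tendsto_const_nhds.congr' ?_
      filter_upwards [Ioo_mem_nhdsGT hτ] with a ha using (hzero τ hτ h0 a ha).symm
    exact one_ne_zero (tendsto_nhds_unique h1 h2)
  intro τ hτ
  refine ⟨?_, by nlinarith [hlt τ hτ]⟩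
  by_contra! h1
  obtain ⟨s, hs, hs'⟩ := intermediate_value_Icc' hτ.le
    (h.continuousOn_k.mono fun s hs => hT.trans hs.1)
    (show (0 : ℝ) ∈ Icc (k τ) (k T) from ⟨h1, by rw [hkT]; exact zero_le_one⟩)
  rcases hs.1.eq_or_lt with rfl | h2
  · rw [hkT] at hs'; exact one_ne_zero hs'
  · exact hnz s h2 hs'

/-- Every profile is the normalised solution of the reduced equation. -/
theorem eq_reduced (h : IsProfile k u) {V : ℝ → ℝ} (hV : IsReduced V) {l : ℝ}
    (hl : Tendsto (fun t => Real.log (V t) - 3 * logRadius V t) atTop (𝓝 l)) :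
    ∀ τ > 0, 0 < k τ ∧ k τ < 1 ∧ V (-Real.log (k τ)) = τ ^ 3 * u τ ∧
      logRadius V (-Real.log (k τ)) + l / 3 = Real.log τ := by
  obtain ⟨T, hT, huT, hkT, hu⟩ := h.exists_last_zero
  have hk := h.k_mem_Ioo_of_last_zero hT hkT hu
  have hpos : ∀ τ > T, 0 < τ := fun τ hτ => hT.trans_lt hτ
  have ht : ∀ τ > T, 0 < -Real.log (k τ) := fun τ hτ =>
    neg_pos.2 (Real.log_neg (hk τ hτ).1 (hk τ hτ).2)
  have hgap : ∀ τ > T, 1 - k τ ^ 2 = gap (-Real.log (k τ)) := fun τ hτ => by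
    have h1 : -2 * -Real.log (k τ) = (2 : ℕ) * Real.log (k τ) := by push_cast; ring
    rw [gap, h1, ← Real.log_pow, Real.exp_log (pow_pos (hk τ hτ).1 2)]
  have htd : ∀ τ > T, HasDerivAt (fun τ => -Real.log (k τ))
      (τ ^ 2 * u τ / gap (-Real.log (k τ))) τ := fun τ hτ => by
    have h1 := ((h.differentiableAt_k τ (hpos τ hτ)).hasDerivAt.log (hk τ hτ).1.ne').neg
    refine h1.congr_deriv ?_
    have h2 := (hk τ hτ).1.ne'
    have h3 := (gap_pos (ht τ hτ)).ne'
    rw [h.deriv_k (hpos τ hτ) (h.k_sq_ne_one (hpos τ hτ) (hu τ hτ)), hgap τ hτ]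
    field_simp
  have hud : ∀ τ > T, HasDerivAt u (gap (-Real.log (k τ)) ^ 2 / τ ^ 4) τ := fun τ hτ => by
    rw [← hgap τ hτ, ← h.eq_u τ (hpos τ hτ)]
    exact (h.differentiableAt_u τ (hpos τ hτ)).hasDerivAt
  -- The discrepancy from V = τ³ u. It satisfies a linear homogeneous equation with nonpositive
  -- coefficient and vanishes at `T`, so comparison applied to `D` and `-D` gives zero; the
  -- coefficient may be singular at `T`.
  set D : ℝ → ℝ := fun τ => V (-Real.log (k τ)) - τ ^ 3 * u τ with hD
  have hDd : ∀ τ > T, HasDerivAt D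
      (-(gap (-Real.log (k τ)) ^ 2 / (V (-Real.log (k τ)) * τ)) * D τ) τ := fun τ hτ => by
    have h1 := ((hV.hasDerivAt _ (ht τ hτ)).comp τ (htd τ hτ)).sub
      ((hasDerivAt_pow 3 τ).mul (hud τ hτ))
    refine h1.congr_deriv ?_
    have h2 := (hpos τ hτ).ne'
    have h3 := (gap_pos (ht τ hτ)).ne'
    have h4 := (hV.pos _ (ht τ hτ)).ne'
    simp only [hD, slope]
    field_simp
    push_cast
    ring
  have hkpos : ∀ τ ∈ Ici T, 0 < k τ ∧ k τ ≤ 1 := fun τ hτ => by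
    rcases (mem_Ici.1 hτ).eq_or_lt with rfl | h1
    · rw [hkT]; exact ⟨one_pos, le_rfl⟩
    · exact ⟨(hk τ h1).1, (hk τ h1).2.le⟩
  have htc : ContinuousOn (fun τ => -Real.log (k τ)) (Ici T) :=
    ((h.continuousOn_k.mono (Ici_subset_Ici.2 hT)).log fun τ hτ => (hkpos τ hτ).1.ne').neg
  have hDc : ContinuousOn D (Ici T) := by
    refine (hV.continuousOn.comp htc fun τ hτ => ?_).sub
      ((continuousOn_id.pow 3).mul (h.continuousOn_u.mono (Ici_subset_Ici.2 hT)))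
    exact neg_nonneg.2 (Real.log_nonpos (hkpos τ hτ).1.le (hkpos τ hτ).2)
  have hDT : D T = 0 := by simp [hD, hkT, huT, hV.zero]
  have hcoef : ∀ τ > T, 0 ≤ gap (-Real.log (k τ)) ^ 2 / (V (-Real.log (k τ)) * τ) := fun τ hτ => by
    have := hpos τ hτ
    have := hV.pos _ (ht τ hτ)
    positivity
  have hD0 : ∀ τ > T, D τ = 0 := by
    intro τ hτ
    apply le_antisymm
    · refine nonpos_of_deriv_nonpos_of_pos (hDc.mono Icc_subset_Ici_self) hDT.le
        (fun s hs => hDd s hs.1) (fun s hs h1 => ?_) τ ⟨le_of_lt hτ, le_rfl⟩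
      nlinarith [hcoef s hs.1]
    · have := nonpos_of_deriv_nonpos_of_pos (hDc.neg.mono Icc_subset_Ici_self)
        (by simp [hDT]) (fun s hs => (hDd s hs.1).neg) (fun s hs h1 => ?_) τ ⟨le_of_lt hτ, le_rfl⟩
      · simpa using this
      · have h2 : 0 < -D s := h1
        nlinarith [hcoef s hs.1]
  have hVu : ∀ τ > T, V (-Real.log (k τ)) = τ ^ 3 * u τ := fun τ hτ => sub_eq_zero.1 (hD0 τ hτ)
  set G : ℝ → ℝ := fun τ => logRadius V (-Real.log (k τ)) - Real.log τ
  have hGd : ∀ τ > T, HasDerivAt G 0 τ := fun τ hτ => by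
    have h1 := ((hV.hasDerivAt_logRadius (ht τ hτ)).comp τ (htd τ hτ)).sub
      (Real.hasDerivAt_log (hpos τ hτ).ne')
    refine h1.congr_deriv ?_
    have h2 := (hpos τ hτ).ne'
    have h3 := (gap_pos (ht τ hτ)).ne'
    have h4 := (hu τ hτ).ne'
    rw [hVu τ hτ]
    field_simp
    ring
  -- Since log V = 3 log τ + log u, `G` is a third of log u minus (log V - 3 `logRadius`), and u → 1
  -- fixes its limit.
  have hGlim : Tendsto G atTop (𝓝 (-(l / 3))) := by
    have hti : Tendsto (fun τ => -Real.log (k τ)) atTop atTop := by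
      have h1 : Tendsto k atTop (𝓝[>] 0) := tendsto_nhdsWithin_iff.2 ⟨h.tendsto_k, by
        filter_upwards [eventually_gt_atTop T] with τ hτ using (hk τ hτ).1⟩
      exact tendsto_neg_atBot_atTop.comp (Real.tendsto_log_nhdsGT_zero.comp h1)
    have h1 : Tendsto (fun τ => Real.log (u τ)) atTop (𝓝 (Real.log 1)) :=
      h.tendsto_u.log one_ne_zero
    have h2 := (h1.sub (hl.comp hti)).div_const 3
    rw [Real.log_one, zero_sub, neg_div] at h2
    refine h2.congr' ?_
    filter_upwards [eventually_gt_atTop T] with τ hτ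
    simp only [G, Function.comp]
    rw [hVu τ hτ, Real.log_mul (pow_pos (hpos τ hτ) 3).ne' (hu τ hτ).ne', Real.log_pow]
    push_cast
    ring
  have hG : ∀ τ > T, G τ = -(l / 3) := by
    intro τ hτ
    refine tendsto_nhds_unique (tendsto_const_nhds.congr' ?_) hGlim
    filter_upwards [eventually_gt_atTop T] with σ hσ
    exact isOpen_Ioi.is_const_of_deriv_eq_zero isPreconnected_Ioi
      (fun s hs => (hGd s hs).differentiableAt.differentiableWithinAt)
      (fun s hs => (hGd s hs).deriv) hτ hσ
  -- If T > 0, then as τ decreases to T the value -log k tends to 0 and `logRadius` to -∞, although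
  -- it equals log τ - l/3, which stays finite.
  have hT0 : T = 0 := by
    by_contra hne
    have hTpos : 0 < T := lt_of_le_of_ne hT (Ne.symm hne)
    have h1 : Tendsto (fun τ => -Real.log (k τ)) (𝓝[>] T) (𝓝[>] 0) := by
      refine tendsto_nhdsWithin_iff.2 ⟨?_, ?_⟩
      · have := htc T self_mem_Ici
        simp only [ContinuousWithinAt, hkT, Real.log_one, neg_zero] at this
        exact this.mono_left (nhdsWithin_mono _ Ioi_subset_Ici_self)
      · filter_upwards [self_mem_nhdsWithin] with τ hτ using ht τ hτ
    have h2 := hV.tendsto_logRadius_zero.comp h1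
    have h3 : Tendsto (fun τ => Real.log τ - l / 3) (𝓝[>] T) (𝓝 (Real.log T - l / 3)) :=
      ((Real.continuousAt_log hTpos.ne').tendsto.mono_left nhdsWithin_le_nhds).sub_const _
    refine not_tendsto_nhds_of_tendsto_atBot h2 _ (h3.congr' ?_)
    filter_upwards [self_mem_nhdsWithin] with τ hτ
    have := hG τ hτ
    simp only [G] at this
    simp only [Function.comp]
    linarith
  rw [hT0] at hk hVu hG
  intro τ hτ
  refine ⟨(hk τ hτ).1, (hk τ hτ).2, hVu τ hτ, ?_⟩
  have := hG τ hτ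
  simp only [G] at this
  linarith

end IsProfile

/-- The profile is unique. -/
theorem IsProfile.eqOn {k u k₂ u₂ : ℝ → ℝ} (h : IsProfile k u) (h₂ : IsProfile k₂ u₂) :
    EqOn k₂ k (Ici 0) ∧ EqOn u₂ u (Ici 0) := by
  obtain ⟨V, hV0, hVc, hVd, hVp⟩ := exists_reduced
  have hV : IsReduced V := ⟨hV0, hVc, hVd, hVp⟩
  obtain ⟨l, hl⟩ := hV.exists_tendsto_log_sub_logRadius
  have key : ∀ τ > 0, k₂ τ = k τ ∧ u₂ τ = u τ := by
    intro τ hτ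
    obtain ⟨a1, a2, a3, a4⟩ := h.eq_reduced hV hl τ hτ
    obtain ⟨b1, b2, b3, b4⟩ := h₂.eq_reduced hV hl τ hτ
    have h1 : -Real.log (k₂ τ) = -Real.log (k τ) :=
      hV.strictMonoOn_logRadius.injOn (neg_pos.2 (Real.log_neg b1 b2))
        (neg_pos.2 (Real.log_neg a1 a2)) (by linarith)
    have h2 : k₂ τ = k τ := Real.log_injOn_pos b1 a1 (neg_injective h1)
    refine ⟨h2, ?_⟩
    rw [h2, a3] at b3
    exact (mul_left_cancel₀ (pow_pos hτ 3).ne' b3).symm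
  constructor
  · intro τ hτ
    rcases (mem_Ici.1 hτ).eq_or_lt with rfl | hτ
    · rw [h.k_zero, h₂.k_zero]
    · exact (key τ hτ).1
  · intro τ hτ
    rcases (mem_Ici.1 hτ).eq_or_lt with rfl | hτ
    · rw [h.u_zero, h₂.u_zero]
    · exact (key τ hτ).2

/-! ### Monotonicity and decay -/

namespace IsProfile

variable {k u : ℝ → ℝ}

theorem strictAntiOn_k (h : IsProfile k u) (hk : ∀ τ > 0, 0 < k τ ∧ k τ < 1)
    (hu : ∀ τ > 0, 0 < u τ) : StrictAntiOn k (Ici 0) := by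
  refine strictAntiOn_of_deriv_neg (convex_Ici _) h.continuousOn_k ?_
  rw [interior_Ici]
  intro τ hτ
  have h1 : 0 < 1 - k τ ^ 2 := by nlinarith [hk τ hτ]
  rw [h.deriv_k hτ (by linarith), neg_lt_zero]
  have h2 := (hk τ hτ).1
  have h3 := hu τ hτ
  have h4 : 0 < τ := hτ
  positivity

theorem strictMonoOn_u (h : IsProfile k u) (hk : ∀ τ > 0, 0 < k τ ∧ k τ < 1) :
    StrictMonoOn u (Ici 0) := by
  refine strictMonoOn_of_deriv_pos (convex_Ici _) h.continuousOn_u ?_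
  rw [interior_Ici]
  intro τ hτ
  have h1 : 0 < 1 - k τ ^ 2 := by nlinarith [hk τ hτ]
  have h4 : 0 < τ := hτ
  rw [h.eq_u τ hτ]
  positivity

/-- L'Hôpital's rule: τ⁴ u' = (1 - k²)² → 1, hence τ³ (u - 1) → -1/3. -/
theorem u_sub_one_isTheta (h : IsProfile k u) :
    (fun τ => u τ - 1) =Θ[atTop] fun τ => (τ ^ 3)⁻¹ := by
  refine (isTheta_of_div_tendsto_nhds_ne_zero (c := -(1 / 3)) ?_ (by norm_num)).symm
  refine HasDerivAt.lhopital_zero_atTop (f' := fun τ => (1 - k τ ^ 2) ^ 2 / τ ^ 4)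
    (g' := fun τ => -(3 * τ ^ 2) / (τ ^ 3) ^ 2) ?_ ?_ ?_ ?_ ?_ ?_
  · filter_upwards [eventually_gt_atTop 0] with τ hτ
    rw [← h.eq_u τ hτ]
    exact (h.differentiableAt_u τ hτ).hasDerivAt.sub_const 1
  · filter_upwards [eventually_gt_atTop 0] with τ hτ
    simpa using (hasDerivAt_pow 3 τ).fun_inv (pow_pos hτ 3).ne'
  · filter_upwards [eventually_gt_atTop 0] with τ hτ
    exact div_ne_zero (neg_ne_zero.2 (by positivity)) (by positivity)
  · simpa using h.tendsto_u.sub_const 1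
  · exact (tendsto_pow_atTop three_ne_zero).inv_tendsto_atTop
  · have h1 : Tendsto (fun τ => -((1 - k τ ^ 2) ^ 2 / 3)) atTop (𝓝 (-((1 - 0 ^ 2) ^ 2 / 3))) :=
      ((((h.tendsto_k.pow 2).const_sub 1).pow 2).div_const 3).neg
    have h2 : -((1 - 0 ^ 2) ^ 2 / 3) = -(1 / 3 : ℝ) := by norm_num
    rw [h2] at h1
    refine h1.congr' ?_
    filter_upwards [eventually_gt_atTop 0] with τ hτ
    field_simp

end IsProfile

/-! ### The boundary value problem in the variable `r` -/

/-- The boundary value problem in the variable `r`, where `κ = (2/3) g² H₀`. -/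
structure IsRadial (κ : ℝ) (K U : ℝ → ℝ) : Prop where
  differentiableAt_K : ∀ r > 0, DifferentiableAt ℝ K r
  differentiableAt_U : ∀ r > 0, DifferentiableAt ℝ U r
  eq_K : ∀ r > 0, K r * U r = -((1 - K r ^ 2) * deriv K r / (κ * r ^ 2))
  eq_U : ∀ r > 0, deriv U r = (1 - K r ^ 2) ^ 2 / (κ * r ^ 4)
  K_zero : K 0 = 1
  U_zero : U 0 = 0
  continuousWithinAt_K : ContinuousWithinAt K (Ici 0) 0
  continuousWithinAt_U : ContinuousWithinAt U (Ici 0) 0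
  tendsto_K : Tendsto K atTop (𝓝 0)
  tendsto_U : Tendsto U atTop (𝓝 1)

theorem scale_pos {g H₀ : ℝ} (hg : 0 < g) (hH₀ : 0 < H₀) : 0 < scale g H₀ := by
  unfold scale; positivity

theorem scale_pow_three {g H₀ : ℝ} (hg : 0 < g) (hH₀ : 0 < H₀) :
    scale g H₀ ^ 3 = 2 * g ^ 2 / 3 * H₀ := by
  rw [scale, ← Real.rpow_natCast, ← Real.rpow_mul (by positivity)]
  norm_num

theorem deriv_comp_div (f : ℝ → ℝ) (a τ : ℝ) :
    deriv (fun τ => f (τ / a)) τ = a⁻¹ * deriv f (τ / a) := by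
  have := deriv_comp_mul_left a⁻¹ f τ
  simp only [smul_eq_mul] at this
  simp only [div_eq_inv_mul]
  exact this

theorem differentiableAt_comp_div (f : ℝ → ℝ) {a : ℝ} (ha : 0 < a) (τ : ℝ) :
    DifferentiableAt ℝ (fun τ => f (τ / a)) τ ↔ DifferentiableAt ℝ f (τ / a) := by
  constructor
  · intro h
    have h1 : DifferentiableAt ℝ (fun τ => f (τ / a)) (a * (τ / a)) := by
      rwa [mul_div_cancel₀ _ ha.ne']
    have h2 := h1.comp (τ / a) (f := fun r => a * r) (by fun_prop)
    have h3 : ((fun τ => f (τ / a)) ∘ fun r => a * r) = f := by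
      funext r; simp only [Function.comp]; rw [mul_div_cancel_left₀ _ ha.ne']
    rwa [h3] at h2
  · intro h
    exact h.comp τ (f := fun τ => τ / a) (by fun_prop)

theorem continuousWithinAt_comp_div (f : ℝ → ℝ) {a : ℝ} (ha : 0 < a) :
    ContinuousWithinAt (fun τ => f (τ / a)) (Ici 0) 0 ↔ ContinuousWithinAt f (Ici 0) 0 := by
  have key : ∀ (h : ℝ → ℝ) (c : ℝ), 0 < c → ContinuousWithinAt h (Ici 0) 0 →
      ContinuousWithinAt (fun r => h (r * c)) (Ici 0) 0 := fun h c hc hh => by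
    refine ContinuousWithinAt.comp (t := Ici 0) (by simpa using hh)
      (by fun_prop : Continuous fun r : ℝ => r * c).continuousWithinAt fun r hr => ?_
    exact mul_nonneg hr hc.le
  constructor
  · intro h
    simpa [ha.ne'] using key _ a ha h
  · intro h
    simpa [div_eq_mul_inv] using key _ a⁻¹ (inv_pos.2 ha) h

theorem tendsto_comp_div (f : ℝ → ℝ) {a : ℝ} (ha : 0 < a) (F : Filter ℝ) :
    Tendsto (fun τ => f (τ / a)) atTop F ↔ Tendsto f atTop F := by
  constructor
  · intro h
    have := h.comp (tendsto_id.atTop_mul_const ha)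
    simpa [Function.comp_def, ha.ne'] using this
  · intro h
    exact h.comp (tendsto_id.atTop_div_const ha)

/-- Only the cube of the scale survives the substitution τ = a r, so the field computations can use
κ = a³ and never meet a cube root. -/
theorem solvesBVP_iff_isRadial {g H₀ : ℝ} (hg : 0 < g) (hH₀ : 0 < H₀) {K U : ℝ → ℝ} :
    SolvesBVP g H₀ K U ↔ IsRadial (2 * g ^ 2 / 3 * H₀) K U := by
  have ha := scale_pos hg hH₀
  unfold SolvesBVP
  rw [← scale_pow_three hg hH₀]
  set a := scale g H₀
  have hK : ∀ r > 0, (K r * U r = -((1 - K r ^ 2) * deriv K r / (a ^ 3 * r ^ 2)) ↔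
      K (a * r / a) * U (a * r / a) = -((1 - K (a * r / a) ^ 2) *
        deriv (fun τ => K (τ / a)) (a * r) / (a * r) ^ 2)) := fun r hr => by
    rw [deriv_comp_div K a, mul_div_cancel_left₀ _ ha.ne']
    refine Eq.congr_right (congrArg Neg.neg ?_)
    field_simp
  have hU : ∀ r > 0, (deriv U r = (1 - K r ^ 2) ^ 2 / (a ^ 3 * r ^ 4) ↔
      deriv (fun τ => U (τ / a)) (a * r) = (1 - K (a * r / a) ^ 2) ^ 2 / (a * r) ^ 4) :=
    fun r hr => by
    rw [deriv_comp_div U a, mul_div_cancel_left₀ _ ha.ne', inv_mul_eq_iff_eq_mul₀ ha.ne']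
    refine Eq.congr_right ?_
    field_simp
  have hex : ∀ {p : ℝ → Prop}, (∀ τ > 0, p τ) ↔ ∀ r > 0, p (a * r) := fun {p} =>
    ⟨fun h r hr => h _ (mul_pos ha hr), fun h τ hτ => by
      have := h (τ / a) (div_pos hτ ha)
      rwa [mul_div_cancel₀ _ ha.ne'] at this⟩
  constructor
  · rintro ⟨h1, h2, h3, h4, h5, h6, h7, h8, h9, h10⟩
    refine ⟨fun r hr => ?_, fun r hr => ?_, fun r hr => (hK r hr).2 (hex.1 h3 r hr),
      fun r hr => (hU r hr).2 (hex.1 h4 r hr), by simpa using h5, by simpa using h6,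
      (continuousWithinAt_comp_div K ha).1 h7, (continuousWithinAt_comp_div U ha).1 h8,
      (tendsto_comp_div K ha _).1 h9, (tendsto_comp_div U ha _).1 h10⟩
    · have := (differentiableAt_comp_div K ha _).1 (hex.1 h1 r hr)
      rwa [mul_div_cancel_left₀ _ ha.ne'] at this
    · have := (differentiableAt_comp_div U ha _).1 (hex.1 h2 r hr)
      rwa [mul_div_cancel_left₀ _ ha.ne'] at this
  · rintro ⟨h1, h2, h3, h4, h5, h6, h7, h8, h9, h10⟩
    refine ⟨fun τ hτ => (differentiableAt_comp_div K ha _).2 (h1 _ (div_pos hτ ha)),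
      fun τ hτ => (differentiableAt_comp_div U ha _).2 (h2 _ (div_pos hτ ha)),
      hex.2 fun r hr => (hK r hr).1 (h3 r hr), hex.2 fun r hr => (hU r hr).1 (h4 r hr),
      by simpa using h5, by simpa using h6,
      (continuousWithinAt_comp_div K ha).2 h7, (continuousWithinAt_comp_div U ha).2 h8,
      (tendsto_comp_div K ha _).2 h9, (tendsto_comp_div U ha _).2 h10⟩

/-- Uniqueness for the boundary value problem. -/
theorem SolvesBVP.eqOn {g H₀ : ℝ} (hg : 0 < g) (hH₀ : 0 < H₀) {K U K₂ U₂ : ℝ → ℝ}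
    (h : SolvesBVP g H₀ K U) (h₂ : SolvesBVP g H₀ K₂ U₂) :
    EqOn K₂ K (Ici 0) ∧ EqOn U₂ U (Ici 0) := by
  have ha := scale_pos hg hH₀
  obtain ⟨e1, e2⟩ := IsProfile.eqOn h h₂
  constructor
  · intro r hr
    have := e1 (show scale g H₀ * r ∈ Ici 0 from mul_nonneg ha.le hr)
    simpa [ha.ne'] using this
  · intro r hr
    have := e2 (show scale g H₀ * r ∈ Ici 0 from mul_nonneg ha.le hr)
    simpa [ha.ne'] using this

/-- A solution of the boundary value problem with the properties used in the construction of the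
monopole. -/
structure IsRegularRadial (κ : ℝ) (K U : ℝ → ℝ) : Prop extends IsRadial κ K U where
  K_mem : ∀ r > 0, 0 < K r ∧ K r < 1
  U_pos : ∀ r > 0, 0 < U r
  regular : ∃ β > 0, Tendsto (fun r => (1 - K r) / r ^ 2) (𝓝[>] 0) (𝓝 β) ∧
      Tendsto (fun r => U r / r) (𝓝[>] 0) (𝓝 (4 * β ^ 2 / κ))
  U_sub_one_isTheta : (fun r => U r - 1) =Θ[atTop] fun r => (r ^ 3)⁻¹

theorem exists_isRegularRadial {g H₀ : ℝ} (hg : 0 < g) (hH₀ : 0 < H₀) : ∃ K U : ℝ → ℝ,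
    IsRegularRadial (2 * g ^ 2 / 3 * H₀) K U ∧ StrictAntiOn K (Ici 0) ∧ StrictMonoOn U (Ici 0) ∧
    (∃ C > 0, K =O[atTop] fun r => Real.exp (-C * r ^ 3)) ∧
    (∃ C > 0, (fun r => Real.exp (-C * r ^ 3)) =O[atTop] K) := by
  obtain ⟨k, u, h, hk, hu, ⟨b, hb, hkb, hub⟩, hO, hO'⟩ := exists_profile
  have ha := scale_pos hg hH₀
  have hsolves : SolvesBVP g H₀ (fun r => k (scale g H₀ * r)) fun r => u (scale g H₀ * r) := by
    unfold SolvesBVP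
    simpa only [mul_div_cancel₀ _ ha.ne'] using h
  have hrad := (solvesBVP_iff_isRadial hg hH₀).1 hsolves
  have ha3 := scale_pow_three hg hH₀
  set a := scale g H₀
  have hat : Tendsto (fun r => a * r) atTop atTop := tendsto_id.const_mul_atTop ha
  have ha0 : Tendsto (fun r => a * r) (𝓝[>] 0) (𝓝[>] 0) := by
    refine tendsto_nhdsWithin_iff.2 ⟨?_, ?_⟩
    · have : Tendsto (fun r => a * r) (𝓝 0) (𝓝 (a * 0)) := by
        apply Continuous.tendsto; fun_prop
      rw [mul_zero] at this
      exact this.mono_left nhdsWithin_le_nhds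
    · filter_upwards [self_mem_nhdsWithin] with r hr using mul_pos ha hr
  refine ⟨_, _, ⟨hrad, fun r hr => hk _ (mul_pos ha hr), fun r hr => hu _ (mul_pos ha hr),
    ⟨a ^ 2 * b, by positivity, ?_, ?_⟩, ?_⟩, ?_, ?_, ⟨1 / 8 * a ^ 3, by positivity, ?_⟩,
    ⟨1 / 3 * a ^ 3, by positivity, ?_⟩⟩
  · refine ((hkb.comp ha0).const_mul (a ^ 2)).congr' ?_
    filter_upwards [self_mem_nhdsWithin] with r hr
    have : 0 < r := hr
    simp only [Function.comp]
    field_simp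
  -- With β = a² b, the relation κ = a³ matches the two forms of the slope of `U` at the origin.
  · have h1 : 4 * (a ^ 2 * b) ^ 2 / (2 * g ^ 2 / 3 * H₀) = a * (4 * b ^ 2) := by
      rw [← ha3]; field_simp
    rw [h1]
    refine ((hub.comp ha0).const_mul a).congr' ?_
    filter_upwards [self_mem_nhdsWithin] with r hr
    have : 0 < r := hr
    simp only [Function.comp]
    field_simp
  · have h0 : ((fun τ => u τ - 1) ∘ fun r => a * r) =Θ[atTop]
        ((fun τ : ℝ => (τ ^ 3)⁻¹) ∘ fun r => a * r) :=
      ⟨h.u_sub_one_isTheta.1.comp_tendsto hat, h.u_sub_one_isTheta.2.comp_tendsto hat⟩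
    refine h0.trans ?_
    have h1 : ((fun τ : ℝ => (τ ^ 3)⁻¹) ∘ fun r => a * r) = fun r => (a ^ 3)⁻¹ * (r ^ 3)⁻¹ := by
      funext r; simp only [Function.comp]; rw [mul_pow, mul_inv]
    rw [h1]
    exact (isTheta_const_mul_left (by positivity)).2 (isTheta_refl _ _)
  · exact fun r hr s hs hrs => h.strictAntiOn_k hk hu (mul_nonneg ha.le hr) (mul_nonneg ha.le hs)
      (mul_lt_mul_of_pos_left hrs ha)
  · exact fun r hr s hs hrs => h.strictMonoOn_u hk (mul_nonneg ha.le hr) (mul_nonneg ha.le hs)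
      (mul_lt_mul_of_pos_left hrs ha)
  · refine (hO.comp_tendsto hat).congr_right fun r => ?_
    simp only [Function.comp]; congr 1; ring
  · refine (hO'.comp_tendsto hat).congr_left fun r => ?_
    simp only [Function.comp]; congr 1; ring

namespace IsRegularRadial

variable {κ : ℝ} {K U : ℝ → ℝ}

theorem K_sub_one_isTheta (h : IsRegularRadial κ K U) :
    (fun r => K r - 1) =Θ[𝓝[>] 0] fun r => r ^ 2 := by
  obtain ⟨β, hβ, h1, -⟩ := h.regular
  refine (isTheta_of_div_tendsto_nhds_ne_zero (c := -β) ?_ (by linarith)).symm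
  exact h1.neg.congr fun r => by ring

theorem U_isTheta (h : IsRegularRadial κ K U) (hκ : 0 < κ) : U =Θ[𝓝[>] 0] fun r => r := by
  obtain ⟨β, hβ, -, h1⟩ := h.regular
  exact (isTheta_of_div_tendsto_nhds_ne_zero h1 (by positivity)).symm

theorem one_sub_K_sq_pos (h : IsRegularRadial κ K U) {r : ℝ} (hr : 0 < r) : 0 < 1 - K r ^ 2 := by
  nlinarith [h.K_mem r hr]

theorem deriv_K (h : IsRegularRadial κ K U) (hκ : 0 < κ) {r : ℝ} (hr : 0 < r) :
    deriv K r = -(κ * r ^ 2 * (K r * U r) / (1 - K r ^ 2)) := by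
  have h1 := (h.one_sub_K_sq_pos hr).ne'
  rw [h.eq_K r hr]
  field_simp

theorem tendsto_K_zero (h : IsRegularRadial κ K U) : Tendsto K (𝓝[>] 0) (𝓝 1) := by
  have := h.continuousWithinAt_K
  rw [ContinuousWithinAt, h.K_zero] at this
  exact this.mono_left (nhdsWithin_mono _ Ioi_subset_Ici_self)

theorem tendsto_one_sub_K_sq_div (h : IsRegularRadial κ K U) {β : ℝ}
    (hβ : Tendsto (fun r => (1 - K r) / r ^ 2) (𝓝[>] 0) (𝓝 β)) :
    Tendsto (fun r => (1 - K r ^ 2) / r ^ 2) (𝓝[>] 0) (𝓝 (2 * β)) := by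
  have := hβ.mul (h.tendsto_K_zero.const_add 1)
  rw [one_add_one_eq_two, mul_comm β] at this
  exact this.congr fun r => by ring

/-- The asymptotics of `K` are not differentiated: the equation writes K'/r as -κ K (U/r) / ((1 -
K²)/r²), whose factors have known limits. -/
theorem tendsto_deriv_K_div (h : IsRegularRadial κ K U) (hκ : 0 < κ) {β : ℝ} (hβ0 : 0 < β)
    (hβ : Tendsto (fun r => (1 - K r) / r ^ 2) (𝓝[>] 0) (𝓝 β))
    (hU : Tendsto (fun r => U r / r) (𝓝[>] 0) (𝓝 (4 * β ^ 2 / κ))) :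
    Tendsto (fun r => deriv K r / r) (𝓝[>] 0) (𝓝 (-(2 * β))) := by
  have h1 := (((h.tendsto_K_zero.mul hU).const_mul κ).div (h.tendsto_one_sub_K_sq_div hβ)
    (by positivity)).neg
  have h2 : -(κ * (1 * (4 * β ^ 2 / κ)) / (2 * β)) = -(2 * β) := by field_simp; ring
  rw [h2] at h1
  refine h1.congr' ?_
  filter_upwards [self_mem_nhdsWithin] with r hr
  have hr' : 0 < r := hr
  have := (h.one_sub_K_sq_pos hr').ne'
  rw [h.deriv_K hκ hr']
  simp only [Pi.div_apply]
  field_simp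

theorem tendsto_deriv_U (h : IsRegularRadial κ K U) {β : ℝ}
    (hβ : Tendsto (fun r => (1 - K r) / r ^ 2) (𝓝[>] 0) (𝓝 β)) :
    Tendsto (fun r => deriv U r) (𝓝[>] 0) (𝓝 (4 * β ^ 2 / κ)) := by
  have h1 := ((h.tendsto_one_sub_K_sq_div hβ).pow 2).div_const κ
  rw [mul_pow, show (2 : ℝ) ^ 2 = 4 by norm_num] at h1
  refine h1.congr' ?_
  filter_upwards [self_mem_nhdsWithin] with r hr
  have hr' : 0 < r := hr
  rw [h.eq_U r hr']
  field_simp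

theorem continuousOn_deriv_K (h : IsRegularRadial κ K U) (hκ : 0 < κ) :
    ContinuousOn (deriv K) (Ioi 0) := by
  have hK : ContinuousOn K (Ioi 0) := fun r hr =>
    (h.differentiableAt_K r hr).continuousAt.continuousWithinAt
  have hU : ContinuousOn U (Ioi 0) := fun r hr =>
    (h.differentiableAt_U r hr).continuousAt.continuousWithinAt
  refine ContinuousOn.congr (f := fun r => -(κ * r ^ 2 * (K r * U r) / (1 - K r ^ 2))) ?_
    fun r hr => h.deriv_K hκ hr
  exact (((by fun_prop : ContinuousOn (fun r : ℝ => κ * r ^ 2) (Ioi 0)).mul (hK.mul hU)).div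
    (continuousOn_const.sub (hK.pow 2)) fun r hr => (h.one_sub_K_sq_pos hr).ne').neg

theorem continuousOn_deriv_U (h : IsRegularRadial κ K U) (hκ : 0 < κ) :
    ContinuousOn (deriv U) (Ioi 0) := by
  have hK : ContinuousOn K (Ioi 0) := fun r hr =>
    (h.differentiableAt_K r hr).continuousAt.continuousWithinAt
  refine ContinuousOn.congr (f := fun r => (1 - K r ^ 2) ^ 2 / (κ * r ^ 4)) ?_
    fun r hr => h.eq_U r hr
  refine ((continuousOn_const.sub (hK.pow 2)).pow 2).div (by fun_prop) fun r hr => ?_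
  have : 0 < r := hr
  positivity

end IsRegularRadial

/-! ### The Clifford algebra -/

/-- The Clifford product `x^a γ_a`. -/
def slash (γ : Fin 5 → Mat) (x : Space) : Mat := ∑ a, x a • γ a

theorem slash_add (γ : Fin 5 → Mat) (x y : Space) : slash γ (x + y) = slash γ x + slash γ y := by
  simp [slash, add_smul, Finset.sum_add_distrib]

theorem slash_sub (γ : Fin 5 → Mat) (x y : Space) : slash γ (x - y) = slash γ x - slash γ y := by
  simp [slash, sub_smul, Finset.sum_sub_distrib]

theorem slash_neg (γ : Fin 5 → Mat) (x : Space) : slash γ (-x) = -slash γ x := by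
  simp [slash]

theorem slash_smul (γ : Fin 5 → Mat) (c : ℝ) (x : Space) : slash γ (c • x) = c • slash γ x := by
  simp [slash, mul_smul, Finset.smul_sum]

theorem slash_single (γ : Fin 5 → Mat) (a : Fin 5) :
    slash γ (EuclideanSpace.single a 1) = γ a := by
  simp [slash, ite_smul]

namespace IsGamma

variable {γ : Fin 5 → Mat}

theorem sq (hγ : IsGamma γ) (a : Fin 5) : γ a * γ a = 1 := by
  have h := hγ.clifford a a
  rw [if_pos rfl, ← two_mul, ← one_add_one_eq_two] at h
  have h2 : (2 : ℂ) • (γ a * γ a) = (2 : ℂ) • (1 : Mat) := by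
    rw [two_smul, two_smul, ← h, add_mul, one_mul]
  exact smul_right_injective _ two_ne_zero h2

theorem anticomm (hγ : IsGamma γ) {a b : Fin 5} (hab : a ≠ b) : γ a * γ b = -(γ b * γ a) := by
  have h := hγ.clifford a b
  rw [if_neg hab] at h
  exact eq_neg_of_add_eq_zero_left h

theorem mul_swap (hγ : IsGamma γ) (a b : Fin 5) :
    γ a * γ b = (if a = b then (2 : ℝ) else 0) • (1 : Mat) - γ b * γ a := by
  split_ifs with h
  · subst h; rw [hγ.sq, two_smul]; abel
  · rw [hγ.anticomm h, zero_smul, zero_sub]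

theorem gamma_mul_slash (hγ : IsGamma γ) (a : Fin 5) (x : Space) :
    γ a * slash γ x = (2 * x a) • (1 : Mat) - slash γ x * γ a := by
  have h : ∀ b, γ a * (x b • γ b) = (if a = b then 2 * x a else 0) • (1 : Mat) - x b • γ b * γ a :=
    fun b => by
      rw [mul_smul_comm, hγ.mul_swap, smul_sub, smul_smul, smul_mul_assoc]
      congr 2
      split_ifs with hab
      · subst hab; ring
      · ring
  rw [slash, Finset.mul_sum, Finset.sum_congr rfl fun b _ => h b, Finset.sum_sub_distrib,
    ← Finset.sum_smul, Finset.sum_ite_eq, if_pos (Finset.mem_univ _), Finset.sum_mul]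

theorem slash_mul_slash (hγ : IsGamma γ) (x y : Space) :
    slash γ x * slash γ y = (2 * inner ℝ x y) • (1 : Mat) - slash γ y * slash γ x := by
  have h : ∀ a, x a • γ a * slash γ y = (2 * (y a * x a)) • (1 : Mat) - slash γ y * (x a • γ a) :=
    fun a => by
      rw [smul_mul_assoc, hγ.gamma_mul_slash, smul_sub, smul_smul, mul_smul_comm]
      congr 2; ring
  conv_lhs => rw [slash, Finset.sum_mul, Finset.sum_congr rfl fun a _ => h a,
    Finset.sum_sub_distrib, ← Finset.sum_smul, ← Finset.mul_sum, ← Finset.mul_sum]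
  rw [PiLp.inner_apply]
  rfl

theorem slash_sq (hγ : IsGamma γ) (x : Space) : slash γ x * slash γ x = (‖x‖ ^ 2) • (1 : Mat) := by
  have h := hγ.slash_mul_slash x x
  rw [eq_sub_iff_add_eq, ← two_smul ℝ, real_inner_self_eq_norm_sq, mul_smul] at h
  exact smul_right_injective _ (two_ne_zero (α := ℝ)) h

theorem slash_isHermitian (hγ : IsGamma γ) (x : Space) : star (slash γ x) = slash γ x := by
  simp only [slash, star_sum, star_smul, star_trivial]
  exact Finset.sum_congr rfl fun a _ => by rw [Matrix.star_eq_conjTranspose, (hγ.hermitian a).eq]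

/-- Conjugation by a unit vector is minus the reflection. -/
theorem slash_conj (hγ : IsGamma γ) {n : Space} (hn : ‖n‖ = 1) (x : Space) :
    slash γ n * slash γ x * slash γ n = -slash γ ((ℝ ∙ n)ᗮ.reflection x) := by
  rw [Submodule.reflection_orthogonal_apply, Submodule.reflection_singleton_apply,
    hγ.slash_mul_slash, sub_mul, mul_assoc, hγ.slash_sq, hn, slash_neg, slash_sub, two_smul,
    slash_add, slash_smul]
  simp only [RCLike.ofReal_real_eq_id, id, one_pow, one_smul, mul_one,
    div_one, neg_neg, two_mul, add_smul, add_mul, smul_mul_assoc, one_mul]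

/-- Every orthogonal transformation is implemented by a unitary matrix, up to its determinant. -/
theorem exists_spin (hγ : IsGamma γ) (O : Space ≃ₗᵢ[ℝ] Space) :
    ∃ S ∈ Matrix.unitaryGroup (Fin 4) ℂ, ∀ x, S * slash γ x * star S =
      LinearMap.det (O.toLinearEquiv : Space →ₗ[ℝ] Space) • slash γ (O x) := by
  -- By Cartan–Dieudonné, `O` is a product of reflections. Conjugation by a unit vector is minus a
  -- reflection, and each reflection also flips the determinant, so the signs match.
  obtain ⟨l, -, rfl⟩ := O.reflections_generate_dim
  induction l with
  | nil =>
    refine ⟨1, one_mem _, fun x => ?_⟩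
    have : LinearMap.det (((List.map (fun v : Space => (ℝ ∙ v)ᗮ.reflection) []).prod.toLinearEquiv :
        Space ≃ₗ[ℝ] Space) : Space →ₗ[ℝ] Space) = 1 := LinearMap.det_id
    rw [this]
    simp
  | cons v l ih =>
    obtain ⟨S, hS, h⟩ := ih
    simp only [List.map_cons, List.prod_cons]
    set O := (List.map (fun v : Space => (ℝ ∙ v)ᗮ.reflection) l).prod
    -- The list of vectors may contain zero, whose associated reflection is the identity.
    by_cases hv : v = 0
    · refine ⟨S, hS, fun x => ?_⟩
      have : (ℝ ∙ v)ᗮ.reflection = 1 := by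
        ext1 x
        rw [Submodule.reflection_orthogonal_apply, Submodule.reflection_singleton_apply, hv]
        simp
      rw [this, one_mul]
      exact h x
    have hv' : ‖v‖ ≠ 0 := norm_ne_zero_iff.2 hv
    set n : Space := ‖v‖⁻¹ • v with hn
    have hn1 : ‖n‖ = 1 := by rw [hn, norm_smul, norm_inv, norm_norm, inv_mul_cancel₀ hv']
    have hspan : (ℝ ∙ v) = (ℝ ∙ n) :=
      (Submodule.span_singleton_smul_eq (isUnit_iff_ne_zero.2 (inv_ne_zero hv')) v).symm
    have hrefl : ∀ y, (ℝ ∙ v)ᗮ.reflection y = (ℝ ∙ n)ᗮ.reflection y := fun y => by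
      congr 2
      rw [hspan]
    have hdet : LinearMap.det (((ℝ ∙ v)ᗮ.reflection * O).toLinearEquiv : Space →ₗ[ℝ] Space) =
        -LinearMap.det (O.toLinearEquiv : Space →ₗ[ℝ] Space) := by
      have h1 := (ℝ ∙ v)ᗮ.det_reflection
      rw [Submodule.orthogonal_orthogonal, finrank_span_singleton hv, pow_one] at h1
      have h2 : (((ℝ ∙ v)ᗮ.reflection * O).toLinearEquiv : Space →ₗ[ℝ] Space) =
        (ℝ ∙ v)ᗮ.reflection.toLinearMap ∘ₗ (O.toLinearEquiv : Space →ₗ[ℝ] Space) := rfl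
      rw [h2, LinearMap.det_comp, h1, neg_one_mul]
    have hu : slash γ n ∈ Matrix.unitaryGroup (Fin 4) ℂ := by
      rw [Matrix.mem_unitaryGroup_iff, hγ.slash_isHermitian, hγ.slash_sq, hn1, one_pow, one_smul]
    refine ⟨slash γ n * S, mul_mem hu hS, fun x => ?_⟩
    rw [star_mul, hγ.slash_isHermitian, hdet, LinearIsometryEquiv.coe_mul, Function.comp_apply, neg_smul,
      ← smul_neg, hrefl, ← hγ.slash_conj hn1, ← smul_mul_assoc, ← mul_smul_comm, ← h x]
    simp only [mul_assoc]

end IsGamma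

theorem norm_rotate {R : Matrix (Fin 5) (Fin 5) ℝ}
    (hR : R ∈ Matrix.specialOrthogonalGroup (Fin 5) ℝ) (x : Space) : ‖rotate R x‖ = ‖x‖ := by
  have h1 : R.transpose * R = 1 :=
    Matrix.mem_unitaryGroup_iff'.1 (Matrix.mem_specialUnitaryGroup_iff.1 hR).1
  have h2 : ‖rotate R x‖ ^ 2 = ‖x‖ ^ 2 := by
    rw [EuclideanSpace.real_norm_sq_eq, EuclideanSpace.real_norm_sq_eq]
    have h3 : ∀ v : Fin 5 → ℝ, ∑ i, v i ^ 2 = v ⬝ᵥ v := fun v => by simp [dotProduct, _root_.sq]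
    rw [h3, h3]
    simp only [rotate]
    rw [Matrix.dotProduct_mulVec, Matrix.vecMul_mulVec, h1, Matrix.vecMul_one]
  exact (sq_eq_sq₀ (norm_nonneg _) (norm_nonneg _)).1 h2

/-- Every rotation is implemented by a unitary matrix. -/
theorem IsGamma.exists_spin_rotate {γ : Fin 5 → Mat} (hγ : IsGamma γ)
    {R : Matrix (Fin 5) (Fin 5) ℝ} (hR : R ∈ Matrix.specialOrthogonalGroup (Fin 5) ℝ) :
    ∃ S ∈ Matrix.unitaryGroup (Fin 4) ℂ, ∀ x, S * slash γ x * star S = slash γ (rotate R x) := by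
  let L : Space →ₗᵢ[ℝ] Space := ⟨Matrix.toEuclideanLin R, norm_rotate hR⟩
  obtain ⟨S, hS, h⟩ := hγ.exists_spin (L.toLinearIsometryEquiv rfl)
  refine ⟨S, hS, fun x => ?_⟩
  have h1 : ((L.toLinearIsometryEquiv rfl).toLinearEquiv : Space →ₗ[ℝ] Space) =
      Matrix.toEuclideanLin R := by ext1 x; rfl
  rw [h x, h1, Matrix.toEuclideanLin_eq_toLin_orthonormal, LinearMap.det_toLin,
    (Matrix.mem_specialUnitaryGroup_iff.1 hR).2, one_smul]
  rfl

/-! ### The Levi-Civita symbol -/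

/-- Permuting the indices permutes the rows of the matrix whose determinant defines the symbol. -/
theorem leviCivita_comp (σ : Equiv.Perm (Fin 5)) (v : Fin 5 → Fin 5) :
    leviCivita (v (σ 0)) (v (σ 1)) (v (σ 2)) (v (σ 3)) (v (σ 4)) =
      (Equiv.Perm.sign σ : ℤ) * leviCivita (v 0) (v 1) (v 2) (v 3) (v 4) := by
  unfold leviCivita
  have h : (Matrix.of fun p q : Fin 5 =>
      if ![v (σ 0), v (σ 1), v (σ 2), v (σ 3), v (σ 4)] p = q then (1 : ℝ) else 0) =
      (Matrix.of fun p q : Fin 5 =>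
        if ![v 0, v 1, v 2, v 3, v 4] p = q then (1 : ℝ) else 0).submatrix σ id := by
    have h1 : ![v (σ 0), v (σ 1), v (σ 2), v (σ 3), v (σ 4)] = v ∘ σ := by
      funext p; fin_cases p <;> rfl
    have h2 : ![v 0, v 1, v 2, v 3, v 4] = v := by funext p; fin_cases p <;> rfl
    rw [h1, h2]
    rfl
  rw [h, Matrix.det_permute]

theorem leviCivita_swap (a b : Fin 5) (hab : a ≠ b) (v : Fin 5 → Fin 5) :
    leviCivita (v (Equiv.swap a b 0)) (v (Equiv.swap a b 1)) (v (Equiv.swap a b 2))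
      (v (Equiv.swap a b 3)) (v (Equiv.swap a b 4)) =
      -leviCivita (v 0) (v 1) (v 2) (v 3) (v 4) := by
  rw [leviCivita_comp, Equiv.Perm.sign_swap hab]
  simp

theorem leviCivita_swap₀₁ (i j k l m : Fin 5) :
    leviCivita j i k l m = -leviCivita i j k l m :=
  leviCivita_swap 0 1 (by decide) ![i, j, k, l, m]

theorem leviCivita_swap₁₂ (i j k l m : Fin 5) :
    leviCivita i k j l m = -leviCivita i j k l m :=
  leviCivita_swap 1 2 (by decide) ![i, j, k, l, m]

theorem leviCivita_swap₂₃ (i j k l m : Fin 5) :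
    leviCivita i j l k m = -leviCivita i j k l m :=
  leviCivita_swap 2 3 (by decide) ![i, j, k, l, m]

/-- The Leibniz formula; it turns contractions with the symbol into sums over permutations. -/
theorem leviCivita_eq_sum (i j k l m : Fin 5) : leviCivita i j k l m =
    ∑ σ : Equiv.Perm (Fin 5), ((Equiv.Perm.sign σ : ℤ) : ℝ) *
      if i = σ 0 ∧ j = σ 1 ∧ k = σ 2 ∧ l = σ 3 ∧ m = σ 4 then 1 else 0 := by
  unfold leviCivita
  rw [← Matrix.det_transpose, Matrix.det_apply']
  refine Finset.sum_congr rfl fun σ _ => ?_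
  congr 1
  simp only [Matrix.transpose_apply, Matrix.of_apply, Fin.prod_univ_five, ← ite_and, mul_ite,
    mul_one, mul_zero]
  simp
  congr 1
  apply propext
  tauto

/-- The chirality condition for an arbitrary order of the factors. -/
theorem IsGamma.sign_smul_prod {γ : Fin 5 → Mat} (hγ : IsGamma γ) (σ : Equiv.Perm (Fin 5)) :
    ((Equiv.Perm.sign σ : ℤ) : ℝ) • (γ (σ 0) * γ (σ 1) * γ (σ 2) * γ (σ 3) * γ (σ 4)) = 1 := by
  -- Adjacent transpositions generate the group. Multiplying on the right by one swaps two
  -- neighbouring factors, and anticommutation cancels the change of sign.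
  have hσ : σ ∈ Submonoid.closure
      (range fun i : Fin 4 => Equiv.swap i.castSucc i.succ) := by
    rw [Equiv.Perm.mclosure_swap_castSucc_succ]; trivial
  induction hσ using Submonoid.closure_induction_right with
  | one => simpa using hγ.chirality
  | mul_right σ _ s hs ih =>
    obtain ⟨i, rfl⟩ := hs
    have hne : i.castSucc ≠ i.succ := (Fin.castSucc_lt_succ).ne
    rw [Equiv.Perm.sign_mul, Equiv.Perm.sign_swap hne, ← ih]
    simp only [mul_neg, mul_one, Units.val_neg, Int.cast_neg, neg_smul, ← smul_neg]
    congr 1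
    have h := fun a b (hab : a ≠ b) => hγ.anticomm (σ.injective.ne hab)
    fin_cases i
    · change -(γ (σ 1) * γ (σ 0) * γ (σ 2) * γ (σ 3) * γ (σ 4)) = _
      rw [h 0 1 (by decide)]; simp only [neg_mul]
    · change -(γ (σ 0) * γ (σ 2) * γ (σ 1) * γ (σ 3) * γ (σ 4)) = _
      rw [mul_assoc (γ (σ 0)) (γ (σ 2)), h 2 1 (by decide)]
      simp only [neg_mul, mul_neg, neg_neg, mul_assoc]
    · change -(γ (σ 0) * γ (σ 1) * γ (σ 3) * γ (σ 2) * γ (σ 4)) = _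
      rw [mul_assoc _ (γ (σ 3)) (γ (σ 2)), h 3 2 (by decide)]
      simp only [neg_mul, mul_neg, neg_neg, mul_assoc]
    · change -(γ (σ 0) * γ (σ 1) * γ (σ 2) * γ (σ 4) * γ (σ 3)) = _
      rw [mul_assoc _ (γ (σ 4)) (γ (σ 3)), h 4 3 (by decide)]
      simp only [mul_neg, neg_neg, mul_assoc]

/-- Contraction of the Levi-Civita symbol with three gamma matrices. -/
theorem IsGamma.sum_leviCivita_three {γ : Fin 5 → Mat} (hγ : IsGamma γ) (i m : Fin 5) :
    ∑ j, ∑ k, ∑ l, leviCivita i j k l m • (γ j * γ k * γ l) =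
      (6 : ℝ) • (γ i * γ m - (if i = m then (1 : ℝ) else 0) • (1 : Mat)) := by
  -- Multiply the ordered chirality relation by the first factor on the left and the last on the
  -- right; their squares are 1.
  have hσ : ∀ σ : Equiv.Perm (Fin 5), ((Equiv.Perm.sign σ : ℤ) : ℝ) •
      (γ (σ 1) * γ (σ 2) * γ (σ 3)) = γ (σ 0) * γ (σ 4) := fun σ => by
    have h1 := congrArg (fun M => γ (σ 0) * M * γ (σ 4)) (hγ.sign_smul_prod σ)
    simp only [mul_one, mul_smul_comm, smul_mul_assoc] at h1
    rw [← h1]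
    congr 1
    simp only [mul_assoc, hγ.sq, mul_one]
    rw [← mul_assoc (γ (σ 0)), hγ.sq, one_mul]
  -- Fixing two distinct images leaves 3! = 6 permutations. For i = m there are none, in agreement
  -- with γ_i² - 1 = 0.
  have hcard : ∀ i m : Fin 5, (Finset.univ.filter fun σ : Equiv.Perm (Fin 5) =>
      i = σ 0 ∧ m = σ 4).card = if i = m then 0 else 6 := by decide +kernel
  calc ∑ j, ∑ k, ∑ l, leviCivita i j k l m • (γ j * γ k * γ l)
      = ∑ σ : Equiv.Perm (Fin 5), ∑ j, ∑ k, ∑ l, (((Equiv.Perm.sign σ : ℤ) : ℝ) *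
          if i = σ 0 ∧ j = σ 1 ∧ k = σ 2 ∧ l = σ 3 ∧ m = σ 4 then 1 else 0) •
            (γ j * γ k * γ l) := by
        simp only [leviCivita_eq_sum, Finset.sum_smul]
        simp only [Finset.sum_comm (t := (Finset.univ : Finset (Equiv.Perm (Fin 5))))]
    _ = ∑ σ : Equiv.Perm (Fin 5), if i = σ 0 ∧ m = σ 4 then γ i * γ m else 0 := by
        refine Finset.sum_congr rfl fun σ _ => ?_
        split_ifs with h
        · rw [Finset.sum_eq_single (σ 1), Finset.sum_eq_single (σ 2), Finset.sum_eq_single (σ 3)]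
          · rw [if_pos ⟨h.1, rfl, rfl, rfl, h.2⟩, mul_one, hσ, h.1, h.2]
          · intro l _ hl; rw [if_neg (by tauto), mul_zero, zero_smul]
          · simp
          · intro k _ hk
            exact Finset.sum_eq_zero fun l _ => by rw [if_neg (by tauto), mul_zero, zero_smul]
          · simp
          · intro j _ hj
            exact Finset.sum_eq_zero fun k _ => Finset.sum_eq_zero fun l _ => by
              rw [if_neg (by tauto), mul_zero, zero_smul]
          · simp
        · exact Finset.sum_eq_zero fun j _ => Finset.sum_eq_zero fun k _ =>
            Finset.sum_eq_zero fun l _ => by rw [if_neg (by tauto), mul_zero, zero_smul]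
    _ = _ := by
        rw [← Finset.sum_filter, Finset.sum_const, hcard]
        split_ifs with h
        · subst h; simp [hγ.sq]
        · simp [← Nat.cast_smul_eq_nsmul ℝ]

theorem eq_zero_of_eq_neg {M : Mat} (h : M = -M) : M = 0 := by
  have h2 : (2 : ℝ) • M = 0 := by rw [two_smul, ← sub_neg_eq_add, ← h, sub_self]
  exact (smul_eq_zero.1 h2).resolve_left two_ne_zero

/-! ### Contractions entering F ∧ F. -/

/-- Contraction of the Levi-Civita symbol with a four-index quantity. -/
def contract (m : Fin 5) (T : Fin 5 → Fin 5 → Fin 5 → Fin 5 → Mat) : Mat :=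
  ∑ i, ∑ j, ∑ k, ∑ l, leviCivita i j k l m • T i j k l

section contract

variable (m : Fin 5) (T T' : Fin 5 → Fin 5 → Fin 5 → Fin 5 → Mat)

theorem contract_add : contract m (fun i j k l => T i j k l + T' i j k l) =
    contract m T + contract m T' := by
  simp only [contract, smul_add, Finset.sum_add_distrib]

theorem contract_smul (c : ℝ) : contract m (fun i j k l => c • T i j k l) = c • contract m T := by
  simp only [contract, smul_comm _ c, Finset.smul_sum]

theorem contract_sub : contract m (fun i j k l => T i j k l - T' i j k l) =
    contract m T - contract m T' := by
  simp only [contract, smul_sub, Finset.sum_sub_distrib]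

theorem contract_swap₀₁ : contract m (fun i j k l => T j i k l) = -contract m T := by
  rw [contract, contract, Finset.sum_comm]
  simp only [← Finset.sum_neg_distrib]
  refine Finset.sum_congr rfl fun i _ => Finset.sum_congr rfl fun j _ =>
    Finset.sum_congr rfl fun k _ => Finset.sum_congr rfl fun l _ => ?_
  rw [leviCivita_swap₀₁, neg_smul]

theorem contract_swap₁₂ : contract m (fun i j k l => T i k j l) = -contract m T := by
  simp only [contract, ← Finset.sum_neg_distrib]
  refine Finset.sum_congr rfl fun i _ => ?_
  rw [Finset.sum_comm]
  refine Finset.sum_congr rfl fun j _ => Finset.sum_congr rfl fun k _ =>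
    Finset.sum_congr rfl fun l _ => ?_
  rw [leviCivita_swap₁₂, neg_smul]

theorem contract_swap₂₃ : contract m (fun i j k l => T i j l k) = -contract m T := by
  simp only [contract, ← Finset.sum_neg_distrib]
  refine Finset.sum_congr rfl fun i _ => Finset.sum_congr rfl fun j _ => ?_
  rw [Finset.sum_comm]
  refine Finset.sum_congr rfl fun k _ => Finset.sum_congr rfl fun l _ => ?_
  rw [leviCivita_swap₂₃, neg_smul]

variable {m T}

theorem contract_eq_zero₁₂ (h : ∀ i j k l, T i k j l = T i j k l) : contract m T = 0 := by
  have h1 := contract_swap₁₂ m T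
  simp only [h] at h1
  exact eq_zero_of_eq_neg h1

/-- The swap of positions 0 and 2 is a product of three adjacent swaps, hence odd. -/
theorem contract_eq_zero₀₂ (h : ∀ i j k l, T k j i l = T i j k l) : contract m T = 0 := by
  have h1 := contract_swap₀₁ m fun i j k l => T k i j l
  have h2 := contract_swap₁₂ m fun i j k l => T j i k l
  have h3 := contract_swap₀₁ m T
  rw [h3, neg_neg] at h2
  rw [h2] at h1
  simp only [h] at h1
  exact eq_zero_of_eq_neg h1

/-- The contraction that gives `*₅ (F ∧ F)`. -/
theorem IsGamma.contract_eq {γ : Fin 5 → Mat} (hγ : IsGamma γ) (x : Space) (P S : ℝ) (m : Fin 5)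
    (F : Fin 5 → Fin 5 → Mat) (hF : ∀ i j, F i j =
      P • (slash γ x * (x i • γ j - x j • γ i)) + S • (γ i * γ j - γ j * γ i)) :
    (1 / 4 : ℝ) • contract m (fun i j k l => F i j * F k l) =
      (24 * S ^ 2) • γ m + (12 * P * S) • (‖x‖ ^ 2 • γ m - x m • slash γ x) := by
  set X := slash γ x with hX
  -- `F` is the antisymmetrisation of `f`. The symbol antisymmetrises anyway, so each `F` can be
  -- replaced by 2 `f`, and the product by 4 `f f`.
  set f : Fin 5 → Fin 5 → Mat := fun i j => (P * x i) • (X * γ j) + S • (γ i * γ j) with hf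
  have hFf : ∀ i j, F i j = f i j - f j i := fun i j => by
    rw [hF, hf]
    simp only [mul_sub, smul_sub, mul_smul_comm, smul_smul]
    abel
  have h1 : contract m (fun i j k l => F i j * F k l) =
      (4 : ℝ) • contract m (fun i j k l => f i j * f k l) := by
    have e : (fun i j k l => F i j * F k l) = fun i j k l =>
        (f i j * f k l - f j i * f k l) - (f i j * f l k - f j i * f l k) := by
      funext i j k l; rw [hFf, hFf]; noncomm_ring
    have s1 := contract_swap₀₁ m fun i j k l => f i j * f k l
    have s2 := contract_swap₂₃ m fun i j k l => f i j * f k l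
    have s3 := contract_swap₀₁ m fun i j k l => f i j * f l k
    rw [e, contract_sub m (fun i j k l => f i j * f k l - f j i * f k l),
      contract_sub m (fun i j k l => f i j * f k l), contract_sub m (fun i j k l => f i j * f l k),
      s3, s2, s1, show (4 : ℝ) = 1 + 1 + 1 + 1 by norm_num]
    simp only [add_smul, one_smul]
    abel
  have hgX : ∀ i, γ i * X = (2 * x i) • (1 : Mat) - X * γ i := fun i => hγ.gamma_mul_slash i x
  have hggX : ∀ i j, γ i * γ j * X =
      (2 * x j) • γ i - (2 * x i) • γ j + X * γ i * γ j := fun i j => by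
    rw [mul_assoc, hgX, mul_sub, ← mul_assoc, hgX, sub_mul]
    simp only [mul_smul_comm, smul_mul_assoc, mul_one, one_mul]
    abel
  have e : (fun i j k l => f i j * f k l) = fun i j k l =>
      (P ^ 2) • ((x i * x k) • (X * γ j * X * γ l)) +
      ((P * S) • (x i • (X * (γ j * γ k * γ l))) +
      ((P * S) • ((2 * x j * x k) • (γ i * γ l) - (2 * x i * x k) • (γ j * γ l) +
        x k • (X * (γ i * γ j * γ l))) +
      (S ^ 2) • (γ i * (γ j * γ k * γ l)))) := by
    funext i j k l
    have h2 := congrArg (fun M => M * γ l) (hggX i j)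
    simp only [add_mul, sub_mul, smul_mul_assoc] at h2
    have h3 : f i j * f k l = (P ^ 2) • ((x i * x k) • (X * γ j * X * γ l)) +
      ((P * S) • (x i • (X * (γ j * γ k * γ l))) +
      ((P * S) • (x k • (γ i * γ j * X * γ l)) + (S ^ 2) • (γ i * (γ j * γ k * γ l)))) := by
      simp only [hf, add_mul, mul_add, smul_mul_assoc, mul_smul_comm, smul_smul, mul_assoc]
      module
    rw [h3, h2]
    simp only [smul_add, smul_sub, smul_smul, mul_assoc]
    module
  -- After moving X to the left, terms with two factors of x in contracted indices are symmetric and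
  -- vanish. This kills the P² term; the two PS terms contribute 6 each, and the S² term 24.
  have c1 : contract m (fun i j k l => (x i * x k) • (X * γ j * X * γ l)) = 0 :=
    contract_eq_zero₀₂ fun i j k l => by rw [mul_comm]
  have c2 : contract m (fun i j k l => x i • (X * (γ j * γ k * γ l))) =
      (6 : ℝ) • (‖x‖ ^ 2 • γ m - x m • X) := by
    have h2 : ∀ i, ∑ j, ∑ k, ∑ l, leviCivita i j k l m • (x i • (X * (γ j * γ k * γ l))) =
        (6 : ℝ) • (X * (x i • γ i) * γ m) - (6 : ℝ) • ((if i = m then x i else 0) • X) := by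
      intro i
      have h3 := congrArg (fun M => x i • (X * M)) (hγ.sum_leviCivita_three i m)
      simp only [Finset.mul_sum, Finset.smul_sum, mul_smul_comm, smul_comm (x i)] at h3
      rw [h3, mul_sub, smul_sub, smul_sub]
      simp only [mul_smul_comm, smul_mul_assoc, mul_assoc, mul_one, smul_smul]
      congr 2
      split_ifs <;> simp
    rw [contract, Finset.sum_congr rfl fun i _ => h2 i, Finset.sum_sub_distrib, ← Finset.smul_sum,
      ← Finset.sum_mul, ← Finset.mul_sum, ← Finset.smul_sum, ← Finset.sum_smul,
      Finset.sum_ite_eq', if_pos (Finset.mem_univ _), ← slash, ← hX, hγ.slash_sq, smul_mul_assoc,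
      one_mul, smul_sub]
  have c3 : contract m (fun i j k l => (2 * x j * x k) • (γ i * γ l)) = 0 :=
    contract_eq_zero₁₂ fun i j k l => by rw [mul_right_comm]
  have c4 : contract m (fun i j k l => (2 * x i * x k) • (γ j * γ l)) = 0 :=
    contract_eq_zero₀₂ fun i j k l => by rw [mul_right_comm]
  have c5 : contract m (fun i j k l => x k • (X * (γ i * γ j * γ l))) =
      (6 : ℝ) • (‖x‖ ^ 2 • γ m - x m • X) := by
    rw [← c2, contract_swap₁₂ m fun i j k l => x j • (X * (γ i * γ k * γ l)),
      contract_swap₀₁ m fun i j k l => x i • (X * (γ j * γ k * γ l)), neg_neg]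
  have c6 : contract m (fun i j k l => γ i * (γ j * γ k * γ l)) = (24 : ℝ) • γ m := by
    have h2 : ∀ i, ∑ j, ∑ k, ∑ l, leviCivita i j k l m • (γ i * (γ j * γ k * γ l)) =
        (6 : ℝ) • γ m - (6 : ℝ) • (if i = m then γ i else 0) := by
      intro i
      have h3 := congrArg (fun M => γ i * M) (hγ.sum_leviCivita_three i m)
      simp only [Finset.mul_sum, mul_smul_comm] at h3
      rw [h3, mul_sub, smul_sub, ← mul_assoc, hγ.sq, one_mul]
      congr 2
      split_ifs <;> simp
    rw [contract, Finset.sum_congr rfl fun i _ => h2 i, Finset.sum_sub_distrib, ← Finset.smul_sum,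
      ← Finset.smul_sum, Finset.sum_ite_eq', if_pos (Finset.mem_univ _), Finset.sum_const, Finset.card_univ,
      Fintype.card_fin]
    module
  rw [h1, e, contract_add, contract_smul, c1, contract_add, contract_smul, c2, contract_add,
    contract_smul, contract_add, contract_sub, c3, c4, c5, contract_smul, c6]
  module

end contract

/-! ### Calculus of radial fields -/

theorem hasFDerivAt_norm_of_ne_zero {x : Space} (hx : x ≠ 0) :
    HasFDerivAt (fun y : Space => ‖y‖) (‖x‖⁻¹ • innerSL ℝ x) x := by
  have h := (hasStrictFDerivAt_norm_sq x).hasFDerivAt.sqrt (pow_ne_zero 2 (norm_ne_zero_iff.2 hx))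
  simp only [Real.sqrt_sq (norm_nonneg _)] at h
  refine h.congr_fderiv ?_
  ext y
  simp
  field_simp

theorem hasFDerivAt_radial_mul {ρ : ℝ → ℝ} {ρ' : ℝ} {x : Space} (hx : x ≠ 0)
    (hρ : HasDerivAt ρ ρ' ‖x‖) (a : Fin 5) :
    HasFDerivAt (fun y : Space => ρ ‖y‖ * y a) (ρ ‖x‖ • (EuclideanSpace.proj a : Space →L[ℝ] ℝ) +
      x a • ρ' • ‖x‖⁻¹ • innerSL ℝ x) x := by
  have h1 : HasFDerivAt (fun y : Space => y a) (EuclideanSpace.proj a : Space →L[ℝ] ℝ) x :=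
    (EuclideanSpace.proj a : Space →L[ℝ] ℝ).hasFDerivAt
  exact (hρ.comp_hasFDerivAt x (hasFDerivAt_norm_of_ne_zero hx)).mul h1

theorem pderiv_sum_smul {ι : Type*} [Fintype ι] {f : ι → Space → ℝ} {f' : ι → Space →L[ℝ] ℝ}
    {x : Space} (hf : ∀ a, HasFDerivAt (f a) (f' a) x) (M : ι → Mat) (i : Fin 5) :
    pderiv i (fun y => ∑ a, f a y • M a) x = ∑ a, f' a (EuclideanSpace.single i 1) • M a := by
  ext p q
  have h : HasFDerivAt (fun y => ∑ a, f a y • M a p q) (∑ a, (f' a).smulRight (M a p q)) x :=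
    HasFDerivAt.fun_sum fun a _ => (hf a).smul_const (M a p q)
  have e : (fun y => (∑ a, f a y • M a) p q) = fun y => ∑ a, f a y • M a p q := by
    funext y; simp [Matrix.sum_apply]
  simp only [pderiv, Matrix.of_apply, e, h.fderiv]
  simp [Matrix.sum_apply]

/-- Partial derivatives of a radial multiple of a linear function. -/
theorem pderiv_radial_smul_slash {ρ : ℝ → ℝ} {ρ' : ℝ} {x : Space} (hx : x ≠ 0)
    (hρ : HasDerivAt ρ ρ' ‖x‖) (M : Fin 5 → Mat) (i : Fin 5) :
    pderiv i (fun y => ρ ‖y‖ • slash M y) x =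
      ρ ‖x‖ • M i + (ρ' * x i / ‖x‖) • slash M x := by
  have e : (fun y => ρ ‖y‖ • slash M y) = fun y => ∑ a, (ρ ‖y‖ * y a) • M a := by
    funext y; simp only [slash, Finset.smul_sum, smul_smul]
  rw [e, pderiv_sum_smul (fun a => hasFDerivAt_radial_mul hx hρ a)]
  have h : ∀ a, (ρ ‖x‖ • (EuclideanSpace.proj a : Space →L[ℝ] ℝ) +
      x a • ρ' • ‖x‖⁻¹ • innerSL ℝ x) (EuclideanSpace.single i 1) • M a =
      (if a = i then ρ ‖x‖ • M i else 0) + (ρ' * x i / ‖x‖) • (x a • M a) := by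
    intro a
    have h1 : inner ℝ x (EuclideanSpace.single i (1 : ℝ)) = x i := by
      simp [EuclideanSpace.inner_single_right]
    simp only [add_apply, smul_apply, innerSL_apply_apply,
      h1, add_smul, smul_smul, smul_eq_mul]
    congr 1
    · split_ifs with h
      · subst h; simp
      · simp [h]
    · congr 1; ring
  rw [Finset.sum_congr rfl fun a _ => h a, Finset.sum_add_distrib, Finset.sum_ite_eq',
    if_pos (Finset.mem_univ _), ← Finset.smul_sum, slash]

/-- Criterion for a radial vector field to be continuously differentiable at the origin too. -/
theorem contDiff_radial_mul {ρ : ℝ → ℝ} {c : ℝ} (hd : ∀ r > 0, DifferentiableAt ℝ ρ r)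
    (hc : ContinuousOn (deriv ρ) (Ioi 0)) (h0 : Tendsto ρ (𝓝[>] 0) (𝓝 c))
    (h1 : Tendsto (fun r => r * deriv ρ r) (𝓝[>] 0) (𝓝 0)) (a : Fin 5) :
    ContDiff ℝ 1 fun x : Space => ρ ‖x‖ * x a := by
  classical
  set L : Space →L[ℝ] ℝ := EuclideanSpace.proj a with hL
  have hLa : ∀ x : Space, L x = x a := fun x => rfl
  have habs : ∀ x : Space, |x a| ≤ ‖x‖ := fun x => by
    rw [← Real.norm_eq_abs]; exact PiLp.norm_apply_le x a
  have hnorm : Tendsto (fun x : Space => ‖x‖) (𝓝[≠] 0) (𝓝[>] 0) := tendsto_norm_nhdsNE_zero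
  -- The candidate derivative. The value of ρ at 0 never matters, since it is multiplied by a
  -- coordinate that vanishes there.
  set G : Space → Space →L[ℝ] ℝ := fun x => if x = 0 then c • L else
    ρ ‖x‖ • L + x a • deriv ρ ‖x‖ • ‖x‖⁻¹ • innerSL ℝ x with hG
  have hG0 : G 0 = c • L := if_pos rfl
  have hG' : ∀ x ≠ 0, G x = ρ ‖x‖ • L + x a • deriv ρ ‖x‖ • ‖x‖⁻¹ • innerSL ℝ x :=
    fun x hx => if_neg hx
  have hderiv : ∀ x, HasFDerivAt (fun x : Space => ρ ‖x‖ * x a) (G x) x := by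
    intro x
    by_cases hx : x = 0
    · subst hx
      rw [hG0, hasFDerivAt_iff_isLittleO_nhds_zero]
      refine IsLittleO.of_bound fun ε hε => ?_
      have h2 : ∀ᶠ x : Space in 𝓝[≠] 0, |ρ ‖x‖ - c| < ε := by
        have := (hnorm.eventually (h0.eventually (Metric.ball_mem_nhds c hε)))
        simpa [Real.dist_eq] using this
      rw [eventually_nhdsWithin_iff] at h2
      filter_upwards [h2] with x hx
      by_cases hx0 : x = 0
      · subst hx0; simp
      · have h3 : ρ ‖0 + x‖ * (0 + x) a - ρ ‖(0 : Space)‖ * (0 : Space) a - (c • L) x =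
            (ρ ‖x‖ - c) * x a := by
          simp [hLa]; ring
        rw [h3, norm_mul, Real.norm_eq_abs, Real.norm_eq_abs]
        exact mul_le_mul (hx hx0).le (habs x) (abs_nonneg _) hε.le
    · rw [hG' x hx]
      exact hasFDerivAt_radial_mul hx (hd _ (norm_pos_iff.2 hx)).hasDerivAt a
  rw [contDiff_one_iff_fderiv]
  refine ⟨fun x => (hderiv x).differentiableAt, ?_⟩
  have hfd : fderiv ℝ (fun x : Space => ρ ‖x‖ * x a) = G := funext fun x => (hderiv x).fderiv
  rw [hfd, continuous_iff_continuousAt]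
  intro x
  by_cases hx : x = 0
  · subst hx
    rw [continuousAt_iff_punctured_nhds, hG0, tendsto_iff_norm_sub_tendsto_zero]
    -- A bound for ‖G x - c L‖ using |x_a| ≤ ‖x‖; its second term is the reason for requiring r ρ' →
    -- 0.
    have h2 : Tendsto (fun x : Space => |ρ ‖x‖ - c| * ‖L‖ + |‖x‖ * deriv ρ ‖x‖|) (𝓝[≠] 0) (𝓝 0) := by
      have h3 := ((((h0.comp hnorm).sub_const c).abs).mul_const ‖L‖).add (h1.comp hnorm).abs
      simpa using h3
    refine squeeze_zero' (Eventually.of_forall fun _ => norm_nonneg _) ?_ h2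
    filter_upwards [self_mem_nhdsWithin] with x hx
    have hx : x ≠ 0 := hx
    have hx' : 0 < ‖x‖ := norm_pos_iff.2 hx
    have e : G x - c • L = (ρ ‖x‖ - c) • L + x a • deriv ρ ‖x‖ • ‖x‖⁻¹ • innerSL ℝ x := by
      rw [hG' x hx]
      ext y
      simp
      ring
    rw [e]
    refine (norm_add_le _ _).trans (add_le_add (by rw [norm_smul, Real.norm_eq_abs]) ?_)
    rw [norm_smul, norm_smul, norm_smul, innerSL_apply_norm, norm_inv, norm_norm,
      inv_mul_cancel₀ hx'.ne', mul_one, abs_mul, abs_norm, Real.norm_eq_abs, Real.norm_eq_abs]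
    exact mul_le_mul_of_nonneg_right (habs x) (abs_nonneg _)
  · have hx' : 0 < ‖x‖ := norm_pos_iff.2 hx
    have hcn : ContinuousAt (fun x : Space => ‖x‖) x := continuous_norm.continuousAt
    have hρ : ContinuousAt (fun x : Space => ρ ‖x‖) x :=
      ContinuousAt.comp (g := ρ) (hd _ hx').continuousAt hcn
    have hρ' : ContinuousAt (fun x : Space => deriv ρ ‖x‖) x :=
      ContinuousAt.comp (g := deriv ρ) (hc.continuousAt (Ioi_mem_nhds hx')) hcn
    have hxa : ContinuousAt (fun x : Space => x a) x := L.continuous.continuousAt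
    have hi : ContinuousAt (fun x : Space => innerSL ℝ x) x := (innerSL ℝ).continuous.continuousAt
    have hG2 : ContinuousAt (fun x : Space => ρ ‖x‖ • L +
        x a • deriv ρ ‖x‖ • ‖x‖⁻¹ • innerSL ℝ x) x :=
      (hρ.smul continuousAt_const).add
        (hxa.smul (hρ'.smul ((hcn.inv₀ hx'.ne').smul hi)))
    refine hG2.congr ?_
    filter_upwards [isOpen_ne.mem_nhds hx] with y hy using (hG' y hy).symm

/-! ### The hedgehog fields -/

/-- The components `x^a γ_a γ_i - x_i` of `r² e de`, as linear functions of `x`. -/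
def hedgehogCoeff (γ : Fin 5 → Mat) (i a : Fin 5) : Mat :=
  γ a * γ i - (if a = i then (1 : ℝ) else 0) • (1 : Mat)

theorem slash_hedgehogCoeff (γ : Fin 5 → Mat) (i : Fin 5) (x : Space) :
    slash (hedgehogCoeff γ i) x = slash γ x * γ i - x i • (1 : Mat) := by
  simp only [slash, hedgehogCoeff, smul_sub, Finset.sum_sub_distrib, Finset.sum_mul, smul_mul_assoc]
  congr 1
  simp

/-- The radial function in the hedgehog potential. -/
def potentialProfile (g : ℝ) (K : ℝ → ℝ) (r : ℝ) : ℝ := (1 - K r) / (2 * g * r ^ 2)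

/-- The radial function in the hedgehog Higgs field. -/
def higgsProfile (H₀ : ℝ) (U : ℝ → ℝ) (r : ℝ) : ℝ := H₀ * U r / r

theorem hedgehogHiggs_eq (γ : Fin 5 → Mat) (H₀ : ℝ) (U : ℝ → ℝ) :
    hedgehogHiggs γ H₀ U = fun x => higgsProfile H₀ U ‖x‖ • slash γ x := by
  funext x
  rw [hedgehogHiggs, radial, smul_smul, ← div_eq_mul_inv]
  rfl

theorem pderiv_radial (γ : Fin 5 → Mat) {x : Space} (hx : x ≠ 0) (i : Fin 5) :
    pderiv i (radial γ) x = ‖x‖⁻¹ • γ i - (x i / ‖x‖ ^ 3) • slash γ x := by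
  have hx' := norm_ne_zero_iff.2 hx
  have h := pderiv_radial_smul_slash hx (hasDerivAt_inv hx') γ i
  have e : radial γ = fun y => ‖y‖⁻¹ • slash γ y := rfl
  rw [e, h, sub_eq_add_neg, ← neg_smul]
  congr 2
  field_simp

/-- Because X² = r², the product e ∂_i e is (X γ_i - x_i)/r². The potential thus becomes a radial
function times a linear one, for which one derivative rule and one regularity criterion suffice. -/
theorem hedgehogPotential_eq {γ : Fin 5 → Mat} (hγ : IsGamma γ) (g : ℝ) (K : ℝ → ℝ) :
    hedgehogPotential γ g K = fun x i =>
      potentialProfile g K ‖x‖ • slash (hedgehogCoeff γ i) x := by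
  funext x i
  by_cases hx : x = 0
  · subst hx
    simp [hedgehogPotential, radial, slash]
  have hx' := norm_ne_zero_iff.2 hx
  have e : radial γ x = ‖x‖⁻¹ • slash γ x := rfl
  have h : radial γ x * pderiv i (radial γ) x = (‖x‖ ^ 2)⁻¹ • slash (hedgehogCoeff γ i) x := by
    rw [pderiv_radial γ hx, e, slash_hedgehogCoeff]
    simp only [mul_sub, smul_mul_assoc, mul_smul_comm, smul_sub, smul_smul, hγ.slash_sq]
    congr 2
    · field_simp
    · field_simp
  rw [hedgehogPotential, h, smul_smul, potentialProfile, ← div_eq_mul_inv, div_div]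

theorem hedgehog_isSO5Valued {γ : Fin 5 → Mat} (hγ : IsGamma γ) (g H₀ : ℝ) (K U : ℝ → ℝ) :
    IsSO5Valued γ (hedgehogPotential γ g K) (hedgehogHiggs γ H₀ U) := by
  constructor
  · intro x i
    rw [hedgehogPotential_eq hγ]
    refine Submodule.smul_mem _ _ (Submodule.sum_mem _ fun a _ => Submodule.smul_mem _ _ ?_)
    unfold hedgehogCoeff
    split_ifs with h
    · subst h
      rw [hγ.sq, one_smul, sub_self]
      exact zero_mem _
    · rw [zero_smul, sub_zero]
      exact Submodule.subset_span ⟨a, i, h, rfl⟩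
  · intro x
    rw [hedgehogHiggs_eq]
    exact Submodule.smul_mem _ _ (Submodule.sum_mem _ fun a _ =>
      Submodule.smul_mem _ _ (Submodule.subset_span ⟨a, rfl⟩))

/-- The fields are built covariantly from x^a γ_a and the γ_i, so the spin lift of `R` is the
compensating gauge transformation and O = R. -/
theorem hedgehog_isSphericallySymmetric {γ : Fin 5 → Mat} (hγ : IsGamma γ) (g H₀ : ℝ)
    (K U : ℝ → ℝ) :
    IsSphericallySymmetric γ (hedgehogPotential γ g K) (hedgehogHiggs γ H₀ U) := by
  intro R hR
  obtain ⟨S, hS, h⟩ := hγ.exists_spin_rotate hR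
  have hS' : star S * S = 1 := Matrix.mem_unitaryGroup_iff'.1 hS
  have hS'' : S * star S = 1 := Matrix.mem_unitaryGroup_iff.1 hS
  have hR' : R.transpose * R = 1 :=
    Matrix.mem_unitaryGroup_iff'.1 (Matrix.mem_specialUnitaryGroup_iff.1 hR).1
  have hγR : ∀ a, S * γ a * star S = ∑ b, R b a • γ b := fun a => by
    rw [← slash_single γ a, h]
    simp [slash, rotate]
  refine ⟨S, hS, ⟨R, hR, hγR⟩, fun x => ?_, fun x i => ?_⟩
  · rw [hedgehogHiggs_eq]
    simp only [norm_rotate hR, ← h]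
    simp
  · rw [hedgehogPotential_eq hγ]
    simp only [norm_rotate hR, slash_hedgehogCoeff, ← h]
    have h1 : ∑ j, R j i * (rotate R x) j = x i := by
      have : (R.transpose.mulVec (R.mulVec x.ofLp)) i = x i := by
        rw [Matrix.mulVec_mulVec, hR', Matrix.one_mulVec]
      exact this
    calc ∑ j, R j i • potentialProfile g K ‖x‖ •
          (S * slash γ x * star S * γ j - (rotate R x) j • (1 : Mat))
        = potentialProfile g K ‖x‖ • (S * slash γ x * star S * (∑ j, R j i • γ j) -
            (∑ j, R j i * (rotate R x) j) • (1 : Mat)) := by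
          simp only [Finset.mul_sum, Finset.sum_smul, ← Finset.sum_sub_distrib, Finset.smul_sum,
            smul_sub, mul_smul_comm, smul_smul, mul_comm (R _ i), mul_assoc]
      _ = S * potentialProfile g K ‖x‖ • (slash γ x * γ i - x i • (1 : Mat)) * star S := by
          rw [← hγR, h1]
          have h2 : S * slash γ x * star S * (S * γ i * star S) = S * (slash γ x * γ i) * star S := by
            calc _ = S * slash γ x * (star S * S) * γ i * star S := by simp only [mul_assoc]
              _ = _ := by rw [hS', mul_one]; simp only [mul_assoc]
          rw [h2]
          simp only [mul_smul_comm, smul_mul_assoc, mul_sub, sub_mul, mul_one, hS'']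

/-- The field strength of the hedgehog. -/
theorem fieldStrength_hedgehog {γ : Fin 5 → Mat} (hγ : IsGamma γ) {g h' : ℝ} {K : ℝ → ℝ}
    {x : Space} (hx : x ≠ 0) (hh : HasDerivAt (potentialProfile g K) h' ‖x‖) (i j : Fin 5) :
    fieldStrength g (hedgehogPotential γ g K) x i j =
      (h' / ‖x‖ + 2 * g * potentialProfile g K ‖x‖ ^ 2) •
        (slash γ x * (x i • γ j - x j • γ i)) +
      (potentialProfile g K ‖x‖ - g * potentialProfile g K ‖x‖ ^ 2 * ‖x‖ ^ 2) •
        (γ i * γ j - γ j * γ i) := by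
  have hx' := norm_ne_zero_iff.2 hx
  rw [hedgehogPotential_eq hγ, fieldStrength]
  simp only [pderiv_radial_smul_slash hx hh]
  set h := potentialProfile g K ‖x‖
  set X := slash γ x with hX
  have hN : ∀ i j, slash (hedgehogCoeff γ i) x * slash (hedgehogCoeff γ j) x =
      x i • (X * γ j) - x j • (X * γ i) - ‖x‖ ^ 2 • (γ i * γ j) + (x i * x j) • (1 : Mat) := by
    intro i j
    have e : X * γ i * (X * γ j) = (2 * x i) • (X * γ j) - ‖x‖ ^ 2 • (γ i * γ j) := by
      rw [mul_assoc, ← mul_assoc (γ i), hγ.gamma_mul_slash, sub_mul, mul_sub, smul_mul_assoc,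
        one_mul, mul_smul_comm, ← mul_assoc X (X * γ i), ← mul_assoc X X, hγ.slash_sq,
        smul_mul_assoc, one_mul, smul_mul_assoc]
    rw [slash_hedgehogCoeff, slash_hedgehogCoeff, ← hX, sub_mul, mul_sub, mul_sub, e]
    simp only [smul_mul_assoc, mul_smul_comm, one_mul, mul_one, smul_smul]
    module
  simp only [smul_mul_assoc, mul_smul_comm, smul_smul, hN]
  simp only [slash_hedgehogCoeff, hedgehogCoeff, ← hX, mul_sub, mul_smul_comm, eq_comm (a := j)]
  module

/-- The covariant derivative of the Higgs field of the hedgehog. -/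
theorem covDeriv_hedgehog {γ : Fin 5 → Mat} (hγ : IsGamma γ) {g H₀ : ℝ} (hg : g ≠ 0)
    {K U : ℝ → ℝ} {x : Space} (hx : x ≠ 0) (hU : DifferentiableAt ℝ U ‖x‖) (m : Fin 5) :
    covDeriv g (hedgehogPotential γ g K) (hedgehogHiggs γ H₀ U) x m =
      (H₀ * (K ‖x‖ * U ‖x‖) / ‖x‖) • γ m +
      (H₀ * (deriv U ‖x‖ / ‖x‖ ^ 2 - K ‖x‖ * U ‖x‖ / ‖x‖ ^ 3) * x m) • slash γ x := by
  have hx' := norm_ne_zero_iff.2 hx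
  have hη : HasDerivAt (higgsProfile H₀ U)
      ((H₀ * deriv U ‖x‖ * ‖x‖ - H₀ * U ‖x‖ * 1) / ‖x‖ ^ 2) ‖x‖ :=
    (hU.hasDerivAt.const_mul H₀).div (hasDerivAt_id _) hx'
  rw [hedgehogPotential_eq hγ, hedgehogHiggs_eq, covDeriv, pderiv_radial_smul_slash hx hη]
  set X := slash γ x with hX
  -- The two products are opposite, so the commutator doubles. With h the potential profile, 1 - 2g
  -- h r² = K, which puts the factor K on the transverse part.
  have e1 : slash (hedgehogCoeff γ m) x * X = x m • X - ‖x‖ ^ 2 • γ m := by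
    rw [slash_hedgehogCoeff, ← hX, sub_mul, mul_assoc, hγ.gamma_mul_slash, ← hX, mul_sub,
      ← mul_assoc X X, hγ.slash_sq]
    simp only [smul_mul_assoc, mul_smul_comm, one_mul, mul_one]
    module
  have e2 : X * slash (hedgehogCoeff γ m) x = ‖x‖ ^ 2 • γ m - x m • X := by
    rw [slash_hedgehogCoeff, ← hX, mul_sub, ← mul_assoc X X, hγ.slash_sq]
    simp only [smul_mul_assoc, mul_smul_comm, one_mul, mul_one]
  simp only [smul_mul_assoc, mul_smul_comm, e1, e2, higgsProfile, potentialProfile]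
  match_scalars
  · field_simp
    ring
  · field_simp
    ring

/-- The four-form `F ∧ F` of the hedgehog. -/
theorem starFF_hedgehog {γ : Fin 5 → Mat} (hγ : IsGamma γ) {g : ℝ} (hg : g ≠ 0)
    {K : ℝ → ℝ} {x : Space} (hx : x ≠ 0) (hK : DifferentiableAt ℝ K ‖x‖) (m : Fin 5) :
    starFF g (hedgehogPotential γ g K) x m =
      (-(3 / (2 * g ^ 2)) * ((1 - K ‖x‖ ^ 2) * deriv K ‖x‖) / ‖x‖ ^ 3) • γ m +
      (3 / (2 * g ^ 2) * ((1 - K ‖x‖ ^ 2) * deriv K ‖x‖ / ‖x‖ ^ 5 +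
        (1 - K ‖x‖ ^ 2) ^ 2 / ‖x‖ ^ 6) * x m) • slash γ x := by
  have hx' := norm_ne_zero_iff.2 hx
  have hh : HasDerivAt (potentialProfile g K)
      ((-deriv K ‖x‖ * (2 * g * ‖x‖ ^ 2) - (1 - K ‖x‖) * (2 * g * (2 * ‖x‖))) /
        (2 * g * ‖x‖ ^ 2) ^ 2) ‖x‖ := by
    refine (hK.hasDerivAt.const_sub 1).div ?_ (by positivity)
    simpa using (hasDerivAt_pow 2 ‖x‖).const_mul (2 * g)
  -- The coefficients simplify to S = (1 - K²)/(4g r²) and P = -K'/(2g r³) - (1 - K²)/(2g r⁴). In 24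
  -- S² + 12 P S r² the squares of 1 - K² cancel.
  have h := hγ.contract_eq x _ _ m _ (fieldStrength_hedgehog hγ hx hh)
  refine h.trans ?_
  simp only [potentialProfile]
  match_scalars
  · field_simp
    ring
  · field_simp
    ring

/-! ### The Bogomolny equation -/

theorem IsGamma.ne_zero {γ : Fin 5 → Mat} (hγ : IsGamma γ) (a : Fin 5) : γ a ≠ 0 := fun h => by
  have := hγ.sq a
  rw [h, mul_zero] at this
  exact zero_ne_one this

/-- Away from the origin the Bogomolny equation holds for a hedgehog solving the radial
equations. -/
theorem bogomolnyAt_of_radial {γ : Fin 5 → Mat} (hγ : IsGamma γ) {g H₀ : ℝ} (hg : g ≠ 0)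
    (hH₀ : H₀ ≠ 0) {K U : ℝ → ℝ} (h : IsRadial (2 * g ^ 2 / 3 * H₀) K U) {x : Space} (hx : x ≠ 0) :
    BogomolnyAt g (hedgehogPotential γ g K) (hedgehogHiggs γ H₀ U) x := by
  intro m
  have hx' : 0 < ‖x‖ := norm_pos_iff.2 hx
  rw [starFF_hedgehog hγ hg hx (h.differentiableAt_K _ hx'),
    covDeriv_hedgehog hγ hg hx (h.differentiableAt_U _ hx'), h.eq_K _ hx', h.eq_U _ hx']
  congr 2
  · field_simp
  · field_simp
    ring

/-- Conversely, the Bogomolny equation away from the origin implies the radial equations. -/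
theorem radial_of_bogomolnyAt {γ : Fin 5 → Mat} (hγ : IsGamma γ) {g H₀ : ℝ} (hg : g ≠ 0)
    (hH₀ : H₀ ≠ 0) {K U : ℝ → ℝ} {r : ℝ} (hr : 0 < r) (hK : DifferentiableAt ℝ K r)
    (hU : DifferentiableAt ℝ U r)
    (h : BogomolnyAt g (hedgehogPotential γ g K) (hedgehogHiggs γ H₀ U)
      (EuclideanSpace.single 0 r)) :
    K r * U r = -((1 - K r ^ 2) * deriv K r / (2 * g ^ 2 / 3 * H₀ * r ^ 2)) ∧
      deriv U r = (1 - K r ^ 2) ^ 2 / (2 * g ^ 2 / 3 * H₀ * r ^ 4) := by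
  set x : Space := EuclideanSpace.single 0 r with hxr
  have hn : ‖x‖ = r := by rw [hxr, PiLp.norm_single, Real.norm_of_nonneg hr.le]
  have hx : x ≠ 0 := norm_ne_zero_iff.1 (by rw [hn]; exact hr.ne')
  have hx0 : x 0 = r := by simp [hxr]
  have hx1 : x 1 = 0 := by simp [hxr]
  have hs : slash γ x = r • γ 0 := by
    have : x = r • EuclideanSpace.single 0 (1 : ℝ) := by
      ext i
      simp [hxr]
    rw [this, slash_smul, slash_single]
  -- On the first axis the component along the axis carries U', while any transverse one carries
  -- only K U; the transverse equation is extracted first.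
  have h0 := h 0
  have h1 := h 1
  rw [starFF_hedgehog hγ hg hx (by rwa [hn]), covDeriv_hedgehog hγ hg hx (by rwa [hn]), hn, hx1,
    mul_zero, mul_zero, zero_smul, add_zero, add_zero] at h1
  rw [starFF_hedgehog hγ hg hx (by rwa [hn]), covDeriv_hedgehog hγ hg hx (by rwa [hn]), hn, hx0,
    hs, smul_smul, smul_smul, ← add_smul, ← add_smul] at h0
  have e1 := smul_left_injective ℝ (hγ.ne_zero 1) h1
  have e0 := smul_left_injective ℝ (hγ.ne_zero 0) h0
  have a1 : K r * U r = -((1 - K r ^ 2) * deriv K r / (2 * g ^ 2 / 3 * H₀ * r ^ 2)) := by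
    field_simp at e1 ⊢
    linarith
  refine ⟨a1, ?_⟩
  have a2 : 3 / (2 * g ^ 2) * (1 - K r ^ 2) ^ 2 / r ^ 4 = H₀ * deriv U r := by
    have b1 : -(3 / (2 * g ^ 2)) * ((1 - K r ^ 2) * deriv K r) / r ^ 3 + 3 / (2 * g ^ 2) *
        ((1 - K r ^ 2) * deriv K r / r ^ 5 + (1 - K r ^ 2) ^ 2 / r ^ 6) * r * r =
        3 / (2 * g ^ 2) * (1 - K r ^ 2) ^ 2 / r ^ 4 := by field_simp; ring
    have b2 : H₀ * (K r * U r) / r + H₀ * (deriv U r / r ^ 2 - K r * U r / r ^ 3) * r * r =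
        H₀ * deriv U r := by field_simp; ring
    rw [← b1, ← b2]; exact e0
  field_simp at a2 ⊢
  linarith

/-! ### Regularity -/

section regularity

variable {g H₀ : ℝ} {K U : ℝ → ℝ}

theorem contDiff_potentialProfile_mul (hg : 0 < g) (hH₀ : 0 < H₀)
    (h : IsRegularRadial (2 * g ^ 2 / 3 * H₀) K U) (a : Fin 5) :
    ContDiff ℝ 1 fun x : Space => potentialProfile g K ‖x‖ * x a := by
  have hκ : 0 < 2 * g ^ 2 / 3 * H₀ := by positivity
  obtain ⟨β, hβ, hβ1, hβ2⟩ := h.regular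
  have hd : ∀ r > 0, HasDerivAt (potentialProfile g K)
      (-(deriv K r / (2 * g * r ^ 2)) - (1 - K r) / (g * r ^ 3)) r := fun r hr => by
    refine ((((h.differentiableAt_K r hr).hasDerivAt.const_sub 1).div
      ((hasDerivAt_pow 2 r).const_mul (2 * g)) (by positivity))).congr_deriv ?_
    push_cast
    field_simp
  have hK : ContinuousOn K (Ioi 0) := fun r hr =>
    (h.differentiableAt_K r hr).continuousAt.continuousWithinAt
  refine contDiff_radial_mul (c := β / (2 * g)) (fun r hr => (hd r hr).differentiableAt) ?_ ?_ ?_ a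
  · refine ContinuousOn.congr ?_ fun r hr => (hd r hr).deriv
    refine (((h.continuousOn_deriv_K hκ).div (by fun_prop) fun r hr => ?_).neg).sub
      ((continuousOn_const.sub hK).div (by fun_prop) fun r hr => ?_)
    · have : 0 < r := hr
      positivity
    · have : 0 < r := hr
      positivity
  · refine (hβ1.div_const (2 * g)).congr fun r => ?_
    rw [potentialProfile, div_div, mul_comm (r ^ 2)]
  -- r times the derivative splits into terms with limits β/g and -β/g.
  · have h1 := ((h.tendsto_deriv_K_div hκ hβ hβ1 hβ2).div_const (2 * g)).neg.sub
      (hβ1.div_const g)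
    have h2 : -(-(2 * β) / (2 * g)) - β / g = 0 := by field_simp; ring
    rw [h2] at h1
    refine h1.congr' ?_
    filter_upwards [self_mem_nhdsWithin] with r hr
    have hr' : 0 < r := hr
    rw [(hd r hr').deriv]
    field_simp

theorem contDiff_higgsProfile_mul (hg : 0 < g) (hH₀ : 0 < H₀)
    (h : IsRegularRadial (2 * g ^ 2 / 3 * H₀) K U) (a : Fin 5) :
    ContDiff ℝ 1 fun x : Space => higgsProfile H₀ U ‖x‖ * x a := by
  have hκ : 0 < 2 * g ^ 2 / 3 * H₀ := by positivity
  obtain ⟨β, hβ, hβ1, hβ2⟩ := h.regular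
  have hd : ∀ r > 0, HasDerivAt (higgsProfile H₀ U)
      (H₀ * (deriv U r / r) - H₀ * U r / r ^ 2) r := fun r hr => by
    refine (((h.differentiableAt_U r hr).hasDerivAt.const_mul H₀).div
      (hasDerivAt_id r) hr.ne').congr_deriv ?_
    simp only [id]
    field_simp
  have hU : ContinuousOn U (Ioi 0) := fun r hr =>
    (h.differentiableAt_U r hr).continuousAt.continuousWithinAt
  refine contDiff_radial_mul (c := H₀ * (4 * β ^ 2 / (2 * g ^ 2 / 3 * H₀)))
    (fun r hr => (hd r hr).differentiableAt) ?_ ?_ ?_ a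
  · refine ContinuousOn.congr ?_ fun r hr => (hd r hr).deriv
    refine (continuousOn_const.mul ((h.continuousOn_deriv_U hκ).div continuousOn_id
      fun r hr => ?_)).sub ((continuousOn_const.mul hU).div (by fun_prop) fun r hr => ?_)
    · exact (ne_of_gt hr : r ≠ 0)
    · have : 0 < r := hr
      positivity
  · refine (hβ2.const_mul H₀).congr fun r => ?_
    rw [higgsProfile, mul_div_assoc]
  -- r times the derivative is H₀ (U' - U/r), and both terms have the same limit.
  · have h1 := ((h.tendsto_deriv_U hβ1).sub hβ2).const_mul H₀
    rw [sub_self, mul_zero] at h1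
    refine h1.congr' ?_
    filter_upwards [self_mem_nhdsWithin] with r hr
    have hr' : 0 < r := hr
    rw [(hd r hr').deriv]
    field_simp

theorem contDiff_smul_slash_apply {ρ : ℝ → ℝ}
    (h : ∀ a, ContDiff ℝ 1 fun x : Space => ρ ‖x‖ * x a) (M : Fin 5 → Mat) (p q : Fin 4) :
    ContDiff ℝ 1 fun x : Space => (ρ ‖x‖ • slash M x) p q := by
  have e : (fun x : Space => (ρ ‖x‖ • slash M x) p q) =
      fun x => ∑ a, (ρ ‖x‖ * x a) • M a p q := by
    funext x
    simp [slash, Matrix.sum_apply, Finset.mul_sum, mul_assoc]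
  rw [e]
  exact ContDiff.sum fun a _ => (h a).smul contDiff_const

theorem hedgehog_isC1 {γ : Fin 5 → Mat} (hγ : IsGamma γ) (hg : 0 < g) (hH₀ : 0 < H₀)
    (h : IsRegularRadial (2 * g ^ 2 / 3 * H₀) K U) :
    IsC1 (hedgehogPotential γ g K) (hedgehogHiggs γ H₀ U) := by
  rw [hedgehogPotential_eq hγ, hedgehogHiggs_eq]
  exact ⟨fun i => contDiff_smul_slash_apply (contDiff_potentialProfile_mul hg hH₀ h) _,
    contDiff_smul_slash_apply (contDiff_higgsProfile_mul hg hH₀ h) _⟩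

end regularity

theorem continuous_of_contDiff_apply {M : Space → Mat} (h : ∀ p q, ContDiff ℝ 1 fun x => M x p q) :
    Continuous M :=
  continuous_matrix fun p q => (h p q).continuous

theorem continuous_pderiv {M : Space → Mat} (h : ∀ p q, ContDiff ℝ 1 fun x => M x p q)
    (i : Fin 5) : Continuous (pderiv i M) :=
  continuous_matrix fun p q => ((h p q).continuous_fderiv one_ne_zero).clm_apply continuous_const

theorem IsC1.continuous_fieldStrength {A : Potential} {φ : Higgs} (h : IsC1 A φ) (g : ℝ)
    (i j : Fin 5) : Continuous fun x => fieldStrength g A x i j := by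
  have hA : ∀ i, Continuous fun x => A x i := fun i => continuous_of_contDiff_apply (h.1 i)
  exact ((continuous_pderiv (h.1 j) i).sub (continuous_pderiv (h.1 i) j)).add
    ((((hA i).matrix_mul (hA j)).sub ((hA j).matrix_mul (hA i))).const_smul g)

theorem IsC1.continuous_starFF {A : Potential} {φ : Higgs} (h : IsC1 A φ) (g : ℝ) (m : Fin 5) :
    Continuous fun x => starFF g A x m := by
  have h1 : Continuous fun x => ∑ i, ∑ j, ∑ k, ∑ l,
      leviCivita i j k l m • (fieldStrength g A x i j * fieldStrength g A x k l) :=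
    continuous_finsetSum _ fun i _ => continuous_finsetSum _ fun j _ =>
      continuous_finsetSum _ fun k _ => continuous_finsetSum _ fun l _ =>
        ((h.continuous_fieldStrength g i j).matrix_mul
          (h.continuous_fieldStrength g k l)).const_smul (leviCivita i j k l m)
  exact h1.const_smul (1 / 4 : ℝ)

theorem IsC1.continuous_covDeriv {A : Potential} {φ : Higgs} (h : IsC1 A φ) (g : ℝ) (m : Fin 5) :
    Continuous fun x => covDeriv g A φ x m := by
  have hA : Continuous fun x => A x m := continuous_of_contDiff_apply (h.1 m)
  have hφ : Continuous φ := continuous_of_contDiff_apply h.2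
  exact (continuous_pderiv h.2 m).add (((hA.matrix_mul hφ).sub (hφ.matrix_mul hA)).const_smul g)

/-- Both sides of the equation are continuous for C¹ fields, and the complement of the origin is
dense. -/
theorem IsC1.bogomolnyAt_of_ne_zero {A : Potential} {φ : Higgs} (h : IsC1 A φ) {g : ℝ}
    (hb : ∀ x, x ≠ 0 → BogomolnyAt g A φ x) (x : Space) : BogomolnyAt g A φ x := by
  intro m
  have := Continuous.ext_on (dense_compl_singleton (0 : Space)) (h.continuous_starFF g m)
    (h.continuous_covDeriv g m) fun x hx => hb x hx m
  exact congrFun this x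

/-! ### Energy and charge -/

section energy

variable {g H₀ : ℝ} {K U : ℝ → ℝ}

/-- The energy density of the Higgs field of the hedgehog, as a function of `r`. -/
def higgsDensity (H₀ : ℝ) (K U : ℝ → ℝ) (r : ℝ) : ℝ :=
  4 * H₀ ^ 2 * (deriv U r ^ 2 + 4 * (K r * U r) ^ 2 / r ^ 2)

theorem trace_covDeriv_sq {γ : Fin 5 → Mat} (hγ : IsGamma γ) (hg : g ≠ 0) {x : Space} (hx : x ≠ 0)
    (hU : DifferentiableAt ℝ U ‖x‖) :
    (∑ m, (covDeriv g (hedgehogPotential γ g K) (hedgehogHiggs γ H₀ U) x m *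
      covDeriv g (hedgehogPotential γ g K) (hedgehogHiggs γ H₀ U) x m).trace).re =
      higgsDensity H₀ K U ‖x‖ := by
  have hx' := norm_ne_zero_iff.2 hx
  -- Squares of Clifford vectors are scalars. Summed over m they give 5c² + 2cd r² + d² r⁴ = 4c² +
  -- (c + d r²)², where c + d r² = H₀ U'; the trace contributes a factor 4.
  have key : ∀ (c d : ℝ) (m : Fin 5), (c • γ m + (d * x m) • slash γ x) *
      (c • γ m + (d * x m) • slash γ x) =
      (c ^ 2 + 2 * c * d * x m ^ 2 + d ^ 2 * ‖x‖ ^ 2 * x m ^ 2) • (1 : Mat) := by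
    intro c d m
    simp only [add_mul, mul_add, smul_mul_assoc, mul_smul_comm, hγ.sq, hγ.slash_sq,
      hγ.gamma_mul_slash]
    module
  rw [← Matrix.trace_sum]
  simp only [covDeriv_hedgehog hγ hg hx hU, key]
  rw [← Finset.sum_smul, Matrix.trace_smul, Matrix.trace_one, Complex.smul_re,
    Finset.sum_add_distrib, Finset.sum_add_distrib, ← Finset.mul_sum, ← Finset.mul_sum,
    ← EuclideanSpace.real_norm_sq_eq, higgsDensity]
  simp
  field_simp
  ring

theorem trace_higgs_sq {γ : Fin 5 → Mat} (hγ : IsGamma γ) {x : Space} (hx : x ≠ 0) :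
    (hedgehogHiggs γ H₀ U x * hedgehogHiggs γ H₀ U x).trace.re = 4 * (H₀ ^ 2 * U ‖x‖ ^ 2) := by
  have hx' := norm_ne_zero_iff.2 hx
  rw [hedgehogHiggs_eq, smul_mul_smul_comm, hγ.slash_sq, smul_smul, Matrix.trace_smul,
    Matrix.trace_one, Complex.smul_re, higgsProfile]
  simp
  field_simp

namespace IsRegularRadial

variable {κ : ℝ}

/-- The Bogomolny completion in radial form: with w = 1 - K², differentiating U w² and inserting U'
= w²/(κ r⁴) and w K' = -κ r² K U yields the two halves of the density. -/
theorem hasDerivAt_superpotential (h : IsRegularRadial κ K U) (hκ : 0 < κ) {r : ℝ} (hr : 0 < r) :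
    HasDerivAt (fun r => 4 * H₀ ^ 2 / κ * (U r * (1 - K r ^ 2) ^ 2))
      (r ^ 4 * higgsDensity H₀ K U r) r := by
  have hK := (h.differentiableAt_K r hr).hasDerivAt
  have hU := (h.differentiableAt_U r hr).hasDerivAt
  refine ((hU.mul (((hK.pow 2).const_sub 1).pow 2)).const_mul (4 * H₀ ^ 2 / κ)).congr_deriv ?_
  have := (h.one_sub_K_sq_pos hr).ne'
  rw [higgsDensity, h.deriv_K hκ hr, h.eq_U r hr]
  simp only [Pi.pow_apply]
  push_cast
  field_simp
  ring

theorem continuousWithinAt_superpotential (h : IsRegularRadial κ K U) :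
    ContinuousWithinAt (fun r => 4 * H₀ ^ 2 / κ * (U r * (1 - K r ^ 2) ^ 2)) (Ici 0) 0 :=
  continuousWithinAt_const.mul (h.continuousWithinAt_U.mul
    ((continuousWithinAt_const.sub (h.continuousWithinAt_K.pow 2)).pow 2))

theorem tendsto_superpotential (h : IsRegularRadial κ K U) :
    Tendsto (fun r => 4 * H₀ ^ 2 / κ * (U r * (1 - K r ^ 2) ^ 2)) atTop (𝓝 (4 * H₀ ^ 2 / κ)) := by
  simpa using (h.tendsto_U.mul (((h.tendsto_K.pow 2).const_sub 1).pow 2)).const_mul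
    (4 * H₀ ^ 2 / κ)

theorem higgsDensity_nonneg (r : ℝ) : 0 ≤ r ^ 4 * higgsDensity H₀ K U r := by
  unfold higgsDensity; positivity

theorem integrableOn_higgsDensity (h : IsRegularRadial κ K U) (hκ : 0 < κ) :
    IntegrableOn (fun r => r ^ 4 * higgsDensity H₀ K U r) (Ioi 0) :=
  integrableOn_Ioi_deriv_of_nonneg h.continuousWithinAt_superpotential
    (fun _ hr => h.hasDerivAt_superpotential hκ hr) (fun r _ => higgsDensity_nonneg r)
    h.tendsto_superpotential

theorem integral_higgsDensity (h : IsRegularRadial κ K U) (hκ : 0 < κ) :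
    ∫ r in Ioi 0, r ^ 4 * higgsDensity H₀ K U r = 4 * H₀ ^ 2 / κ := by
  rw [integral_Ioi_of_hasDerivAt_of_nonneg h.continuousWithinAt_superpotential
    (fun _ hr => h.hasDerivAt_superpotential hκ hr) (fun r _ => higgsDensity_nonneg r)
    h.tendsto_superpotential, h.U_zero]
  simp

/-- Since U - 1 = O(r⁻³), the integrand is O(r⁴ r⁻⁶) = O(r⁻²) at infinity. -/
theorem integrableOn_potential (h : IsRegularRadial κ K U) :
    IntegrableOn (fun r => r ^ 4 * (H₀ ^ 2 * U r ^ 2 - H₀ ^ 2) ^ 2) (Ioi 0) := by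
  have hU : ContinuousOn U (Ici 0) := fun r hr => by
    rcases (mem_Ici.1 hr).eq_or_lt with rfl | hr
    · exact h.continuousWithinAt_U
    · exact (h.differentiableAt_U r hr).continuousAt.continuousWithinAt
  have hc : ContinuousOn (fun r => r ^ 4 * (H₀ ^ 2 * U r ^ 2 - H₀ ^ 2) ^ 2) (Ici 0) :=
    (continuousOn_id.pow 4).mul (((continuousOn_const.mul (hU.pow 2)).sub continuousOn_const).pow 2)
  refine IntegrableOn.mono_set ?_ Ioi_subset_Ici_self
  refine (hc.locallyIntegrableOn measurableSet_Ici).integrableOn_of_isBigO_atTop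
    (g := fun r => r ^ (-2 : ℝ)) ?_ (integrableAtFilter_rpow_atTop_iff.2 (by norm_num))
  have h1 : (fun r => U r + 1) =O[atTop] fun _ => (1 : ℝ) :=
    (h.tendsto_U.add_const 1).isBigO_one ℝ
  have h2 := ((isBigO_refl (fun r : ℝ => r ^ 4) atTop).mul
    ((h.U_sub_one_isTheta.1.mul h1).pow 2)).const_mul_left ((H₀ ^ 2) ^ 2)
  refine h2.congr' (Eventually.of_forall fun r => by ring) ?_
  filter_upwards [eventually_gt_atTop 0] with r hr
  rw [Real.rpow_neg hr.le, Real.rpow_two]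
  field_simp

end IsRegularRadial

/-- The Bogomolny equation makes the two quadratic terms equal, so 1/8 + 1/8 becomes 1/4. -/
theorem energyDensity_hedgehog {γ : Fin 5 → Mat} (hγ : IsGamma γ) (hg : g ≠ 0) (lam : ℝ)
    (hU : ∀ r > 0, DifferentiableAt ℝ U r)
    (hb : ∀ x, BogomolnyAt g (hedgehogPotential γ g K) (hedgehogHiggs γ H₀ U) x) {x : Space}
    (hx : x ≠ 0) :
    energyDensity g H₀ lam (hedgehogPotential γ g K) (hedgehogHiggs γ H₀ U) x =
      1 / 4 * higgsDensity H₀ K U ‖x‖ + lam * (H₀ ^ 2 * U ‖x‖ ^ 2 - H₀ ^ 2) ^ 2 := by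
  have hb' := hb x
  simp only [BogomolnyAt] at hb'
  rw [energyDensity]
  simp only [hb']
  rw [trace_covDeriv_sq hγ hg hx (hU _ (norm_pos_iff.2 hx)), trace_higgs_sq hγ hx]
  ring

theorem integrable_energyDensity {γ : Fin 5 → Mat} (hγ : IsGamma γ) (hg : 0 < g) (hH₀ : 0 < H₀)
    (h : IsRegularRadial (2 * g ^ 2 / 3 * H₀) K U)
    (hb : ∀ x, BogomolnyAt g (hedgehogPotential γ g K) (hedgehogHiggs γ H₀ U) x) (lam : ℝ) :
    Integrable (energyDensity g H₀ lam (hedgehogPotential γ g K) (hedgehogHiggs γ H₀ U)) := by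
  have hκ : 0 < 2 * g ^ 2 / 3 * H₀ := by positivity
  have h1 : Integrable fun x : Space => 1 / 4 * higgsDensity H₀ K U ‖x‖ +
      lam * (H₀ ^ 2 * U ‖x‖ ^ 2 - H₀ ^ 2) ^ 2 := by
    rw [integrable_fun_norm_addHaar volume
      (f := fun r => 1 / 4 * higgsDensity H₀ K U r + lam * (H₀ ^ 2 * U r ^ 2 - H₀ ^ 2) ^ 2)]
    simp only [finrank_euclideanSpace, Fintype.card_fin, Nat.add_one_sub_one, smul_eq_mul]
    refine (((h.integrableOn_higgsDensity (H₀ := H₀) hκ).const_mul (1 / 4)).add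
      ((h.integrableOn_potential (H₀ := H₀)).const_mul lam)).congr (Eventually.of_forall fun r => ?_)
    simp only [Pi.add_apply]
    ring
  refine h1.congr ?_
  have h0 : ∀ᵐ x : Space, x ≠ 0 := by simp [ae_iff]
  filter_upwards [h0] with x hx
  exact (energyDensity_hedgehog hγ hg.ne' lam h.differentiableAt_U hb hx).symm

theorem volume_real_ball : volume.real (Metric.ball (0 : Space) 1) = 8 * Real.pi ^ 2 / 15 := by
  have hG : Real.Gamma ((Fintype.card (Fin 5) : ℝ) / 2 + 1) = 15 / 8 * √Real.pi := by
    have e : ((Fintype.card (Fin 5) : ℝ) / 2 + 1) = 1 / 2 + 1 + 1 + 1 := by norm_num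
    rw [e, Real.Gamma_add_one (by norm_num), Real.Gamma_add_one (by norm_num),
      Real.Gamma_add_one (by norm_num), Real.Gamma_one_half_eq]
    ring
  have hs : √Real.pi ^ 2 = Real.pi := Real.sq_sqrt Real.pi_pos.le
  have hs5 : √Real.pi ^ 5 = Real.pi ^ 2 * √Real.pi := by
    rw [show √Real.pi ^ 5 = (√Real.pi ^ 2) ^ 2 * √Real.pi by ring, hs]
  rw [Measure.real, EuclideanSpace.volume_ball, hG, ENNReal.ofReal_one, one_pow, one_mul,
    ENNReal.toReal_ofReal (by positivity), Fintype.card_fin]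
  rw [div_eq_div_iff (by positivity) (by norm_num), hs5]
  ring

theorem charge_hedgehog {γ : Fin 5 → Mat} (hγ : IsGamma γ) (hg : 0 < g) (hH₀ : 0 < H₀)
    (h : IsRegularRadial (2 * g ^ 2 / 3 * H₀) K U)
    (hb : ∀ x, BogomolnyAt g (hedgehogPotential γ g K) (hedgehogHiggs γ H₀ U) x) :
    charge g H₀ (hedgehogPotential γ g K) (hedgehogHiggs γ H₀ U) = 1 := by
  have hκ : 0 < 2 * g ^ 2 / 3 * H₀ := by positivity
  have h1 : ∫ x : Space, (∑ m, (covDeriv g (hedgehogPotential γ g K) (hedgehogHiggs γ H₀ U) x m *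
      starFF g (hedgehogPotential γ g K) x m).trace).re =
      ∫ x : Space, higgsDensity H₀ K U ‖x‖ := by
    refine integral_congr_ae ?_
    have h0 : ∀ᵐ x : Space, x ≠ 0 := by simp [ae_iff]
    filter_upwards [h0] with x hx
    have hb' := hb x
    simp only [BogomolnyAt] at hb'
    simp only [hb']
    exact trace_covDeriv_sq hγ hg.ne' hx (h.differentiableAt_U _ (norm_pos_iff.2 hx))
  -- The unit sphere has area 5 · 8π²/15 = 8π²/3 and the radial integral is 4H₀²/κ = 6H₀/g². Their
  -- product is 16π² H₀/g².
  rw [charge, h1, integral_fun_norm_addHaar volume (higgsDensity H₀ K U), volume_real_ball]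
  simp only [finrank_euclideanSpace, Fintype.card_fin, Nat.add_one_sub_one, smul_eq_mul]
  rw [h.integral_higgsDensity hκ]
  have := Real.pi_pos
  simp only [nsmul_eq_mul]
  push_cast
  field_simp
  norm_num

end energy

end

end Monopole

/-! ### The main theorem. -/

theorem theorem2p1 (g H₀ : ℝ) (hg : 0 < g) (hH₀ : 0 < H₀) :
    ∃ K U : ℝ → ℝ,
      -- existence
      Monopole.SolvesBVP g H₀ K U ∧
      -- uniqueness
      (∀ K₂ U₂ : ℝ → ℝ, Monopole.SolvesBVP g H₀ K₂ U₂ →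
        EqOn K₂ K (Ici 0) ∧ EqOn U₂ U (Ici 0)) ∧
      -- monotonicity
      StrictAntiOn K (Ici 0) ∧ StrictMonoOn U (Ici 0) ∧
      -- asymptotics at infinity, with sharpness of the rates
      (∃ C > 0, K =O[atTop] fun r => Real.exp (-C * r ^ 3)) ∧
      (∃ C > 0, (fun r => Real.exp (-C * r ^ 3)) =O[atTop] K) ∧
      (fun r => U r - 1) =Θ[atTop] (fun r => (r ^ 3)⁻¹) ∧
      -- asymptotics at the origin, with sharpness of the rates
      (fun r => K r - 1) =Θ[𝓝[>] 0] (fun r => r ^ 2) ∧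
      U =Θ[𝓝[>] 0] (fun r => r) ∧
      -- the monopole
      ∀ γ : Fin 5 → Monopole.Mat, Monopole.IsGamma γ →
        let A := Monopole.hedgehogPotential γ g K
        let φ := Monopole.hedgehogHiggs γ H₀ U
        Monopole.IsSO5Valued γ A φ ∧
        Monopole.IsC1 A φ ∧
        (∀ x, Monopole.BogomolnyAt g A φ x) ∧
        Monopole.IsSphericallySymmetric γ A φ ∧
        (∀ lam : ℝ, 0 ≤ lam → Integrable (Monopole.energyDensity g H₀ lam A φ)) ∧
        Monopole.charge g H₀ A φ = 1 ∧
        -- it is the only hedgehog configuration with these boundary values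
        (∀ K₂ U₂ : ℝ → ℝ, DifferentiableOn ℝ K₂ (Ioi 0) → DifferentiableOn ℝ U₂ (Ioi 0) →
          ContinuousWithinAt K₂ (Ici 0) 0 → ContinuousWithinAt U₂ (Ici 0) 0 →
          K₂ 0 = 1 → U₂ 0 = 0 → Tendsto K₂ atTop (𝓝 0) → Tendsto U₂ atTop (𝓝 1) →
          (∀ x, x ≠ 0 → Monopole.BogomolnyAt g (Monopole.hedgehogPotential γ g K₂)
            (Monopole.hedgehogHiggs γ H₀ U₂) x) →
          EqOn K₂ K (Ici 0) ∧ EqOn U₂ U (Ici 0)) := by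
  obtain ⟨K, U, h, hK, hU, hO, hO'⟩ := Monopole.exists_isRegularRadial hg hH₀
  have hsol : Monopole.SolvesBVP g H₀ K U :=
    (Monopole.solvesBVP_iff_isRadial hg hH₀).2 h.toIsRadial
  have huniq : ∀ K₂ U₂ : ℝ → ℝ, Monopole.SolvesBVP g H₀ K₂ U₂ →
      EqOn K₂ K (Ici 0) ∧ EqOn U₂ U (Ici 0) := fun K₂ U₂ h₂ =>
    Monopole.SolvesBVP.eqOn hg hH₀ hsol h₂
  refine ⟨K, U, hsol, huniq, hK, hU, hO, hO', h.U_sub_one_isTheta, h.K_sub_one_isTheta,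
    h.U_isTheta (by positivity), fun γ hγ => ?_⟩
  have hC1 := Monopole.hedgehog_isC1 hγ hg hH₀ h
  have hb := hC1.bogomolnyAt_of_ne_zero fun x hx =>
    Monopole.bogomolnyAt_of_radial hγ hg.ne' hH₀.ne' h.toIsRadial hx
  refine ⟨Monopole.hedgehog_isSO5Valued hγ g H₀ K U, hC1, hb,
    Monopole.hedgehog_isSphericallySymmetric hγ g H₀ K U,
    fun lam _ => Monopole.integrable_energyDensity hγ hg hH₀ h hb lam,
    Monopole.charge_hedgehog hγ hg hH₀ h hb, ?_⟩
  intro K₂ U₂ hK₂ hU₂ hKc hUc hK0 hU0 hKi hUi hb₂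
  have hKd : ∀ r > 0, DifferentiableAt ℝ K₂ r := fun r hr =>
    (hK₂ r hr).differentiableAt (Ioi_mem_nhds hr)
  have hUd : ∀ r > 0, DifferentiableAt ℝ U₂ r := fun r hr =>
    (hU₂ r hr).differentiableAt (Ioi_mem_nhds hr)
  have hode := fun (r : ℝ) (hr : 0 < r) => Monopole.radial_of_bogomolnyAt hγ hg.ne' hH₀.ne' hr
    (hKd r hr) (hUd r hr) (hb₂ _ (by simpa using hr.ne'))
  exact huniq K₂ U₂ ((Monopole.solvesBVP_iff_isRadial hg hH₀).2
    ⟨hKd, hUd, fun r hr => (hode r hr).1, fun r hr => (hode r hr).2, hK0, hU0, hKc, hUc, hKi, hUi⟩)
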